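/- Let $\mathcal G$ be an ample groupoid, that is, a topological groupoid (not necessarily Hausdorff) whose unit space $\mathcal G^0$ is locally compact, Hausdorff and totally disconnected and whose source map $s$ is a local homeomorphism; let $r$ denote the range map. For a space $X$ with a basis of compact open sets let $\mathbb ZX$ be the group of functions $X\to\mathbb Z$ generated by the characteristic functions of the compact (quasi-compact and Hausdorff) open subsets of $X$. Then $\mathbb Z\mathcal G$ is a ring under convolution $(f*h)(g)=\sum_{r(a)=r(g)}f(a)h(a^{-1}g)$, and $\mathbb Z\mathcal G^0$ is a right $\mathbb Z\mathcal G$-module under $(hf)(x)=\sum_{s(g)=x}h(r(g))f(g)$. A left $\mathbb Z\mathcal G$-module $M$ is unitary if $\mathbb Z\mathcal G\cdot M=M$, and for such $M$ one sets $H_n(\mathcal G,M)=\operatorname{Tor}_n^{\mathbb Z\mathcal G}(\mathbb Z\mathcal G^0,M)$, where $\operatorname{Tor}$ is formed in the category of unitary modules. Let $M$ be a unitary left $\mathbb Z\mathcal G$-module and let $U\subseteq\mathcal G^0$ be open and invariant (a union of orbits), with complement $C=\mathcal G^0\setminus U$. Let $\mathcal G^U_U$ and $\mathcal G^C_C$ be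 the ample groupoids of the arrows with source and range in $U$, respectively in $C$. Regard $\mathbb Z\mathcal G^U_U$ as an ideal of $\mathbb Z\mathcal G$ by extension by zero, and regard $M/\mathbb Z\mathcal G^U_U\cdot M$ as a $\mathbb Z\mathcal G^C_C$-module through the isomorphism $\mathbb Z\mathcal G/\mathbb Z\mathcal G^U_U\cong\mathbb Z\mathcal G^C_C$ given by restriction. Then there is a long exact sequence of abelian groups \[ \cdots\to H_{n+1}(\mathcal G^C_C,M/\mathbb Z\mathcal G^U_U\cdot M)\to H_n(\mathcal G^U_U,\mathbb Z\mathcal G^U_U\cdot M)\to H_n(\mathcal G,M)\to H_n(\mathcal G^C_C,M/\mathbb Z\mathcal G^U_U\cdot M)\to\cdots \] \[ \cdots\to H_0(\mathcal G^U_U,\mathbb Z\mathcal G^U_U\cdot M)\to H_0(\mathcal G,M)\to H_0(\mathcal G^C_C,M/\mathbb Z\mathcal G^U_U\cdot M)\to 0 . \] Moreover, there are isomorphisms $H_n(\mathcal G^U_U,\mathbb Z\mathcal G^U_U\cdot M)\cong H_n(\mathcal G,\mathbb Z\mathcal G^U_U\cdot M)$ and $H_n(\mathcal G,M/\mathbb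 Z\mathcal G^U_U\cdot M)\cong H_n(\mathcal G^C_C,M/\mathbb Z\mathcal G^U_U\cdot M)$ for all $n\ge 0$ under which the maps into and out of $H_n(\mathcal G,M)$ in this sequence are induced by the inclusion $\mathbb Z\mathcal G^U_U\cdot M\to M$ and the projection $M\to M/\mathbb Z\mathcal G^U_U\cdot M$. -/

import Mathlib

open CategoryTheory
open scoped TensorProduct

universe u

section Tensor

variable (S : Type u) [Ring S] (A : Type u) [AddCommGroup A] [Module Sᵐᵒᵖ A]

/-- The relations `a s ⊗ m = a ⊗ s m` in `A ⊗_ℤ M`. -/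
def balancedRelations (M : Type u) [AddCommGroup M] [Module S M] : AddSubgroup (A ⊗[ℤ] M) :=
  AddSubgroup.closure
    {x | ∃ (a : A) (s : S) (m : M), x = (MulOpposite.op s • a) ⊗ₜ[ℤ] m - a ⊗ₜ[ℤ] (s • m)}

/-- The tensor product `A ⊗_S M` of a right `S`-module and a left `S`-module over a ring `S`
that need not be commutative. -/
abbrev BalancedTensor (M : Type u) [AddCommGroup M] [Module S M] : Type u :=
  (A ⊗[ℤ] M) ⧸ balancedRelations S A M

/-- The homomorphism `A ⊗_S M → A ⊗_S N` induced by an `S`-linear map `M → N`. -/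
def BalancedTensor.map {M N : Type u} [AddCommGroup M] [Module S M] [AddCommGroup N] [Module S N]
    (f : M →ₗ[S] N) : BalancedTensor S A M →+ BalancedTensor S A N :=
  QuotientAddGroup.map _ _ (LinearMap.lTensor A f.toAddMonoidHom.toIntLinearMap).toAddMonoidHom <| by
    rw [balancedRelations, AddSubgroup.closure_le]
    rintro _ ⟨a, s, m, rfl⟩
    refine AddSubgroup.subset_closure ⟨a, s, f m, ?_⟩
    simp

/-- The functor `A ⊗_S -` from left `S`-modules to abelian groups. -/
def tensorFunctor : ModuleCat.{u} S ⥤ AddCommGrpCat.{u} where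
  obj M := AddCommGrpCat.of (BalancedTensor S A M)
  map f := AddCommGrpCat.ofHom (BalancedTensor.map S A f.hom)
  map_id M := by
    ext x
    change A ⊗[ℤ] M at x
    induction x with
    | zero => simp
    | tmul a m => rfl
    | add x y hx hy => rw [map_add, hx, hy, map_add]
  map_comp {M N P} f g := by
    ext x
    change A ⊗[ℤ] M at x
    induction x with
    | zero => simp
    | tmul a m => rfl
    | add x y hx hy => rw [map_add, hx, hy, map_add]

instance tensorFunctor_additive : (tensorFunctor S A).Additive where
  map_add {M N f g} := by
    ext x
    obtain ⟨x, rfl⟩ := QuotientAddGroup.mk_surjective x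
    induction x with
    | zero => exact (map_zero _).trans (map_zero _).symm
    | tmul a m =>
      exact congrArg (QuotientAddGroup.mk' (balancedRelations S A N))
        (TensorProduct.tmul_add a (f.hom m) (g.hom m))
    | add x y hx hy => exact (map_add _ _ _).trans ((congrArg₂ _ hx hy).trans (map_add _ _ _).symm)

end Tensor

section Unitization

variable (R : Type u) [NonUnitalRing R]

/-- The unitization `ℤ ⊕ R` of a ring `R` that need not be unital. -/
def Unitized : Type u := Unitization ℤ R

instance : Ring (Unitized R) := inferInstanceAs (Ring (Unitization ℤ R))

variable {R}

namespace Unitized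

/-- The inclusion of a ring in its unitization. -/
def inr : R →ₙ+* Unitized R where
  toFun r := (r : Unitization ℤ R)
  map_mul' := Unitization.inr_mul ℤ
  map_zero' := Unitization.inr_zero ℤ
  map_add' := Unitization.inr_add ℤ

lemma exists_eq (s : Unitized R) : ∃ (n : ℤ) (r : R), s = n + inr r := by
  refine ⟨s.toProd.1, s.toProd.2, ?_⟩
  have h := (Unitization.inl_fst_add_inr_snd_eq s).symm
  have h' : (Unitization.inl s.toProd.1 : Unitization ℤ R) = ((s.toProd.1 : ℤ) : Unitization ℤ R) :=
    eq_intCast (Unitization.inlRingHom ℤ R) _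
  rw [h'] at h
  exact h

lemma intCast_add_inr_inj {n n' : ℤ} {r r' : R}
    (h : (n : Unitized R) + inr r = n' + inr r') : n = n' ∧ r = r' := by
  have key (n : ℤ) (r : R) : (n : Unitized R) + inr r = Unitization.mk (n, r) := by
    have h' : (Unitization.inl n : Unitization ℤ R) = (n : Unitization ℤ R) :=
      eq_intCast (Unitization.inlRingHom ℤ R) _
    have := Unitization.inl_fst_add_inr_snd_eq (Unitization.mk (n, r) : Unitization ℤ R)
    rw [← this, Unitization.toProd_mk, h']
    rfl
  rw [key, key] at h
  exact Prod.ext_iff.1 (Unitization.mk_injective h)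

/-- A homomorphism from `R` to a unital ring extends to the unitization of `R`. -/
def lift {T : Type*} [Ring T] (φ : R →ₙ+* T) : Unitized R →+* T where
  toFun s := (s.toProd.1 : T) + φ s.toProd.2
  map_one' := by
    change ((1 : ℤ) : T) + φ 0 = 1
    simp
  map_zero' := by
    change ((0 : ℤ) : T) + φ 0 = 0
    simp
  map_mul' s t := by
    change ((s.toProd.1 * t.toProd.1 : ℤ) : T)
      + φ (s.toProd.1 • t.toProd.2 + t.toProd.1 • s.toProd.2 + s.toProd.2 * t.toProd.2) = _
    rw [Int.cast_mul, map_add, map_add, map_mul, map_zsmul, map_zsmul, zsmul_eq_mul, zsmul_eq_mul,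
      add_mul, mul_add, mul_add, (Int.cast_commute t.toProd.1 (φ s.toProd.2)).eq]
    abel
  map_add' s t := by
    change ((s.toProd.1 + t.toProd.1 : ℤ) : T) + φ (s.toProd.2 + t.toProd.2) = _
    simp only [Int.cast_add, map_add]
    abel

@[simp] lemma lift_inr {T : Type*} [Ring T] (φ : R →ₙ+* T) (r : R) : lift φ (inr r) = φ r := by
  change ((0 : ℤ) : T) + φ r = φ r
  simp

/-- The homomorphism of unitizations induced by a ring homomorphism. -/
def map {R' : Type u} [NonUnitalRing R'] (φ : R →ₙ+* R') : Unitized R →+* Unitized R' :=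
  lift ((inr (R := R')).comp φ)

@[simp] lemma map_inr {R' : Type u} [NonUnitalRing R'] (φ : R →ₙ+* R') (r : R) :
    map φ (inr r) = inr (φ r) := by
  simp [map]

end Unitized

end Unitization

section Unitary

variable (R : Type u) [NonUnitalRing R]

/-- A ring `R`, not necessarily unital, has local units if every finite subset of `R` has a
common two-sided idempotent unit. -/
class HasLocalUnits : Prop where
  exists_unit (F : Finset R) : ∃ e : R, e * e = e ∧ ∀ r ∈ F, e * r = r ∧ r * e = r

/-- Left modules over the ring `R`, which need not be unital, are the same thing as left modules
over its unitization.  The submodule `R · M` of such a module `M` is generated by all `r m`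
with `r` in `R` and `m` in `M`. -/
def unitaryPart (M : Type u) [AddCommGroup M] [Module (Unitized R) M] :
    Submodule (Unitized R) M :=
  Submodule.span _ {x | ∃ (r : R) (m : M), x = Unitized.inr r • m}

/-- A left `R`-module `M` is unitary if `R · M = M`. -/
def IsUnitary : ObjectProperty (ModuleCat.{u} (Unitized R)) :=
  fun M => unitaryPart R M = ⊤

/-- The category of unitary left `R`-modules. -/
abbrev UnitaryMod : Type (u + 1) := (IsUnitary R).FullSubcategory

variable {R}

lemma smul_mem_unitaryPart {M : Type u} [AddCommGroup M] [Module (Unitized R) M]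
    (r : R) (m : M) : Unitized.inr r • m ∈ unitaryPart R M :=
  Submodule.subset_span ⟨r, m, rfl⟩

variable [HasLocalUnits R]

lemma mem_unitaryPart_iff {M : Type u} [AddCommGroup M] [Module (Unitized R) M] (m : M) :
    m ∈ unitaryPart R M ↔ ∃ e : R, e * e = e ∧ Unitized.inr e • m = m := by
  constructor
  · intro h
    suffices H : ∃ F : Finset R, ∀ e : R, (∀ r ∈ F, e * r = r) → Unitized.inr e • m = m by
      obtain ⟨F, hF⟩ := H
      obtain ⟨e, he, h⟩ := HasLocalUnits.exists_unit F
      exact ⟨e, he, hF e fun r hr => (h r hr).1⟩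
    classical
    induction h using Submodule.span_induction with
    | mem x h =>
      obtain ⟨r, m, rfl⟩ := h
      refine ⟨{r}, fun e he => ?_⟩
      rw [smul_smul, ← map_mul, he r (by simp)]
    | zero => exact ⟨∅, by simp⟩
    | add x y _ _ hx hy =>
      obtain ⟨F, hF⟩ := hx
      obtain ⟨F', hF'⟩ := hy
      refine ⟨F ∪ F', fun e he => ?_⟩
      rw [smul_add, hF e fun r hr => he r (by simp [hr]), hF' e fun r hr => he r (by simp [hr])]
    | smul s x _ hx =>
      obtain ⟨F, hF⟩ := hx
      obtain ⟨d, -, hd⟩ := HasLocalUnits.exists_unit F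
      have hdx := hF d fun r hr => (hd r hr).1
      obtain ⟨n, r, rfl⟩ := Unitized.exists_eq s
      have hc : ((n : Unitized R) + Unitized.inr r) * Unitized.inr d
          = Unitized.inr (n • d + r * d) := by
        simp [add_mul]
      refine ⟨{n • d + r * d}, fun e he => ?_⟩
      rw [← hdx, smul_smul ((n : Unitized R) + Unitized.inr r), hc, smul_smul, ← map_mul,
        he _ (by simp)]
  · rintro ⟨e, -, h⟩
    rw [← h]
    exact smul_mem_unitaryPart e m

lemma isUnitary_iff (M : ModuleCat.{u} (Unitized R)) :
    IsUnitary R M ↔ ∀ m : M, ∃ e : R, e * e = e ∧ Unitized.inr e • m = m := by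
  simp_rw [← mem_unitaryPart_iff, IsUnitary, Submodule.eq_top_iff']

lemma isUnitary_unitaryPart (M : Type u) [AddCommGroup M] [Module (Unitized R) M] :
    IsUnitary R (ModuleCat.of _ (unitaryPart R M)) := by
  rw [isUnitary_iff]
  rintro ⟨m, hm⟩
  obtain ⟨e, he, h⟩ := (mem_unitaryPart_iff m).1 hm
  exact ⟨e, he, Subtype.ext h⟩

instance : (IsUnitary R).IsClosedUnderSubobjects where
  prop_of_mono {X Y} f _ hY := by
    rw [isUnitary_iff] at hY ⊢
    intro m
    obtain ⟨e, he, h⟩ := hY (f m)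
    refine ⟨e, he, (ModuleCat.mono_iff_injective f).1 inferInstance ?_⟩
    rw [map_smul, h]

instance : (IsUnitary R).IsClosedUnderQuotients where
  prop_of_epi {X Y} f _ hX := by
    rw [isUnitary_iff] at hX ⊢
    intro m
    obtain ⟨m, rfl⟩ := (ModuleCat.epi_iff_surjective f).1 inferInstance m
    obtain ⟨e, he, h⟩ := hX m
    refine ⟨e, he, ?_⟩
    rw [← map_smul, h]

instance : (IsUnitary R).ContainsZero where
  exists_zero := ⟨ModuleCat.of _ PUnit, ModuleCat.isZero_of_subsingleton _, by
    rw [isUnitary_iff]; exact fun m => ⟨0, by simp, Subsingleton.elim _ _⟩⟩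

open Limits in
instance : (IsUnitary R).IsClosedUnderFiniteProducts := by
  classical
  refine ⟨fun J _ => ⟨?_⟩⟩
  rintro X ⟨p⟩
  have : Fintype J := Fintype.ofFinite J
  rw [isUnitary_iff]
  intro m
  have h (j : J) := (isUnitary_iff _).1 (p.prop_diag_obj ⟨j⟩) (p.π.app ⟨j⟩ m)
  choose d hd hdm using h
  obtain ⟨e, he, h⟩ := HasLocalUnits.exists_unit (Finset.univ.image d)
  refine ⟨e, he, Concrete.isLimit_ext p.diag p.isLimit _ _ ?_⟩
  rintro ⟨j⟩
  change p.π.app ⟨j⟩ _ = p.π.app ⟨j⟩ _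
  rw [map_smul, ← hdm, smul_smul, ← map_mul, (h (d j) (by simp)).1]

noncomputable instance : Abelian (UnitaryMod R) := inferInstance

/-- Every unitary module is a quotient of a direct sum of modules `R e` with `e` an idempotent,
which are projective. -/
instance : EnoughProjectives (UnitaryMod R) where
  presentation M := by
    classical
    have hM := (isUnitary_iff M.obj).1 M.property
    choose e he h using hM
    let P (m : M.obj) : Submodule (Unitized R) (Unitized R) := Unitized R ∙ Unitized.inr (e m)
    have hfix (m : M.obj) (x : P m) : x.1 * Unitized.inr (e m) = x.1 := by
      obtain ⟨x, hx⟩ := x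
      obtain ⟨s, rfl⟩ := Submodule.mem_span_singleton.1 hx
      simp only [smul_eq_mul, mul_assoc, ← map_mul, he]
    have hproj (m : M.obj) : Module.Projective (Unitized R) (P m) := by
      refine Module.Projective.of_split (P m).subtype
        ((LinearMap.toSpanSingleton (Unitized R) (Unitized R) (Unitized.inr (e m))).codRestrict
          (P m) fun s => Submodule.mem_span_singleton.2 ⟨s, rfl⟩) ?_
      ext x
      exact hfix m x
    let gen (m : M.obj) : P m := ⟨Unitized.inr (e m), Submodule.mem_span_singleton_self _⟩
    have hgen (m : M.obj) (x : P m) : ∃ r : R, x = Unitized.inr r • gen m := by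
      obtain ⟨n, r, hr⟩ := Unitized.exists_eq x.1
      refine ⟨n • e m + r * e m, Subtype.ext ?_⟩
      have : x.1 = Unitized.inr (n • e m + r * e m) := by
        rw [← hfix m x, hr]
        simp [add_mul]
      rw [← hfix m x, this]
      rfl
    let Q : ModuleCat.{u} (Unitized R) := ModuleCat.of _ (Π₀ m : M.obj, P m)
    have hQ : IsUnitary R Q := by
      rw [IsUnitary, Submodule.eq_top_iff']
      intro x
      change Π₀ m : M.obj, P m at x
      induction x using DFinsupp.induction with
      | h0 => exact zero_mem _
      | ha m b f _ _ hf =>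
        refine add_mem ?_ hf
        obtain ⟨r, rfl⟩ := hgen m b
        rw [DFinsupp.single_smul]
        exact smul_mem_unitaryPart r (DFinsupp.single m (gen m) : Π₀ m : M.obj, P m)
    let f : Q ⟶ M.obj := ModuleCat.ofHom <| DFinsupp.lsum ℕ fun m =>
      (LinearMap.toSpanSingleton (Unitized R) M.obj m).comp (P m).subtype
    have hf : Epi f := by
      rw [ModuleCat.epi_iff_surjective]
      intro m
      refine ⟨DFinsupp.single m (gen m), ?_⟩
      refine (DFinsupp.lsum_single ℕ (M := fun m => P m) _ m (gen m)).trans ?_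
      exact h m
    have := (IsUnitary R).preservesEpimorphisms_ι_of_isNormalMonoCategory
    have hQ' : Projective Q := (IsProjective.iff_projective _).1 inferInstance
    exact ⟨{
      p := ⟨Q, hQ⟩
      projective := (IsUnitary R).ι.projective_of_map_projective hQ'
      f := (IsUnitary R).homMk f
      epi := (IsUnitary R).ι.epi_of_epi_map hf }⟩

variable (A : Type u) [AddCommGroup A] [Module (Unitized R)ᵐᵒᵖ A]

/-- `Tor_n^R(A, M)` for a right `R`-module `A` and a unitary left `R`-module `M`, as a functor
of `M`: the left derived functors of `A ⊗_R -` on the category of unitary left `R`-modules. -/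
noncomputable def torFunctor (n : ℕ) : UnitaryMod R ⥤ AddCommGrpCat.{u} :=
  ((IsUnitary R).ι ⋙ tensorFunctor (Unitized R) A).leftDerived n

end Unitary
section Spaces

/-- The abelian group `ℤX` of functions `X → ℤ` generated by the characteristic functions of the
compact (that is, quasi-compact and Hausdorff) open subsets of `X`. -/
def compactOpenSpan (X : Type u) [TopologicalSpace X] : AddSubgroup (X → ℤ) :=
  AddSubgroup.closure
    {f | ∃ K : Set X, IsOpen K ∧ IsCompact K ∧ T2Space K ∧ f = K.indicator 1}

lemma exists_compactOpen {X : Type u} [TopologicalSpace X] [LocallyCompactSpace X] [T2Space X]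
    [TotallyDisconnectedSpace X] {x : X} {O : Set X} (hO : IsOpen O) (hx : x ∈ O) :
    ∃ W : Set X, IsOpen W ∧ IsCompact W ∧ x ∈ W ∧ W ⊆ O := by
  obtain ⟨N, hN, hxN, hNO⟩ := exists_compact_subset hO hx
  obtain ⟨W, hW, hxW, hWN⟩ :=
    (loc_compact_Haus_tot_disc_of_zero_dim (H := X)).mem_nhds_iff.1 (isOpen_interior.mem_nhds hxN)
  exact ⟨W, hW.isOpen, hN.of_isClosed_subset hW.isClosed (hWN.trans interior_subset), hxW,
    (hWN.trans interior_subset).trans hNO⟩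

lemma exists_compactOpen_of_isCompact {X : Type u} [TopologicalSpace X] [LocallyCompactSpace X]
    [T2Space X] [TotallyDisconnectedSpace X] {A O : Set X} (hA : IsCompact A) (hO : IsOpen O)
    (hAO : A ⊆ O) : ∃ W : Set X, IsOpen W ∧ IsCompact W ∧ A ⊆ W ∧ W ⊆ O := by
  choose! W hWo hWc hxW hWO using fun x (hx : x ∈ O) => exists_compactOpen hO hx
  obtain ⟨t, htA, ht⟩ := hA.elim_nhds_subcover W fun x hx => (hWo x (hAO hx)).mem_nhds (hxW x (hAO hx))
  exact ⟨⋃ x ∈ t, W x, isOpen_biUnion fun x hx => hWo x (hAO (htA x hx)),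
    t.isCompact_biUnion fun x hx => hWc x (hAO (htA x hx)), ht,
    Set.iUnion₂_subset fun x hx => hWO x (hAO (htA x hx))⟩

end Spaces

/-- An ample groupoid: a topological groupoid, not necessarily Hausdorff, whose unit space is
locally compact, Hausdorff and totally disconnected and whose source map is a local homeomorphism.
The product `g h` is defined when the source of `g` is the range of `h`.  The unit space is
presented as a separate space `Obj` with a continuous map `unit` to the space of arrows;
this map is automatically an embedding, as the source map is a continuous left inverse. -/
structure AmpleGroupoid where
  /-- the unit space -/
  Obj : Type u
  /-- the space of arrows -/
  Arr : Type u
  [topObj : TopologicalSpace Obj]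
  [topArr : TopologicalSpace Arr]
  [locallyCompactSpace : LocallyCompactSpace Obj]
  [t2Space : T2Space Obj]
  [totallyDisconnectedSpace : TotallyDisconnectedSpace Obj]
  /-- the source of an arrow -/
  src : Arr → Obj
  /-- the range of an arrow -/
  rng : Arr → Obj
  /-- the identity arrows -/
  unit : Obj → Arr
  /-- the inverse of an arrow -/
  inv : Arr → Arr
  /-- the product of two composable arrows -/
  comp (g h : Arr) (H : src g = rng h) : Arr
  src_unit (x : Obj) : src (unit x) = x
  rng_unit (x : Obj) : rng (unit x) = x
  src_inv (g : Arr) : src (inv g) = rng g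
  rng_inv (g : Arr) : rng (inv g) = src g
  src_comp (g h : Arr) (H : src g = rng h) : src (comp g h H) = src h
  rng_comp (g h : Arr) (H : src g = rng h) : rng (comp g h H) = rng g
  comp_assoc (g h k : Arr) (H : src g = rng h) (H' : src h = rng k) :
    comp (comp g h H) k ((src_comp g h H).trans H') =
      comp g (comp h k H') (H.trans (rng_comp h k H').symm)
  unit_comp (g : Arr) : comp (unit (rng g)) g (src_unit _) = g
  comp_unit (g : Arr) : comp g (unit (src g)) (rng_unit _).symm = g
  inv_comp (g : Arr) : comp (inv g) g (src_inv g) = unit (src g)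
  comp_inv (g : Arr) : comp g (inv g) (rng_inv g).symm = unit (rng g)
  continuous_unit : Continuous unit
  continuous_inv : Continuous inv
  continuous_comp : Continuous fun p : {p : Arr × Arr // src p.1 = rng p.2} =>
    comp p.1.1 p.1.2 p.2
  isLocalHomeomorph_src : IsLocalHomeomorph src

namespace AmpleGroupoid

attribute [instance] topObj topArr locallyCompactSpace t2Space totallyDisconnectedSpace

variable (G : AmpleGroupoid.{u})

lemma inv_inv (g : G.Arr) : G.inv (G.inv g) = g := by
  have h1 := G.comp_assoc (G.inv (G.inv g)) (G.inv g) g (G.src_inv _) (G.src_inv _)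
  simp only [G.inv_comp] at h1
  have h2 := G.unit_comp g
  have h3 := G.comp_unit (G.inv (G.inv g))
  have e : G.src (G.inv g) = G.rng g := G.src_inv g
  have e' : G.src (G.inv (G.inv g)) = G.src g := (G.src_inv _).trans (G.rng_inv g)
  simp only [e] at h1
  simp only [e'] at h3
  rw [← h3, ← h1, h2]

lemma rng_eq : G.rng = G.src ∘ G.inv := funext fun g => (G.src_inv g).symm

lemma continuous_src : Continuous G.src := G.isLocalHomeomorph_src.continuous

/-- Inversion is a homeomorphism. -/
def invHomeo : G.Arr ≃ₜ G.Arr where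
  toFun := G.inv
  invFun := G.inv
  left_inv := G.inv_inv
  right_inv := G.inv_inv
  continuous_toFun := G.continuous_inv
  continuous_invFun := G.continuous_inv

lemma isLocalHomeomorph_rng : IsLocalHomeomorph G.rng := by
  rw [G.rng_eq]
  exact G.isLocalHomeomorph_src.comp G.invHomeo.isLocalHomeomorph

lemma continuous_rng : Continuous G.rng := G.isLocalHomeomorph_rng.continuous

variable {G}

lemma inv_comp_comp (g h : G.Arr) (H : G.src g = G.rng h) :
    G.comp (G.inv g) (G.comp g h H) ((G.src_inv g).trans (G.rng_comp g h H).symm) = h := by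
  rw [← G.comp_assoc _ _ _ (G.src_inv g) H]
  simp only [G.inv_comp, H, G.unit_comp]

lemma comp_inv_comp (g h : G.Arr) (H : G.rng g = G.rng h) :
    G.comp g (G.comp (G.inv g) h ((G.src_inv g).trans H))
      ((G.rng_inv g).symm.trans (G.rng_comp _ _ _).symm) = h := by
  rw [← G.comp_assoc _ _ _ (G.rng_inv g).symm]
  simp only [G.comp_inv, H, G.unit_comp]

/-- The compact bisections: the compact open sets of arrows on which the source map and the range
map are injective. -/
structure IsCompactBisection (K : Set G.Arr) : Prop where
  isOpen : IsOpen K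
  isCompact : IsCompact K
  injOn_src : Set.InjOn G.src K
  injOn_rng : Set.InjOn G.rng K

lemma t2Space_of_injOn {K : Set G.Arr} (hK : Set.InjOn G.src K) : T2Space K :=
  T2Space.of_injective_continuous (f := fun k : K => G.src k)
    (fun x y h => Subtype.ext (hK x.2 y.2 h)) (G.continuous_src.comp continuous_subtype_val)

lemma IsCompactBisection.indicator_mem {K : Set G.Arr} (hK : IsCompactBisection K) :
    (K.indicator 1 : G.Arr → ℤ) ∈ compactOpenSpan G.Arr :=
  AddSubgroup.subset_closure ⟨K, hK.isOpen, hK.isCompact, t2Space_of_injOn hK.injOn_src, rfl⟩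

/-- A piece of a set of arrows lying over a compact open set of sources. -/
lemma isCompact_inter_src {O : Set G.Arr} (hO : IsOpen O) (hinj : Set.InjOn G.src O)
    {W : Set G.Obj} (hW : IsCompact W) (hWO : W ⊆ G.src '' O) :
    IsCompact (O ∩ G.src ⁻¹' W) := by
  have hemb : Topology.IsOpenEmbedding (fun k : O => G.src k) :=
    (G.isLocalHomeomorph_src.comp hO.isOpenEmbedding_subtypeVal.isLocalHomeomorph).isOpenEmbedding_of_injective
      fun x y h => Subtype.ext (hinj x.2 y.2 h)
  have h1 : IsCompact ((fun k : O => G.src k) ⁻¹' W) := by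
    refine hemb.isInducing.isCompact_preimage' hW ?_
    rintro x hx
    obtain ⟨k, hk, rfl⟩ := hWO hx
    exact ⟨⟨k, hk⟩, rfl⟩
  have h2 := h1.image continuous_subtype_val
  convert h2
  ext k
  simp only [Set.mem_inter_iff, Set.mem_preimage, Set.mem_image, Subtype.exists, exists_and_right,
    exists_eq_right]
  exact ⟨fun h => ⟨h.1, h.2⟩, fun h => ⟨h.1, h.2⟩⟩

lemma exists_bisection {g : G.Arr} {O : Set G.Arr} (hO : IsOpen O) (hg : g ∈ O) :
    ∃ V, IsCompactBisection V ∧ g ∈ V ∧ V ⊆ O := by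
  obtain ⟨e, he, hes⟩ := G.isLocalHomeomorph_src g
  obtain ⟨e', he', hes'⟩ := G.isLocalHomeomorph_rng g
  let O' := O ∩ e.source ∩ e'.source
  have hO' : IsOpen O' := (hO.inter e.open_source).inter e'.open_source
  have hinj : Set.InjOn G.src O' := by
    rw [hes]; exact e.injOn.mono fun x hx => hx.1.2
  have hinj' : Set.InjOn G.rng O' := by
    rw [hes']; exact e'.injOn.mono fun x hx => hx.2
  obtain ⟨W, hWo, hWc, hgW, hW⟩ := exists_compactOpen
    (G.isLocalHomeomorph_src.isOpenMap O' hO') (Set.mem_image_of_mem G.src ⟨⟨hg, he⟩, he'⟩)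
  exact ⟨O' ∩ G.src ⁻¹' W, ⟨hO'.inter (hWo.preimage G.continuous_src),
    isCompact_inter_src hO' hinj hWc hW, hinj.mono Set.inter_subset_left,
    hinj'.mono Set.inter_subset_left⟩, ⟨⟨⟨hg, he⟩, he'⟩, hgW⟩, fun x hx => hx.1.1.1⟩

lemma IsCompactBisection.mono {V K : Set G.Arr} (hK : IsCompactBisection K) (hVK : V ⊆ K)
    (ho : IsOpen V) (hc : IsCompact V) : IsCompactBisection V :=
  ⟨ho, hc, hK.injOn_src.mono hVK, hK.injOn_rng.mono hVK⟩

lemma IsCompactBisection.inter_src {K : Set G.Arr} (hK : IsCompactBisection K) {W : Set G.Obj}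
    (hWo : IsOpen W) (hWc : IsCompact W) : IsCompactBisection (K ∩ G.src ⁻¹' W) :=
  hK.mono Set.inter_subset_left (hK.isOpen.inter (hWo.preimage G.continuous_src))
    (hK.isCompact.inter_right (hWc.isClosed.preimage G.continuous_src))

/-- `ℤG` is generated by the characteristic functions of the compact bisections. -/
lemma compactOpenSpan_eq : compactOpenSpan G.Arr = AddSubgroup.closure
    {f | ∃ K : Set G.Arr, IsCompactBisection K ∧ f = K.indicator 1} := by
  classical
  apply le_antisymm
  · rw [compactOpenSpan, AddSubgroup.closure_le]
    rintro _ ⟨K, hKo, hKc, hK2, rfl⟩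
    set B := AddSubgroup.closure
      {f : G.Arr → ℤ | ∃ K : Set G.Arr, IsCompactBisection K ∧ f = K.indicator 1} with hB
    have hinter {V V' : Set G.Arr} (h : IsCompact V) (h' : IsCompact V') (hV : V ⊆ K)
        (hV' : V' ⊆ K) : IsCompact (V ∩ V') := by
      have a := Topology.IsInducing.subtypeVal.isCompact_preimage' h (by simpa using hV)
      have a' := Topology.IsInducing.subtypeVal.isCompact_preimage' h' (by simpa using hV')
      have := (a.inter a').image continuous_subtype_val
      rwa [← Set.preimage_inter, Subtype.image_preimage_coe,
        Set.inter_eq_self_of_subset_right (Set.inter_subset_left.trans hV)] at this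
    have key : ∀ (t : Finset (Set G.Arr)), (∀ V ∈ t, IsCompactBisection V ∧ V ⊆ K) →
        ∀ V, IsOpen V → IsCompact V → V ⊆ K → (V ⊆ ⋃ W ∈ t, W) → V.indicator 1 ∈ B := by
      intro t
      induction t using Finset.induction_on with
      | empty =>
        intro _ V _ _ _ hV
        have : V = ∅ := by simpa using hV
        rw [this, Set.indicator_empty]
        exact zero_mem _
      | insert W t _ ih =>
        intro ht V hVo hVc hVK hV
        have hW := ht W (Finset.mem_insert_self _ _)
        have ht' := fun V hV => ht V (Finset.mem_insert_of_mem hV)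
        have hVW := hinter hVc hW.1.isCompact hVK hW.2
        have hcl : IsCompact (V \ W) := by
          have a := Topology.IsInducing.subtypeVal.isCompact_preimage' hVc (by simpa using hVK)
          have := (a.inter_right (hW.1.isOpen.preimage
            (continuous_subtype_val (p := (· ∈ K)))).isClosed_compl).image continuous_subtype_val
          rwa [← Set.preimage_compl, ← Set.preimage_inter, Subtype.image_preimage_coe,
            Set.inter_eq_self_of_subset_right (Set.inter_subset_left.trans hVK)] at this
        have hop : IsOpen (V \ W) := by
          have a := Topology.IsInducing.subtypeVal.isCompact_preimage' hW.1.isCompact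
            (by simpa using hW.2)
          have := hKo.isOpenMap_subtype_val _ ((hVo.preimage
            (continuous_subtype_val (p := (· ∈ K)))).inter a.isClosed.isOpen_compl)
          rwa [← Set.preimage_compl, ← Set.preimage_inter, Subtype.image_preimage_coe,
            Set.inter_eq_self_of_subset_right (Set.inter_subset_left.trans hVK)] at this
        have h1 : (V \ W).indicator 1 ∈ B := by
          refine ih ht' _ hop hcl (Set.sdiff_subset.trans hVK) ?_
          rintro x ⟨hx, hxW⟩
          have := hV hx
          rw [Finset.set_biUnion_insert] at this
          exact this.resolve_left hxW
        have h2 : (V ∩ W).indicator 1 ∈ B := AddSubgroup.subset_closure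
          ⟨V ∩ W, hW.1.mono Set.inter_subset_right (hVo.inter hW.1.isOpen) hVW, rfl⟩
        have h3 : (V.indicator 1 : G.Arr → ℤ) = (V \ W).indicator 1 + (V ∩ W).indicator 1 := by
          ext x
          by_cases hx : x ∈ V <;> by_cases hx' : x ∈ W <;> simp [hx, hx']
        rw [h3]
        exact add_mem h1 h2
    choose! V hV hgV hVK using fun g (hg : g ∈ K) => exists_bisection hKo hg
    obtain ⟨t, htK, ht⟩ := hKc.elim_nhds_subcover V fun g hg => (hV g hg).isOpen.mem_nhds (hgV g hg)
    refine key (t.image V) ?_ K hKo hKc subset_rfl (by simpa using ht)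
    intro W hW
    obtain ⟨g, hg, rfl⟩ := Finset.mem_image.1 hW
    exact ⟨hV g (htK g hg), hVK g (htK g hg)⟩
  · rw [AddSubgroup.closure_le]
    rintro _ ⟨K, hK, rfl⟩
    exact hK.indicator_mem

/-- The product of two sets of arrows. -/
def mulSet (V W : Set G.Arr) : Set G.Arr :=
  {k | ∃ g ∈ V, ∃ h ∈ W, ∃ H : G.src g = G.rng h, G.comp g h H = k}

lemma mulSet_assoc (U V W : Set G.Arr) : mulSet (mulSet U V) W = mulSet U (mulSet V W) := by
  ext k
  constructor
  · rintro ⟨_, ⟨g, hg, h, hh, H, rfl⟩, l, hl, H', rfl⟩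
    have H'' := (G.src_comp g h H).symm.trans H'
    exact ⟨g, hg, _, ⟨h, hh, l, hl, H'', rfl⟩, H.trans (G.rng_comp h l H'').symm,
      (G.comp_assoc g h l H H'').symm⟩
  · rintro ⟨g, hg, _, ⟨h, hh, l, hl, H', rfl⟩, H, rfl⟩
    have H'' := H.trans (G.rng_comp h l H')
    exact ⟨_, ⟨g, hg, h, hh, H'', rfl⟩, l, hl, (G.src_comp g h H'').trans H',
      G.comp_assoc g h l H'' H'⟩

lemma IsCompactBisection.mulSet {V W : Set G.Arr} (hV : IsCompactBisection V)
    (hW : IsCompactBisection W) : IsCompactBisection (mulSet V W) := by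
  refine ⟨?_, ?_, ?_, ?_⟩
  · rw [isOpen_iff_mem_nhds]
    rintro _ ⟨g, hg, h, hh, H, rfl⟩
    obtain ⟨e, he, hes⟩ := G.isLocalHomeomorph_rng g
    have hek (x : G.Obj) (hx : x ∈ e.target) : G.rng (e.symm x) = x := by
      rw [hes]; exact e.right_inv hx
    let O : Set G.Arr := G.rng ⁻¹' e.target
    have hO : IsOpen O := e.open_target.preimage G.continuous_rng
    let φ : O → G.Arr := fun k => G.comp (G.inv (e.symm (G.rng k))) k
      ((G.src_inv _).trans (hek _ k.2))
    have hσ : Continuous fun k : O => e.symm (G.rng k) :=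
      e.continuousOn_symm.comp_continuous (G.continuous_rng.comp continuous_subtype_val) fun k => k.2
    have hφ : Continuous φ := G.continuous_comp.comp
      (f := fun k : O => (⟨(G.inv (e.symm (G.rng k)), k.1), (G.src_inv _).trans (hek _ k.2)⟩ :
        {p : G.Arr × G.Arr // G.src p.1 = G.rng p.2}))
      (((G.continuous_inv.comp hσ).prodMk continuous_subtype_val).subtype_mk _)
    have hmem : G.comp g h H ∈ O := by
      change G.rng (G.comp g h H) ∈ e.target
      rw [G.rng_comp, hes]
      exact e.map_source he
    have hσg : e.symm (G.rng (G.comp g h H)) = g := by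
      rw [G.rng_comp, hes]; exact e.left_inv he
    have hopen : IsOpen (((fun k : O => e.symm (G.rng k)) ⁻¹' V) ∩ φ ⁻¹' W) :=
      (hV.isOpen.preimage hσ).inter (hW.isOpen.preimage hφ)
    refine Filter.mem_of_superset ((hO.isOpenMap_subtype_val _ hopen).mem_nhds
      ⟨⟨_, hmem⟩, ⟨?_, ?_⟩, rfl⟩) ?_
    · change e.symm _ ∈ V
      rwa [hσg]
    · change G.comp (G.inv (e.symm _)) _ _ ∈ W
      simp only [hσg]
      rwa [inv_comp_comp]
    · rintro _ ⟨k, ⟨hkV, hkW⟩, rfl⟩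
      exact ⟨_, hkV, _, hkW, (G.rng_inv _).symm.trans (G.rng_comp _ _ _).symm,
        comp_inv_comp _ _ (hek _ k.2)⟩
  · have hcl : IsClosed {p : G.Arr × G.Arr | G.src p.1 = G.rng p.2} :=
      isClosed_eq (G.continuous_src.comp continuous_fst) (G.continuous_rng.comp continuous_snd)
    have h1 := (hcl.isClosedEmbedding_subtypeVal.isCompact_preimage
      (hV.isCompact.prod hW.isCompact)).image G.continuous_comp
    convert h1
    ext k
    constructor
    · rintro ⟨g, hg, h, hh, H, rfl⟩
      exact ⟨⟨(g, h), H⟩, ⟨hg, hh⟩, rfl⟩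
    · rintro ⟨⟨⟨g, h⟩, H⟩, ⟨hg, hh⟩, rfl⟩
      exact ⟨g, hg, h, hh, H, rfl⟩
  · rintro _ ⟨g, hg, h, hh, H, rfl⟩ _ ⟨g', hg', h', hh', H', rfl⟩ he
    rw [G.src_comp, G.src_comp] at he
    obtain rfl := hW.injOn_src hh hh' he
    obtain rfl := hV.injOn_src hg hg' (H.trans H'.symm)
    rfl
  · rintro _ ⟨g, hg, h, hh, H, rfl⟩ _ ⟨g', hg', h', hh', H', rfl⟩ he
    rw [G.rng_comp, G.rng_comp] at he
    obtain rfl := hV.injOn_rng hg hg' he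
    obtain rfl := hW.injOn_rng hh hh' (H.symm.trans H')
    rfl

end AmpleGroupoid
namespace AmpleGroupoid

variable (G : AmpleGroupoid.{u})

/-- The convolution `(f * h)(k) = ∑_{r(a) = r(k)} f(a) h(a⁻¹ k)` of functions of arrows. -/
noncomputable def conv (f h : G.Arr → ℤ) (k : G.Arr) : ℤ :=
  ∑ᶠ a : {a : G.Arr // G.rng a = G.rng k},
    f a * h (G.comp (G.inv a) k ((G.src_inv _).trans a.2))

/-- The action `(h f)(x) = ∑_{s(g) = x} h(r(g)) f(g)` of functions of arrows on functions on the
unit space from the right. -/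
noncomputable def act (h : G.Obj → ℤ) (f : G.Arr → ℤ) (x : G.Obj) : ℤ :=
  ∑ᶠ g : {g : G.Arr // G.src g = x}, h (G.rng g) * f g

/-- The additive group of the groupoid algebra `ℤG`. -/
def Alg : Type u := compactOpenSpan G.Arr

/-- The additive group `ℤG⁰` of the trivial module. -/
def ObjAlg : Type u := compactOpenSpan G.Obj

instance : AddCommGroup G.Alg := inferInstanceAs (AddCommGroup (compactOpenSpan G.Arr))

instance : AddCommGroup G.ObjAlg := inferInstanceAs (AddCommGroup (compactOpenSpan G.Obj))

variable {G}

namespace Alg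

/-- The function underlying an element of `ℤG`. -/
def val : G.Alg →+ (G.Arr → ℤ) := (compactOpenSpan G.Arr).subtype

lemma ext {f h : G.Alg} (H : val f = val h) : f = h := Subtype.ext H

/-- The characteristic function of a compact bisection. -/
noncomputable def bis (K : Set G.Arr) (hK : IsCompactBisection K) : G.Alg :=
  ⟨K.indicator 1, hK.indicator_mem⟩

@[simp] lemma val_bis (K : Set G.Arr) (hK : IsCompactBisection K) :
    val (bis K hK) = K.indicator 1 := rfl

@[elab_as_elim]
lemma induction {p : G.Alg → Prop} (bis : ∀ K hK, p (bis K hK)) (zero : p 0)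
    (add : ∀ f h, p f → p h → p (f + h)) (neg : ∀ f, p f → p (-f)) (f : G.Alg) : p f := by
  obtain ⟨f, hf⟩ := f
  have hf' := hf
  rw [compactOpenSpan_eq] at hf'
  induction hf' using AddSubgroup.closure_induction with
  | mem f h =>
    obtain ⟨K, hK, rfl⟩ := h
    exact bis K hK
  | zero => exact zero
  | add f h hf1 hh1 hf2 hh2 =>
    rw [← compactOpenSpan_eq] at hf1 hh1
    exact add ⟨f, hf1⟩ ⟨h, hh1⟩ (hf2 hf1) (hh2 hh1)
  | neg f hf1 hf2 =>
    rw [← compactOpenSpan_eq] at hf1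
    exact neg ⟨f, hf1⟩ (hf2 hf1)

/-- Elements of `ℤG` have finitely many nonzero values on each fibre of the range map. -/
lemma finite_rng (f : G.Alg) (x : G.Obj) : {a | G.rng a = x ∧ val f a ≠ 0}.Finite := by
  induction f using induction with
  | bis K hK =>
    refine Set.Subsingleton.finite fun a ha b hb => ?_
    have h1 : a ∈ K := by by_contra h; exact ha.2 (by simp [h])
    have h2 : b ∈ K := by by_contra h; exact hb.2 (by simp [h])
    exact hK.injOn_rng h1 h2 (ha.1.trans hb.1.symm)
  | zero => simp
  | add f h hf hh =>
    refine (hf.union hh).subset fun a ha => ?_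
    by_contra hc
    simp only [Set.mem_union, Set.mem_ofPred_eq, ha.1, true_and, not_or, not_not] at hc
    exact ha.2 (by simp [hc.1, hc.2])
  | neg f hf => simpa using hf

/-- Elements of `ℤG` have finitely many nonzero values on each fibre of the source map. -/
lemma finite_src (f : G.Alg) (x : G.Obj) : {a | G.src a = x ∧ val f a ≠ 0}.Finite := by
  induction f using induction with
  | bis K hK =>
    refine Set.Subsingleton.finite fun a ha b hb => ?_
    have h1 : a ∈ K := by by_contra h; exact ha.2 (by simp [h])
    have h2 : b ∈ K := by by_contra h; exact hb.2 (by simp [h])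
    exact hK.injOn_src h1 h2 (ha.1.trans hb.1.symm)
  | zero => simp
  | add f h hf hh =>
    refine (hf.union hh).subset fun a ha => ?_
    by_contra hc
    simp only [Set.mem_union, Set.mem_ofPred_eq, ha.1, true_and, not_or, not_not] at hc
    exact ha.2 (by simp [hc.1, hc.2])
  | neg f hf => simpa using hf

lemma finite_support_conv (f : G.Alg) (h : G.Arr → ℤ) (k : G.Arr) :
    (Function.support fun a : {a : G.Arr // G.rng a = G.rng k} =>
      val f a * h (G.comp (G.inv a) k ((G.src_inv _).trans a.2))).Finite := by
  refine ((finite_rng f (G.rng k)).preimage Subtype.val_injective.injOn).subset fun a ha => ?_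
  exact ⟨a.2, left_ne_zero_of_mul ha⟩

lemma finite_support_act (h : G.Obj → ℤ) (f : G.Alg) (x : G.Obj) :
    (Function.support fun g : {g : G.Arr // G.src g = x} => h (G.rng g) * val f g).Finite := by
  refine ((finite_src f x).preimage Subtype.val_injective.injOn).subset fun a ha => ?_
  exact ⟨a.2, right_ne_zero_of_mul ha⟩

lemma conv_add_left (f f' : G.Alg) (h : G.Arr → ℤ) :
    G.conv (val (f + f')) h = G.conv (val f) h + G.conv (val f') h := by
  ext k
  rw [Pi.add_apply, conv, conv, conv,
    ← finsum_add_distrib (finite_support_conv f h k) (finite_support_conv f' h k)]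
  simp only [map_add, Pi.add_apply, add_mul]

lemma conv_add_right (f : G.Alg) (h h' : G.Arr → ℤ) :
    G.conv (val f) (h + h') = G.conv (val f) h + G.conv (val f) h' := by
  ext k
  rw [Pi.add_apply, conv, conv, conv,
    ← finsum_add_distrib (finite_support_conv f h k) (finite_support_conv f h' k)]
  simp only [Pi.add_apply, mul_add]

lemma act_add_left (h h' : G.Obj → ℤ) (f : G.Alg) :
    G.act (h + h') (val f) = G.act h (val f) + G.act h' (val f) := by
  ext k
  rw [Pi.add_apply, act, act, act,
    ← finsum_add_distrib (finite_support_act h f k) (finite_support_act h' f k)]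
  simp only [Pi.add_apply, add_mul]

lemma act_add_right (h : G.Obj → ℤ) (f f' : G.Alg) :
    G.act h (val (f + f')) = G.act h (val f) + G.act h (val f') := by
  ext k
  rw [Pi.add_apply, act, act, act,
    ← finsum_add_distrib (finite_support_act h f k) (finite_support_act h f' k)]
  simp only [map_add, Pi.add_apply, mul_add]

lemma conv_neg_left (f h : G.Arr → ℤ) : G.conv (-f) h = -G.conv f h := by
  ext k
  simp only [conv, Pi.neg_apply, neg_mul, finsum_neg_distrib]

lemma conv_neg_right (f h : G.Arr → ℤ) : G.conv f (-h) = -G.conv f h := by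
  ext k
  simp only [conv, Pi.neg_apply, mul_neg, finsum_neg_distrib]

lemma act_neg_left (h : G.Obj → ℤ) (f : G.Arr → ℤ) : G.act (-h) f = -G.act h f := by
  ext k
  simp only [act, Pi.neg_apply, neg_mul, finsum_neg_distrib]

lemma act_neg_right (h : G.Obj → ℤ) (f : G.Arr → ℤ) : G.act h (-f) = -G.act h f := by
  ext k
  simp only [act, Pi.neg_apply, mul_neg, finsum_neg_distrib]

lemma conv_zero_left (h : G.Arr → ℤ) : G.conv 0 h = 0 := by
  ext k; simp [conv]

lemma conv_zero_right (h : G.Arr → ℤ) : G.conv h 0 = 0 := by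
  ext k; simp [conv]

lemma act_zero_left (f : G.Arr → ℤ) : G.act 0 f = 0 := by
  ext k; simp [act]

lemma act_zero_right (h : G.Obj → ℤ) : G.act h 0 = 0 := by
  ext k; simp [act]

/-- The product of the characteristic functions of two bisections is that of their product. -/
lemma conv_bis {V W : Set G.Arr} (hV : Set.InjOn G.rng V) :
    G.conv (V.indicator 1) (W.indicator 1) = (mulSet V W).indicator 1 := by
  classical
  ext k
  by_cases hk : k ∈ mulSet V W
  · rw [Set.indicator_of_mem hk]
    obtain ⟨g, hg, h, hh, H, rfl⟩ := hk
    rw [conv, finsum_eq_single _ ⟨g, (G.rng_comp g h H).symm⟩]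
    · simp [inv_comp_comp, hg, hh]
    · rintro ⟨a, ha⟩ hne
      rw [Set.indicator_of_notMem, zero_mul]
      intro haV
      exact hne (Subtype.ext (hV haV hg (ha.trans (G.rng_comp g h H))))
  · rw [Set.indicator_of_notMem hk, conv, finsum_eq_zero_of_forall_eq_zero]
    rintro ⟨a, ha⟩
    by_cases haV : a ∈ V
    · rw [Set.indicator_of_notMem (s := W), mul_zero]
      intro hW
      exact hk ⟨a, haV, _, hW, (G.rng_inv _).symm.trans (G.rng_comp _ _ _).symm,
        comp_inv_comp _ _ ha⟩
    · simp [haV]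

lemma act_bis {W : Set G.Obj} {K : Set G.Arr} (hK : Set.InjOn G.src K) :
    G.act (W.indicator 1) (K.indicator 1) = (G.src '' (K ∩ G.rng ⁻¹' W)).indicator 1 := by
  classical
  ext x
  by_cases hx : x ∈ G.src '' (K ∩ G.rng ⁻¹' W)
  · rw [Set.indicator_of_mem hx]
    obtain ⟨g, ⟨hg, hgW⟩, rfl⟩ := hx
    rw [act, finsum_eq_single _ ⟨g, rfl⟩]
    · have : G.rng g ∈ W := hgW
      simp [hg, this]
    · rintro ⟨a, ha⟩ hne
      rw [Set.indicator_of_notMem (s := K), mul_zero]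
      intro haK
      exact hne (Subtype.ext (hK haK hg ha))
  · rw [Set.indicator_of_notMem hx, act, finsum_eq_zero_of_forall_eq_zero]
    rintro ⟨a, ha⟩
    by_cases haK : a ∈ K
    · rw [Set.indicator_of_notMem (s := W), zero_mul]
      intro hW
      exact hx ⟨a, ⟨haK, hW⟩, ha⟩
    · simp [haK]

lemma conv_mem (f h : G.Alg) : G.conv (val f) (val h) ∈ compactOpenSpan G.Arr := by
  induction f using induction with
  | bis V hV =>
    induction h using induction with
    | bis W hW =>
      rw [val_bis, val_bis, conv_bis hV.injOn_rng]
      exact (hV.mulSet hW).indicator_mem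
    | zero => rw [map_zero, conv_zero_right]; exact zero_mem _
    | add f h hf hh => rw [map_add, conv_add_right]; exact add_mem hf hh
    | neg f hf => rw [map_neg, conv_neg_right]; exact neg_mem hf
  | zero => rw [map_zero, conv_zero_left]; exact zero_mem _
  | add f h hf hh => rw [conv_add_left]; exact add_mem hf hh
  | neg f hf => rw [map_neg, conv_neg_left]; exact neg_mem hf

noncomputable instance : Mul G.Alg := ⟨fun f h => ⟨G.conv (val f) (val h), conv_mem f h⟩⟩

lemma val_mul (f h : G.Alg) : val (f * h) = G.conv (val f) (val h) := rfl

noncomputable instance : NonUnitalNonAssocRing G.Alg where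
  left_distrib f h k := ext (by simp only [val_mul, map_add, conv_add_right])
  right_distrib f h k := ext (by rw [val_mul, conv_add_left, map_add, val_mul, val_mul])
  zero_mul f := ext (by rw [val_mul, map_zero, conv_zero_left])
  mul_zero f := ext (by rw [val_mul, map_zero, conv_zero_right])

lemma bis_mul_bis (V W : Set G.Arr) (hV : IsCompactBisection V) (hW : IsCompactBisection W) :
    bis V hV * bis W hW = bis (mulSet V W) (hV.mulSet hW) :=
  ext (by rw [val_mul, val_bis, val_bis, conv_bis hV.injOn_rng, val_bis])

/-- The convolution ring `ℤG`. -/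
noncomputable instance : NonUnitalRing G.Alg where
  mul_assoc f h k := by
    induction f using induction with
    | bis U hU =>
      induction h using induction with
      | bis V hV =>
        induction k using induction with
        | bis W hW => simp only [bis_mul_bis, mulSet_assoc]
        | zero => simp only [mul_zero]
        | add f h hf hh => simp only [mul_add, hf, hh]
        | neg f hf => simp only [mul_neg, hf]
      | zero => simp only [mul_zero, zero_mul]
      | add f h hf hh => simp only [mul_add, add_mul, hf, hh]
      | neg f hf => simp only [mul_neg, neg_mul, hf]
    | zero => simp only [zero_mul]
    | add f h hf hh => simp only [add_mul, hf, hh]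
    | neg f hf => simp only [neg_mul, hf]

lemma isCompactBisection_unit {W : Set G.Obj} (hWo : IsOpen W) (hWc : IsCompact W) :
    IsCompactBisection (G.unit '' W) := by
  refine ⟨?_, hWc.image G.continuous_unit, ?_, ?_⟩
  · have : G.src ∘ G.unit = id := funext G.src_unit
    refine (G.isLocalHomeomorph_src.isOpenEmbedding_of_comp ?_ G.continuous_unit).isOpenMap W hWo
    rw [this]
    exact .id
  · rintro _ ⟨x, hx, rfl⟩ _ ⟨y, hy, rfl⟩ h
    rw [G.src_unit, G.src_unit] at h
    rw [h]
  · rintro _ ⟨x, hx, rfl⟩ _ ⟨y, hy, rfl⟩ h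
    rw [G.rng_unit, G.rng_unit] at h
    rw [h]

/-- The characteristic function of a compact open set of units. -/
noncomputable def idem (W : Set G.Obj) (hWo : IsOpen W) (hWc : IsCompact W) : G.Alg :=
  bis (G.unit '' W) (isCompactBisection_unit hWo hWc)

lemma mulSet_unit_left {W : Set G.Obj} {K : Set G.Arr} (h : ∀ k ∈ K, G.rng k ∈ W) :
    mulSet (G.unit '' W) K = K := by
  ext k
  constructor
  · rintro ⟨_, ⟨x, hx, rfl⟩, h, hh, H, rfl⟩
    rw [G.src_unit] at H
    subst H
    rwa [G.unit_comp]
  · intro hk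
    exact ⟨_, ⟨_, h k hk, rfl⟩, k, hk, _, G.unit_comp k⟩

lemma mulSet_unit_right {W : Set G.Obj} {K : Set G.Arr} (h : ∀ k ∈ K, G.src k ∈ W) :
    mulSet K (G.unit '' W) = K := by
  ext k
  constructor
  · rintro ⟨g, hg, _, ⟨x, hx, rfl⟩, H, rfl⟩
    have H' := H
    rw [G.rng_unit] at H'
    subst H'
    rwa [G.comp_unit]
  · intro hk
    exact ⟨k, hk, _, ⟨_, h k hk, rfl⟩, _, G.comp_unit k⟩

lemma idem_mul_self (W : Set G.Obj) (hWo : IsOpen W) (hWc : IsCompact W) :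
    idem W hWo hWc * idem W hWo hWc = idem W hWo hWc := by
  simp only [idem, bis_mul_bis]
  congr 1
  refine mulSet_unit_left ?_
  rintro _ ⟨x, hx, rfl⟩
  rwa [G.rng_unit]

lemma exists_unit (f : G.Alg) : ∃ A : Set G.Obj, IsOpen A ∧ IsCompact A ∧
    ∀ W hWo hWc, A ⊆ W → idem W hWo hWc * f = f ∧ f * idem W hWo hWc = f := by
  induction f using induction with
  | bis K hK =>
    refine ⟨G.rng '' K ∪ G.src '' K, (G.isLocalHomeomorph_rng.isOpenMap K hK.isOpen).union
      (G.isLocalHomeomorph_src.isOpenMap K hK.isOpen), (hK.isCompact.image G.continuous_rng).union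
      (hK.isCompact.image G.continuous_src), fun W hWo hWc h => ⟨?_, ?_⟩⟩
    · simp only [idem, bis_mul_bis]
      congr 1
      exact mulSet_unit_left fun k hk => h (.inl ⟨k, hk, rfl⟩)
    · simp only [idem, bis_mul_bis]
      congr 1
      exact mulSet_unit_right fun k hk => h (.inr ⟨k, hk, rfl⟩)
  | zero => exact ⟨∅, isOpen_empty, isCompact_empty, by simp⟩
  | add f h hf hh =>
    obtain ⟨A, hAo, hAc, hA⟩ := hf
    obtain ⟨B, hBo, hBc, hB⟩ := hh
    refine ⟨A ∪ B, hAo.union hBo, hAc.union hBc, fun W hWo hWc hW => ?_⟩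
    have h1 := hA W hWo hWc (Set.subset_union_left.trans hW)
    have h2 := hB W hWo hWc (Set.subset_union_right.trans hW)
    rw [mul_add, add_mul, h1.1, h1.2, h2.1, h2.2]
    exact ⟨rfl, rfl⟩
  | neg f hf =>
    obtain ⟨A, hAo, hAc, hA⟩ := hf
    refine ⟨A, hAo, hAc, fun W hWo hWc hW => ?_⟩
    rw [mul_neg, neg_mul, (hA W hWo hWc hW).1, (hA W hWo hWc hW).2]
    exact ⟨rfl, rfl⟩

instance : HasLocalUnits G.Alg where
  exists_unit F := by
    choose A hAo hAc hA using exists_unit (G := G)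
    have ho : IsOpen (⋃ f ∈ F, A f) := isOpen_biUnion fun f _ => hAo f
    have hc : IsCompact (⋃ f ∈ F, A f) := F.isCompact_biUnion fun f _ => hAc f
    exact ⟨idem _ ho hc, idem_mul_self _ _ _, fun f hf =>
      hA f _ ho hc (Set.subset_biUnion_of_mem (u := A) hf)⟩

end Alg

namespace ObjAlg

/-- The function underlying an element of `ℤG⁰`. -/
def val : G.ObjAlg →+ (G.Obj → ℤ) := (compactOpenSpan G.Obj).subtype

lemma ext {f h : G.ObjAlg} (H : val f = val h) : f = h := Subtype.ext H

/-- The characteristic function of a compact open subset of the unit space. -/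
noncomputable def ind (W : Set G.Obj) (hWo : IsOpen W) (hWc : IsCompact W) : G.ObjAlg :=
  ⟨W.indicator 1, AddSubgroup.subset_closure ⟨W, hWo, hWc, inferInstance, rfl⟩⟩

@[simp] lemma val_ind (W : Set G.Obj) (hWo : IsOpen W) (hWc : IsCompact W) :
    val (ind W hWo hWc) = W.indicator 1 := rfl

@[elab_as_elim]
lemma induction {p : G.ObjAlg → Prop} (ind : ∀ W hWo hWc, p (ind W hWo hWc)) (zero : p 0)
    (add : ∀ f h, p f → p h → p (f + h)) (neg : ∀ f, p f → p (-f)) (f : G.ObjAlg) : p f := by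
  obtain ⟨f, hf⟩ := f
  have hf' := hf
  rw [compactOpenSpan] at hf'
  induction hf' using AddSubgroup.closure_induction with
  | mem f h =>
    obtain ⟨W, hWo, hWc, _, rfl⟩ := h
    exact ind W hWo hWc
  | zero => exact zero
  | add f h hf1 hh1 hf2 hh2 => exact add ⟨f, hf1⟩ ⟨h, hh1⟩ (hf2 hf1) (hh2 hh1)
  | neg f hf1 hf2 => exact neg ⟨f, hf1⟩ (hf2 hf1)

lemma act_set {W : Set G.Obj} (hWo : IsOpen W) (hWc : IsCompact W) {K : Set G.Arr}
    (hK : IsCompactBisection K) : IsOpen (G.src '' (K ∩ G.rng ⁻¹' W)) ∧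
      IsCompact (G.src '' (K ∩ G.rng ⁻¹' W)) :=
  ⟨G.isLocalHomeomorph_src.isOpenMap _ (hK.isOpen.inter (hWo.preimage G.continuous_rng)),
    (hK.isCompact.inter_right (hWc.isClosed.preimage G.continuous_rng)).image G.continuous_src⟩

lemma act_mem (h : G.ObjAlg) (f : G.Alg) : G.act (val h) (Alg.val f) ∈ compactOpenSpan G.Obj := by
  induction f using Alg.induction with
  | bis K hK =>
    induction h using induction with
    | ind W hWo hWc =>
      rw [val_ind, Alg.val_bis, Alg.act_bis hK.injOn_src]
      exact (ind _ (act_set hWo hWc hK).1 (act_set hWo hWc hK).2).2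
    | zero => rw [map_zero, Alg.act_zero_left]; exact zero_mem _
    | add f h hf hh => rw [map_add, Alg.act_add_left]; exact add_mem hf hh
    | neg f hf => rw [map_neg, Alg.act_neg_left]; exact neg_mem hf
  | zero => rw [map_zero, Alg.act_zero_right]; exact zero_mem _
  | add f h hf hh => rw [Alg.act_add_right]; exact add_mem hf hh
  | neg f hf => rw [map_neg, Alg.act_neg_right]; exact neg_mem hf

/-- The right action of an element of `ℤG` on `ℤG⁰`. -/
noncomputable def actHom (f : G.Alg) : AddMonoid.End G.ObjAlg where
  toFun h := ⟨G.act (val h) (Alg.val f), act_mem h f⟩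
  map_zero' := ext (by
    change G.act (val 0) _ = 0
    rw [map_zero, Alg.act_zero_left])
  map_add' h h' := ext (by
    change G.act (val (h + h')) _ = G.act (val h) _ + G.act (val h') _
    rw [map_add, Alg.act_add_left])

lemma val_actHom (f : G.Alg) (h : G.ObjAlg) : val (actHom f h) = G.act (val h) (Alg.val f) := rfl

lemma actHom_add (f f' : G.Alg) : actHom (f + f') = actHom f + actHom f' := by
  refine AddMonoidHom.ext fun h => ext ?_
  change val (actHom (f + f') h) = val (actHom f h + actHom f' h)
  rw [map_add, val_actHom, Alg.act_add_right]
  rfl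

lemma actHom_zero : actHom (0 : G.Alg) = 0 := by
  have := actHom_add (0 : G.Alg) 0
  simpa using this

lemma actHom_neg (f : G.Alg) : actHom (-f) = -actHom f := by
  have := actHom_add f (-f)
  rw [add_neg_cancel, actHom_zero] at this
  exact eq_neg_of_add_eq_zero_right this.symm

lemma actHom_add_apply (f f' : G.Alg) (h : G.ObjAlg) :
    actHom (f + f') h = actHom f h + actHom f' h := by
  rw [actHom_add]; rfl

lemma actHom_neg_apply (f : G.Alg) (h : G.ObjAlg) : actHom (-f) h = -actHom f h := by
  rw [actHom_neg]; rfl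

lemma actHom_ind (W : Set G.Obj) (hWo : IsOpen W) (hWc : IsCompact W) (K : Set G.Arr)
    (hK : IsCompactBisection K) : actHom (Alg.bis K hK) (ind W hWo hWc) =
      ind _ (act_set hWo hWc hK).1 (act_set hWo hWc hK).2 :=
  ext (by rw [val_actHom, val_ind, Alg.val_bis, Alg.act_bis hK.injOn_src, val_ind])

lemma actHom_mul_apply (f k : G.Alg) (h : G.ObjAlg) :
    actHom (f * k) h = actHom k (actHom f h) := by
  induction f using Alg.induction with
  | bis K hK =>
    induction k using Alg.induction with
    | bis L hL =>
      induction h using induction with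
      | ind W hWo hWc =>
        simp only [Alg.bis_mul_bis, actHom_ind]
        congr 1
        ext x
        constructor
        · rintro ⟨_, ⟨⟨g, hg, h, hh, H, rfl⟩, hW⟩, rfl⟩
          refine ⟨h, ⟨hh, g, ⟨hg, ?_⟩, H⟩, (G.src_comp g h H).symm⟩
          change G.rng (G.comp g h H) ∈ W at hW
          rwa [G.rng_comp] at hW
        · rintro ⟨h, ⟨hh, g, ⟨hg, hW⟩, H⟩, rfl⟩
          refine ⟨_, ⟨⟨g, hg, h, hh, H, rfl⟩, ?_⟩, G.src_comp g h H⟩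
          change G.rng (G.comp g h H) ∈ W
          rwa [G.rng_comp]
      | zero => simp only [map_zero]
      | add f h hf hh => simp only [map_add, hf, hh]
      | neg f hf => simp only [map_neg, hf]
    | zero => rw [mul_zero, actHom_zero]; rfl
    | add f h hf hh => rw [mul_add, actHom_add_apply, actHom_add_apply, hf, hh]
    | neg f hf => rw [mul_neg, actHom_neg_apply, actHom_neg_apply, hf]
  | zero => rw [zero_mul, actHom_zero]; exact (map_zero (actHom k)).symm
  | add f f' hf hf' => rw [add_mul, actHom_add_apply, actHom_add_apply, hf, hf', ← map_add]
  | neg f hf => rw [neg_mul, actHom_neg_apply, actHom_neg_apply, hf, ← map_neg]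

/-- The right action of `ℤG` on `ℤG⁰`, as a homomorphism to the opposite of the endomorphism
ring. -/
noncomputable def actRingHom : G.Alg →ₙ+* (AddMonoid.End G.ObjAlg)ᵐᵒᵖ where
  toFun f := MulOpposite.op (actHom f)
  map_zero' := by rw [actHom_zero]; rfl
  map_add' f f' := by rw [actHom_add]; rfl
  map_mul' f k := by
    rw [← MulOpposite.op_mul]
    congr 1
    exact AddMonoidHom.ext (actHom_mul_apply f k)

/-- The trivial right `ℤG`-module `ℤG⁰`, with action `(h f)(x) = ∑_{s(g) = x} h(r(g)) f(g)`. -/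
noncomputable instance : Module (Unitized G.Alg)ᵐᵒᵖ G.ObjAlg where
  smul s h := (Unitized.lift actRingHom s.unop).unop h
  one_smul h := by
    change (Unitized.lift actRingHom 1).unop h = h
    rw [map_one]; rfl
  mul_smul s t h := by
    change (Unitized.lift actRingHom (t.unop * s.unop)).unop h = _
    rw [map_mul]; rfl
  smul_zero s := map_zero _
  smul_add s h h' := map_add _ h h'
  add_smul s t h := by
    change (Unitized.lift actRingHom (s.unop + t.unop)).unop h = _
    rw [map_add]; rfl
  zero_smul h := by
    change (Unitized.lift actRingHom 0).unop h = 0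
    rw [map_zero]; rfl

lemma op_inr_smul (f : G.Alg) (h : G.ObjAlg) :
    MulOpposite.op (Unitized.inr f) • h = actHom f h := by
  change (Unitized.lift actRingHom (Unitized.inr f)).unop h = _
  rw [Unitized.lift_inr]; rfl

end ObjAlg

variable (G) in
/-- The homology `H_n(G, M) = Tor_n^{ℤG}(ℤG⁰, M)` of an ample groupoid `G` with coefficients in a
unitary left `ℤG`-module `M`, as a functor of `M`. -/
noncomputable def homology (n : ℕ) : UnitaryMod G.Alg ⥤ AddCommGrpCat.{u} :=
  torFunctor G.ObjAlg n

end AmpleGroupoid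
namespace AmpleGroupoid

variable (G : AmpleGroupoid.{u})

/-- The orbit of a unit `x`: the ranges of the arrows with source `x`. -/
def orbit (x : G.Obj) : Set G.Obj := G.rng '' (G.src ⁻¹' {x})

/-- A set of units is invariant if it is a union of orbits. -/
def IsInvariant (X : Set G.Obj) : Prop := ∀ x ∈ X, G.orbit x ⊆ X

variable {G}

lemma IsInvariant.mem_iff {X : Set G.Obj} (hX : G.IsInvariant X) (g : G.Arr) :
    G.rng g ∈ X ↔ G.src g ∈ X := by
  constructor
  · intro h
    exact hX _ h ⟨G.inv g, G.src_inv g, G.rng_inv g⟩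
  · intro h
    exact hX _ h ⟨g, rfl, rfl⟩

lemma IsInvariant.compl {X : Set G.Obj} (hX : G.IsInvariant X) : G.IsInvariant Xᶜ := by
  rintro x hx _ ⟨g, rfl, rfl⟩ h
  exact hx ((hX.mem_iff g).1 h)

variable (G)

/-- The arrows with source and range in `X`. -/
abbrev arrowsIn (X : Set G.Obj) : Set G.Arr := {g | G.rng g ∈ X ∧ G.src g ∈ X}

variable {G} in
lemma unit_mem {X : Set G.Obj} {x : G.Obj} (hx : x ∈ X) : G.unit x ∈ G.arrowsIn X :=
  ⟨by rwa [G.rng_unit], by rwa [G.src_unit]⟩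

variable {G} in
lemma inv_mem {X : Set G.Obj} {g : G.Arr} (hg : g ∈ G.arrowsIn X) : G.inv g ∈ G.arrowsIn X :=
  ⟨by rw [G.rng_inv]; exact hg.2, by rw [G.src_inv]; exact hg.1⟩

variable {G} in
lemma comp_mem {X : Set G.Obj} {g h : G.Arr} (hg : g ∈ G.arrowsIn X) (hh : h ∈ G.arrowsIn X)
    (H : G.src g = G.rng h) : G.comp g h H ∈ G.arrowsIn X :=
  ⟨by rw [G.rng_comp]; exact hg.1, by rw [G.src_comp]; exact hh.2⟩

variable {G} in
lemma isLocalHomeomorph_src_restrict {X : Set G.Obj} (hinv : G.IsInvariant X) :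
    IsLocalHomeomorph fun g : G.arrowsIn X => (⟨G.src g, g.2.2⟩ : X) := by
  have hcont : Continuous fun g : G.arrowsIn X => (⟨G.src g, g.2.2⟩ : X) :=
    (G.continuous_src.comp continuous_subtype_val).subtype_mk _
  have hopen : IsOpenMap fun g : G.arrowsIn X => (⟨G.src g, g.2.2⟩ : X) := by
    rintro _ ⟨V, hV, rfl⟩
    refine ⟨G.src '' V, G.isLocalHomeomorph_src.isOpenMap V hV, ?_⟩
    ext x
    constructor
    · rintro ⟨g, hg, hx⟩
      have hgX : G.src g ∈ X := by rw [hx]; exact x.2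
      exact ⟨⟨g, (hinv.mem_iff g).2 hgX, hgX⟩, hg, Subtype.ext hx⟩
    · rintro ⟨g, hg, rfl⟩
      exact ⟨g, hg, rfl⟩
  rw [isLocalHomeomorph_iff_isOpenEmbedding_restrict]
  intro g
  obtain ⟨O, hO, hemb⟩ := isLocalHomeomorph_iff_isOpenEmbedding_restrict.1
    G.isLocalHomeomorph_src g.1
  refine ⟨Subtype.val ⁻¹' interior O, (isOpen_interior.preimage continuous_subtype_val).mem_nhds
    (mem_interior_iff_mem_nhds.2 hO), .of_continuous_injective_isOpenMap
    (hcont.comp continuous_subtype_val) ?_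
    (hopen.comp (isOpen_interior.preimage continuous_subtype_val).isOpenMap_subtype_val)⟩
  rintro ⟨a, ha⟩ ⟨b, hb⟩ hab
  have h1 := @hemb.injective ⟨a.1, interior_subset ha⟩ ⟨b.1, interior_subset hb⟩
    (congrArg Subtype.val hab)
  have h2 : a.1 = b.1 := Subtype.mk.inj h1
  exact Subtype.ext (Subtype.ext h2)

/-- The ample groupoid of the arrows with source and range in `X`, for `X` an invariant locally
closed (for example open or closed) set of units, with the subspace topologies. -/
def reduction (X : Set G.Obj) (hX : IsLocallyClosed X) (hinv : G.IsInvariant X) :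
    AmpleGroupoid.{u} where
  Obj := X
  Arr := G.arrowsIn X
  locallyCompactSpace := hX.locallyCompactSpace
  src g := ⟨G.src g, g.2.2⟩
  rng g := ⟨G.rng g, g.2.1⟩
  unit x := ⟨G.unit x, unit_mem x.2⟩
  inv g := ⟨G.inv g, inv_mem g.2⟩
  comp g h H := ⟨G.comp g h (congrArg Subtype.val H), comp_mem g.2 h.2 _⟩
  src_unit x := Subtype.ext (G.src_unit x)
  rng_unit x := Subtype.ext (G.rng_unit x)
  src_inv g := Subtype.ext (G.src_inv g)
  rng_inv g := Subtype.ext (G.rng_inv g)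
  src_comp g h H := Subtype.ext (G.src_comp g h _)
  rng_comp g h H := Subtype.ext (G.rng_comp g h _)
  comp_assoc g h k H H' := Subtype.ext
    (G.comp_assoc g h k (congrArg Subtype.val H) (congrArg Subtype.val H'))
  unit_comp g := Subtype.ext (G.unit_comp g)
  comp_unit g := Subtype.ext (G.comp_unit g)
  inv_comp g := Subtype.ext (G.inv_comp g)
  comp_inv g := Subtype.ext (G.comp_inv g)
  continuous_unit := (G.continuous_unit.comp continuous_subtype_val).subtype_mk _
  continuous_inv := (G.continuous_inv.comp continuous_subtype_val).subtype_mk _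
  continuous_comp := by
    refine Continuous.subtype_mk (G.continuous_comp.comp
      (f := fun p : {p : G.arrowsIn X × G.arrowsIn X //
        (⟨G.src p.1, p.1.2.2⟩ : X) = ⟨G.rng p.2, p.2.2.1⟩} =>
        (⟨(p.1.1.1, p.1.2.1), congrArg Subtype.val p.2⟩ :
          {p : G.Arr × G.Arr // G.src p.1 = G.rng p.2})) ?_) _
    fun_prop
  isLocalHomeomorph_src := isLocalHomeomorph_src_restrict hinv

variable {G}
variable {X : Set G.Obj} {hX : IsLocallyClosed X} {hinv : G.IsInvariant X}

/-- The inclusion of the arrows of a reduction. -/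
def incl (g : (G.reduction X hX hinv).Arr) : G.Arr := Subtype.val (p := (· ∈ G.arrowsIn X)) g

lemma incl_injective : Function.Injective (incl (hX := hX) (hinv := hinv)) :=
  Subtype.val_injective

lemma range_incl : Set.range (incl (hX := hX) (hinv := hinv)) = G.src ⁻¹' X := by
  ext g
  constructor
  · rintro ⟨g, rfl⟩
    exact g.2.2
  · intro h
    exact ⟨⟨g, (hinv.mem_iff g).2 h, h⟩, rfl⟩

lemma isEmbedding_incl : Topology.IsEmbedding (incl (hX := hX) (hinv := hinv)) :=
  .subtypeVal

lemma src_incl (g : (G.reduction X hX hinv).Arr) :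
    G.src (incl g) = Subtype.val (p := (· ∈ X)) ((G.reduction X hX hinv).src g) := rfl

lemma rng_incl (g : (G.reduction X hX hinv).Arr) :
    G.rng (incl g) = Subtype.val (p := (· ∈ X)) ((G.reduction X hX hinv).rng g) := rfl

/-- Convolution in `G` at an arrow of a reduction is convolution in the reduction. -/
lemma conv_incl (f h : G.Arr → ℤ) (k : (G.reduction X hX hinv).Arr) :
    G.conv f h (incl k) = (G.reduction X hX hinv).conv (f ∘ incl) (h ∘ incl) k := by
  symm
  refine finsum_eq_of_bijective (fun a => ⟨incl a.1, congrArg Subtype.val a.2⟩) ⟨?_, ?_⟩ ?_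
  · intro a b hab
    have h1 : incl a.1 = incl b.1 := Subtype.mk.inj hab
    exact Subtype.ext (incl_injective h1)
  · rintro ⟨a, ha⟩
    have haX : G.rng a ∈ X := by rw [ha]; exact k.2.1
    exact ⟨⟨⟨a, haX, (hinv.mem_iff a).1 haX⟩, Subtype.ext ha⟩, rfl⟩
  · intro a
    rfl

/-- Restriction of functions on `G` to a closed invariant reduction is a ring homomorphism. -/
noncomputable def Alg.res (hc : IsClosed X) : G.Alg →ₙ+* (G.reduction X hX hinv).Alg where
  toFun f := ⟨val f ∘ incl, by
    induction f using Alg.induction with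
    | bis K hK =>
      have hcl : Topology.IsClosedEmbedding (incl (hX := hX) (hinv := hinv)) :=
        ⟨isEmbedding_incl, by rw [range_incl]; exact hc.preimage G.continuous_src⟩
      have : IsCompactBisection (incl (hX := hX) (hinv := hinv) ⁻¹' K) :=
        ⟨hK.isOpen.preimage hcl.continuous, hcl.isCompact_preimage hK.isCompact,
          fun a ha b hb hab => incl_injective (hK.injOn_src ha hb (congrArg Subtype.val hab)),
          fun a ha b hb hab => incl_injective (hK.injOn_rng ha hb (congrArg Subtype.val hab))⟩
      exact this.indicator_mem
    | zero => rw [map_zero]; exact zero_mem _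
    | add f h hf hh => rw [map_add]; exact add_mem hf hh
    | neg f hf => rw [map_neg]; exact neg_mem hf⟩
  map_mul' f h := Alg.ext <| funext fun k => conv_incl _ _ k
  map_zero' := rfl
  map_add' f h := rfl

lemma Alg.val_res (hc : IsClosed X) (f : G.Alg) :
    val (res (hX := hX) (hinv := hinv) hc f) = val f ∘ incl := rfl

/-- Extension by zero. -/
noncomputable def extend (f : (G.reduction X hX hinv).Arr → ℤ) : G.Arr → ℤ :=
  Function.extend incl f 0

lemma extend_incl (f : (G.reduction X hX hinv).Arr → ℤ) : extend f ∘ incl = f :=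
  funext fun g => incl_injective.extend_apply f 0 g

lemma extend_apply_incl (f : (G.reduction X hX hinv).Arr → ℤ) (g) : extend f (incl g) = f g :=
  incl_injective.extend_apply f 0 g

lemma extend_apply_of_notMem (f : (G.reduction X hX hinv).Arr → ℤ) {g : G.Arr}
    (hg : G.src g ∉ X) : extend f g = 0 :=
  Function.extend_apply' _ _ _ fun ⟨a, ha⟩ => hg (by rw [← ha]; exact a.2.2)

lemma eq_extend {f : (G.reduction X hX hinv).Arr → ℤ} {h : G.Arr → ℤ} (h1 : h ∘ incl = f)
    (h2 : ∀ g, G.src g ∉ X → h g = 0) : h = extend f := by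
  subst h1
  ext g
  by_cases hg : G.src g ∈ X
  · obtain ⟨g, rfl⟩ : g ∈ Set.range (incl (hX := hX) (hinv := hinv)) := by
      rw [range_incl]; exact hg
    rw [extend_apply_incl, Function.comp_apply]
  · rw [h2 g hg, extend_apply_of_notMem _ hg]

lemma extend_indicator (K : Set (G.reduction X hX hinv).Arr) :
    extend (K.indicator 1) = (incl '' K).indicator 1 := by
  classical
  symm
  refine eq_extend ?_ ?_
  · ext g
    simp [Set.indicator_apply, incl_injective.mem_set_image]
  · intro g hg
    rw [Set.indicator_of_notMem]
    rintro ⟨a, -, rfl⟩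
    exact hg a.2.2

lemma extend_add (f h : (G.reduction X hX hinv).Arr → ℤ) :
    extend (f + h) = extend f + extend h := by
  refine (eq_extend ?_ ?_).symm
  · change extend f ∘ incl + extend h ∘ incl = _
    rw [extend_incl, extend_incl]
  · intro g hg
    rw [Pi.add_apply, extend_apply_of_notMem _ hg, extend_apply_of_notMem _ hg, add_zero]

lemma extend_neg (f : (G.reduction X hX hinv).Arr → ℤ) : extend (-f) = -extend f := by
  refine (eq_extend ?_ ?_).symm
  · change -(extend f ∘ incl) = _
    rw [extend_incl]
  · intro g hg
    rw [Pi.neg_apply, extend_apply_of_notMem _ hg, neg_zero]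

lemma extend_zero : extend (0 : (G.reduction X hX hinv).Arr → ℤ) = 0 :=
  (eq_extend rfl fun _ _ => rfl).symm

/-- Extension by zero, from an open invariant reduction of `G` to `G`, is a ring homomorphism. -/
noncomputable def Alg.ext0 (ho : IsOpen X) : (G.reduction X hX hinv).Alg →ₙ+* G.Alg where
  toFun f := ⟨extend (val f), by
    induction f using Alg.induction with
    | bis K hK =>
      have hop : Topology.IsOpenEmbedding (incl (hX := hX) (hinv := hinv)) :=
        ⟨isEmbedding_incl, by rw [range_incl]; exact ho.preimage G.continuous_src⟩
      have : IsCompactBisection (incl (hX := hX) (hinv := hinv) '' K) := by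
        refine ⟨hop.isOpenMap K hK.isOpen, hK.isCompact.image hop.continuous, ?_, ?_⟩
        · rintro _ ⟨a, ha, rfl⟩ _ ⟨b, hb, rfl⟩ hab
          rw [hK.injOn_src ha hb (Subtype.ext hab)]
        · rintro _ ⟨a, ha, rfl⟩ _ ⟨b, hb, rfl⟩ hab
          rw [hK.injOn_rng ha hb (Subtype.ext hab)]
      rw [val_bis, extend_indicator]
      exact this.indicator_mem
    | zero => rw [map_zero, extend_zero]; exact zero_mem _
    | add f h hf hh => rw [map_add, extend_add]; exact add_mem hf hh
    | neg f hf => rw [map_neg, extend_neg]; exact neg_mem hf⟩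
  map_mul' f h := Alg.ext <| by
    change extend (val (f * h)) = G.conv (extend (val f)) (extend (val h))
    symm
    refine eq_extend ?_ ?_
    · ext k
      rw [Function.comp_apply, conv_incl, extend_incl, extend_incl]
      rfl
    · intro k hk
      refine finsum_eq_zero_of_forall_eq_zero fun a => ?_
      rw [extend_apply_of_notMem, zero_mul]
      rwa [← hinv.mem_iff, a.2, hinv.mem_iff]
  map_zero' := Alg.ext (by
    change extend (val 0) = 0
    rw [map_zero, extend_zero])
  map_add' f h := Alg.ext (by
    change extend (val (f + h)) = extend (val f) + extend (val h)
    rw [map_add, extend_add])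

lemma Alg.val_ext0 (ho : IsOpen X) (f : (G.reduction X hX hinv).Alg) :
    val (ext0 ho f) = extend (val f) := rfl

end AmpleGroupoid
namespace AmpleGroupoid

variable {G : AmpleGroupoid.{u}}

section Exactness

variable {X : Set G.Obj} {hX : IsLocallyClosed X} {hinv : G.IsInvariant X}

/-- Every element of the algebra of a closed invariant reduction is a restriction. -/
lemma Alg.res_surjective (hc : IsClosed X) :
    Function.Surjective (res (hX := hX) (hinv := hinv) hc) := by
  classical
  intro f
  induction f using Alg.induction with
  | bis K hK =>
    obtain ⟨O, hO, hOK⟩ := isEmbedding_incl.isInducing.isOpen_iff.1 hK.isOpen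
    choose! V hV hgV hVO using fun g (hg : g ∈ O) => exists_bisection hO hg
    have hKO : incl '' K ⊆ O := by
      rw [← hOK]; exact Set.image_preimage_subset _ _
    obtain ⟨t, htK, ht⟩ := (hK.isCompact.image isEmbedding_incl.continuous).elim_nhds_subcover V
      fun g hg => (hV g (hKO hg)).isOpen.mem_nhds (hgV g (hKO hg))
    have key : ∀ t : Finset G.Arr, (∀ g ∈ t, g ∈ O) → ∃ f : G.Alg, val f ∘ incl =
        (K ∩ {k | G.src (incl k) ∈ ⋃ g ∈ t, G.src '' V g}).indicator 1 := by
      intro t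
      induction t using Finset.induction_on with
      | empty => intro _; exact ⟨0, by simp; rfl⟩
      | insert a t _ ih =>
        intro hta
        obtain ⟨f, hf⟩ := ih fun g hg => hta g (Finset.mem_insert_of_mem hg)
        have haO := hta a (Finset.mem_insert_self _ _)
        set D := ⋃ g ∈ t, G.src '' V g with hD
        have hDo : IsOpen D := isOpen_biUnion fun g hg => G.isLocalHomeomorph_src.isOpenMap _
          (hV g (hta g (Finset.mem_insert_of_mem hg))).isOpen
        have hDc : IsCompact D := t.isCompact_biUnion fun g hg =>
          (hV g (hta g (Finset.mem_insert_of_mem hg))).isCompact.image G.continuous_src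
        have hbis : IsCompactBisection (V a ∩ G.src ⁻¹' Dᶜ) :=
          (hV a haO).mono Set.inter_subset_left
            ((hV a haO).isOpen.inter (hDc.isClosed.isOpen_compl.preimage G.continuous_src))
            ((hV a haO).isCompact.inter_right (hDo.isClosed_compl.preimage G.continuous_src))
        refine ⟨f + bis _ hbis, ?_⟩
        rw [Finset.set_biUnion_insert, ← hD, map_add]
        change val f ∘ incl + val (bis _ hbis) ∘ incl = _
        rw [hf, val_bis]
        ext k
        have hk : incl k ∈ V a → k ∈ K := fun h => by rw [← hOK]; exact hVO a haO h
        have hk' : k ∈ K → G.src (incl k) ∈ G.src '' V a → incl k ∈ V a := by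
          rintro hkK ⟨v, hv, hvk⟩
          obtain ⟨k', rfl⟩ : v ∈ Set.range (incl (hX := hX) (hinv := hinv)) := by
            rw [range_incl]
            change G.src v ∈ X
            rw [hvk]
            exact k.2.2
          have : k' ∈ K := by rw [← hOK]; exact hVO a haO hv
          rwa [hK.injOn_src hkK this (Subtype.ext hvk.symm)]
        have hk'' : incl k ∈ V a → G.src (incl k) ∈ G.src '' V a := fun h => ⟨_, h, rfl⟩
        simp only [Pi.add_apply, Function.comp_apply, Set.indicator_apply, Set.mem_inter_iff,
          Set.mem_ofPred_eq, Set.mem_preimage, Set.mem_compl_iff, Set.mem_union, Pi.one_apply]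
        clear_value D
        split_ifs <;> first | rfl | (exfalso; tauto)
    obtain ⟨f, hf⟩ := key t fun g hg => hKO (htK g hg)
    refine ⟨f, Alg.ext ?_⟩
    rw [val_res, hf, val_bis]
    congr 1
    refine Set.inter_eq_left.2 fun k hk => ?_
    have := ht ⟨k, hk, rfl⟩
    simp only [Set.mem_iUnion] at this
    obtain ⟨g, hg, hgk⟩ := this
    exact Set.mem_biUnion hg ⟨_, hgk, rfl⟩
  | zero => exact ⟨0, map_zero _⟩
  | add f h hf hh =>
    obtain ⟨f, rfl⟩ := hf
    obtain ⟨h, rfl⟩ := hh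
    exact ⟨f + h, map_add _ _ _⟩
  | neg f hf =>
    obtain ⟨f, rfl⟩ := hf
    exact ⟨-f, map_neg _ _⟩

/-- If an element of `ℤG` vanishes at all arrows with source `x`, then it vanishes at all arrows
with source near `x`. -/
lemma Alg.exists_vanish (f : G.Alg) (x : G.Obj) (hf : ∀ g, G.src g = x → val f g = 0) :
    ∃ W, IsOpen W ∧ x ∈ W ∧ ∀ g, G.src g ∈ W → val f g = 0 := by
  classical
  choose V hV hgV using fun g : G.Arr =>
    (exists_bisection isOpen_univ (Set.mem_univ g)).imp fun V h => And.intro h.1 h.2.1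
  suffices H : ∃ W, IsOpen W ∧ x ∈ W ∧ ∃ T : Finset G.Arr, (∀ g ∈ T, G.src g = x) ∧
      ∀ h, G.src h ∈ W → val f h = ∑ g ∈ T, val f g * (V g).indicator 1 h by
    obtain ⟨W, hWo, hxW, T, hT, H⟩ := H
    refine ⟨W, hWo, hxW, fun h hh => ?_⟩
    rw [H h hh]
    exact Finset.sum_eq_zero fun g hg => by rw [hf g (hT g hg), zero_mul]
  clear hf
  induction f using Alg.induction with
  | bis K hK =>
    by_cases hx : x ∈ G.src '' K
    · obtain ⟨g, hg, rfl⟩ := hx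
      refine ⟨G.src '' (K ∩ V g), G.isLocalHomeomorph_src.isOpenMap _
        (hK.isOpen.inter (hV g).isOpen), ⟨g, ⟨hg, hgV g⟩, rfl⟩, {g}, by simp, ?_⟩
      rintro h ⟨k, ⟨hkK, hkV⟩, hk⟩
      have : h ∈ K ↔ h ∈ V g := by
        constructor
        · intro hh
          rwa [hK.injOn_src hh hkK hk.symm]
        · intro hh
          rwa [(hV g).injOn_src hh hkV hk.symm]
      simp [Set.indicator_apply, hg, this]
    · refine ⟨(G.src '' K)ᶜ, (hK.isCompact.image G.continuous_src).isClosed.isOpen_compl, hx,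
        ∅, by simp, fun h hh => ?_⟩
      rw [val_bis, Set.indicator_of_notMem, Finset.sum_empty]
      exact fun hK => hh ⟨h, hK, rfl⟩
  | zero => exact ⟨Set.univ, isOpen_univ, trivial, ∅, by simp, by simp⟩
  | add f f' hf hf' =>
    obtain ⟨W, hWo, hxW, T, hT, H⟩ := hf
    obtain ⟨W', hWo', hxW', T', hT', H'⟩ := hf'
    have aux (f : G.Alg) (W : Set G.Obj) (hxW : x ∈ W) (T T' : Finset G.Arr)
        (hT : ∀ g ∈ T, G.src g = x) (hT' : ∀ g ∈ T', G.src g = x) (hTT' : T ⊆ T')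
        (H : ∀ h, G.src h ∈ W → val f h = ∑ g ∈ T, val f g * (V g).indicator 1 h) (h : G.Arr)
        (hh : G.src h ∈ W) : val f h = ∑ g ∈ T', val f g * (V g).indicator 1 h := by
      rw [H h hh]
      refine Finset.sum_subset hTT' fun g hg hgT => ?_
      rw [H g (by rw [hT' g hg]; exact hxW), Finset.sum_eq_zero, zero_mul]
      intro g' hg'
      rw [Set.indicator_of_notMem, mul_zero]
      intro hgV'
      have := (hV g').injOn_src hgV' (hgV g') ((hT' g hg).trans (hT g' hg').symm)
      exact hgT (by rwa [this])
    have hTT : ∀ g ∈ T ∪ T', G.src g = x := fun g hg =>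
      (Finset.mem_union.1 hg).elim (hT g) (hT' g)
    refine ⟨W ∩ W', hWo.inter hWo', ⟨hxW, hxW'⟩, T ∪ T', hTT, fun h hh => ?_⟩
    rw [map_add, Pi.add_apply,
      aux f W hxW T (T ∪ T') hT hTT Finset.subset_union_left H h hh.1,
      aux f' W' hxW' T' (T ∪ T') hT' hTT Finset.subset_union_right H' h hh.2,
      ← Finset.sum_add_distrib]
    simp only [Pi.add_apply, add_mul]
  | neg f hf =>
    obtain ⟨W, hWo, hxW, T, hT, H⟩ := hf
    refine ⟨W, hWo, hxW, T, hT, fun h hh => ?_⟩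
    rw [map_neg, Pi.neg_apply, H h hh, ← Finset.sum_neg_distrib]
    simp only [Pi.neg_apply, neg_mul]

lemma Alg.mulSet_unit_eq (K : Set G.Arr) (W : Set G.Obj) :
    mulSet K (G.unit '' W) = K ∩ G.src ⁻¹' W := by
  ext k
  constructor
  · rintro ⟨g, hg, _, ⟨x, hx, rfl⟩, H, rfl⟩
    have H' := H
    rw [G.rng_unit] at H'
    subst H'
    rw [G.comp_unit]
    exact ⟨hg, hx⟩
  · rintro ⟨hk, hkW⟩
    exact ⟨k, hk, _, ⟨_, hkW, rfl⟩, _, G.comp_unit k⟩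

lemma Alg.val_mul_idem (f : G.Alg) (W : Set G.Obj) (hWo : IsOpen W) (hWc : IsCompact W) :
    val (f * idem W hWo hWc) = (G.src ⁻¹' W).indicator (val f) := by
  classical
  induction f using Alg.induction with
  | bis K hK =>
    simp only [idem, bis_mul_bis, val_bis, mulSet_unit_eq]
    rw [Set.inter_comm, ← Set.indicator_indicator]
  | zero => rw [zero_mul, map_zero, Set.indicator_zero']
  | add f h hf hh => rw [add_mul, map_add, map_add, hf, hh, ← Set.indicator_add']
  | neg f hf => rw [neg_mul, map_neg, map_neg, hf, Set.indicator_neg']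

/-- An element of `ℤG` that vanishes on the complement of an open invariant reduction comes from
this reduction. -/
lemma Alg.exists_ext0 (ho : IsOpen X) (f : G.Alg) (hf : ∀ g, G.src g ∉ X → val f g = 0) :
    ∃ h : (G.reduction X hX hinv).Alg, ext0 ho h = f := by
  have step (W : Set G.Obj) (hWo : IsOpen W) (hWc : IsCompact W) (hW : W ⊆ X) (f : G.Alg) :
      ∃ h : (G.reduction X hX hinv).Alg, ext0 ho h = f * idem W hWo hWc := by
    induction f using Alg.induction with
    | bis K hK =>
      have hop : Topology.IsOpenEmbedding (incl (hX := hX) (hinv := hinv)) :=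
        ⟨isEmbedding_incl, by rw [range_incl]; exact ho.preimage G.continuous_src⟩
      have hKW := hK.inter_src hWo hWc
      have hr : K ∩ G.src ⁻¹' W ⊆ Set.range (incl (hX := hX) (hinv := hinv)) := by
        rw [range_incl]; exact fun g hg => hW hg.2
      have hb : IsCompactBisection (incl (hX := hX) (hinv := hinv) ⁻¹' (K ∩ G.src ⁻¹' W)) :=
        ⟨hKW.isOpen.preimage hop.continuous, hop.isInducing.isCompact_preimage' hKW.isCompact hr,
          fun a ha b hb hab => incl_injective (hKW.injOn_src ha hb (congrArg Subtype.val hab)),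
          fun a ha b hb hab => incl_injective (hKW.injOn_rng ha hb (congrArg Subtype.val hab))⟩
      refine ⟨bis _ hb, Alg.ext ?_⟩
      rw [val_ext0, val_bis, extend_indicator, Set.image_preimage_eq_of_subset hr]
      simp only [idem, bis_mul_bis, val_bis, mulSet_unit_eq]
    | zero => exact ⟨0, by rw [map_zero, zero_mul]⟩
    | add f h hf hh =>
      obtain ⟨f', hf⟩ := hf
      obtain ⟨h', hh⟩ := hh
      exact ⟨f' + h', by rw [map_add, hf, hh, add_mul]⟩
    | neg f hf =>
      obtain ⟨f', hf⟩ := hf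
      exact ⟨-f', by rw [map_neg, hf, neg_mul]⟩
  obtain ⟨A, hAo, hAc, hA⟩ := exists_unit f
  choose! O hOo hxO hO using fun x (hx : x ∉ X) =>
    exists_vanish f x fun g hg => hf g (by rwa [hg])
  obtain ⟨W, hWo, hWc, hW, hWX⟩ := exists_compactOpen_of_isCompact
    (A := A \ ⋃ x ∈ Xᶜ, O x) (hAc.diff (isOpen_biUnion hOo)) ho (by
      rintro x ⟨-, hx⟩
      by_contra hxX
      exact hx (Set.mem_biUnion hxX (hxO x hxX)))
  obtain ⟨h, hh⟩ := step W hWo hWc hWX f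
  refine ⟨h, hh.trans (Alg.ext ?_)⟩
  rw [val_mul_idem]
  refine Set.indicator_eq_self.2 fun g hg => hW ⟨?_, ?_⟩
  · by_contra hgA
    apply hg
    rw [← (hA A hAo hAc subset_rfl).2, val_mul_idem, Set.indicator_of_notMem]
    exact hgA
  · intro hgO
    simp only [Set.mem_iUnion] at hgO
    obtain ⟨x, hx, hgO⟩ := hgO
    exact hg (hO x hx g hgO)

end Exactness

section Coefficients

variable (G)
variable (U : Set G.Obj) (hU : IsOpen U) (hinv : G.IsInvariant U)

/-- The reduction `G_U^U` of `G` to an open invariant set `U` of units. -/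
abbrev openPart : AmpleGroupoid.{u} := G.reduction U hU.isLocallyClosed hinv

/-- The reduction `G_C^C` of `G` to the complement `C` of an open invariant set `U` of units. -/
abbrev closedPart : AmpleGroupoid.{u} :=
  G.reduction Uᶜ hU.isClosed_compl.isLocallyClosed hinv.compl

/-- The homomorphism `ℤG_U^U → ℤG` given by extension by zero. -/
noncomputable abbrev extOpen : (G.openPart U hU hinv).Alg →ₙ+* G.Alg := Alg.ext0 hU

/-- The homomorphism `ℤG → ℤG_C^C` given by restriction. -/
noncomputable abbrev resClosed : G.Alg →ₙ+* (G.closedPart U hU hinv).Alg :=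
  Alg.res hU.isClosed_compl

variable {U}

/-- The kernel of restriction to `C` is the image of `ℤG_U^U`; in particular this is an ideal. -/
lemma resClosed_eq_zero_iff (f : G.Alg) :
    G.resClosed U hU hinv f = 0 ↔ ∃ h, G.extOpen U hU hinv h = f := by
  constructor
  · intro h
    refine Alg.exists_ext0 hU f fun g hg => ?_
    obtain ⟨g, rfl⟩ : g ∈ Set.range (incl (hX := hU.isClosed_compl.isLocallyClosed)
        (hinv := hinv.compl)) := by
      rw [range_incl]; exact hg
    have := congrFun (congrArg Alg.val h) g
    rwa [Alg.val_res] at this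
  · rintro ⟨h, rfl⟩
    refine Alg.ext (funext fun g => ?_)
    rw [Alg.val_res, Function.comp_apply, Alg.val_ext0, extend_apply_of_notMem]
    · rfl
    · exact g.2.2

/-- The submodule `ℤG_U^U · M` of a left `ℤG`-module `M`. -/
noncomputable def idealPart (M : Type u) [AddCommGroup M] [Module (Unitized G.Alg) M] :
    Submodule (Unitized G.Alg) M :=
  Submodule.span _ {x | ∃ (f : (G.openPart U hU hinv).Alg) (m : M),
    x = Unitized.inr (G.extOpen U hU hinv f) • m}

lemma mem_idealPart_iff (M : Type u) [AddCommGroup M] [Module (Unitized G.Alg) M] (m : M) :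
    m ∈ G.idealPart hU hinv M ↔ ∃ e : (G.openPart U hU hinv).Alg, e * e = e ∧
      Unitized.inr (G.extOpen U hU hinv e) • m = m := by
  constructor
  · intro h
    suffices H : ∃ F : Finset (G.openPart U hU hinv).Alg, ∀ e : (G.openPart U hU hinv).Alg,
        (∀ r ∈ F, e * r = r) → Unitized.inr (G.extOpen U hU hinv e) • m = m by
      obtain ⟨F, hF⟩ := H
      obtain ⟨e, he, h⟩ := HasLocalUnits.exists_unit F
      exact ⟨e, he, hF e fun r hr => (h r hr).1⟩
    classical
    induction h using Submodule.span_induction with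
    | mem x h =>
      obtain ⟨r, m, rfl⟩ := h
      refine ⟨{r}, fun e he => ?_⟩
      rw [smul_smul, ← map_mul, ← map_mul, he r (by simp)]
    | zero => exact ⟨∅, by simp⟩
    | add x y _ _ hx hy =>
      obtain ⟨F, hF⟩ := hx
      obtain ⟨F', hF'⟩ := hy
      refine ⟨F ∪ F', fun e he => ?_⟩
      rw [smul_add, hF e fun r hr => he r (by simp [hr]), hF' e fun r hr => he r (by simp [hr])]
    | smul s x _ hx =>
      obtain ⟨F, hF⟩ := hx
      obtain ⟨d, -, hd⟩ := HasLocalUnits.exists_unit F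
      have hdx := hF d fun r hr => (hd r hr).1
      obtain ⟨n, r, rfl⟩ := Unitized.exists_eq s
      have hres : G.resClosed U hU hinv (G.extOpen U hU hinv d) = 0 :=
        (G.resClosed_eq_zero_iff hU hinv _).2 ⟨d, rfl⟩
      obtain ⟨c, hc⟩ := (G.resClosed_eq_zero_iff hU hinv
        (n • G.extOpen U hU hinv d + r * G.extOpen U hU hinv d)).1 (by
          rw [map_add, map_zsmul, map_mul, hres, smul_zero, mul_zero, add_zero])
      have hc' : ((n : Unitized G.Alg) + Unitized.inr r) *
          Unitized.inr (G.extOpen U hU hinv d) = Unitized.inr (G.extOpen U hU hinv c) := by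
        rw [hc]
        simp [add_mul]
      refine ⟨{c}, fun e he => ?_⟩
      rw [← hdx, smul_smul ((n : Unitized G.Alg) + Unitized.inr r), hc', smul_smul, ← map_mul,
        ← map_mul, he _ (by simp)]
  · rintro ⟨e, -, h⟩
    rw [← h]
    exact Submodule.subset_span ⟨e, m, rfl⟩

variable (M : UnitaryMod G.Alg)

/-- `ℤG_U^U · M` as a unitary left `ℤG`-module. -/
noncomputable def idealMod : UnitaryMod G.Alg :=
  ⟨ModuleCat.of _ (G.idealPart hU hinv M.obj), by
    have : Mono (ModuleCat.ofHom (G.idealPart hU hinv M.obj).subtype) :=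
      (ModuleCat.mono_iff_injective _).2 Subtype.val_injective
    exact (IsUnitary G.Alg).prop_of_mono
      (ModuleCat.ofHom (G.idealPart hU hinv M.obj).subtype) M.property⟩

/-- The inclusion `ℤG_U^U · M → M`. -/
noncomputable def idealIncl : G.idealMod hU hinv M ⟶ M :=
  (IsUnitary G.Alg).homMk (ModuleCat.ofHom (G.idealPart hU hinv M.obj).subtype)

/-- `M / ℤG_U^U · M` as a unitary left `ℤG`-module. -/
noncomputable def quotMod : UnitaryMod G.Alg :=
  ⟨ModuleCat.of _ (M.obj ⧸ G.idealPart hU hinv M.obj), by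
    have : Epi (ModuleCat.ofHom (G.idealPart hU hinv M.obj).mkQ) :=
      (ModuleCat.epi_iff_surjective _).2 (Submodule.mkQ_surjective _)
    exact (IsUnitary G.Alg).prop_of_epi
      (ModuleCat.ofHom (G.idealPart hU hinv M.obj).mkQ) M.property⟩

/-- The projection `M → M / ℤG_U^U · M`. -/
noncomputable def quotProj : M ⟶ G.quotMod hU hinv M :=
  (IsUnitary G.Alg).homMk (ModuleCat.ofHom (G.idealPart hU hinv M.obj).mkQ)

/-- `ℤG_U^U · M` as a unitary left `ℤG_U^U`-module. -/
noncomputable def openCoeff : UnitaryMod (G.openPart U hU hinv).Alg :=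
  ⟨(ModuleCat.restrictScalars (Unitized.map (G.extOpen U hU hinv))).obj
    (ModuleCat.of _ (G.idealPart hU hinv M.obj)), by
    rw [isUnitary_iff]
    intro m
    change G.idealPart hU hinv M.obj at m
    obtain ⟨e, he, h⟩ := (G.mem_idealPart_iff hU hinv M.obj m.1).1 m.2
    refine ⟨e, he, ?_⟩
    change Unitized.map (G.extOpen U hU hinv) (Unitized.inr e) • m = m
    rw [Unitized.map_inr]
    exact Subtype.ext h⟩

lemma unitizedMap_resClosed_surjective :
    Function.Surjective (Unitized.map (G.resClosed U hU hinv)) := by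
  intro s
  obtain ⟨n, r, rfl⟩ := Unitized.exists_eq s
  obtain ⟨r, rfl⟩ := Alg.res_surjective hU.isClosed_compl r
  exact ⟨n + Unitized.inr r, by rw [map_add, map_intCast, Unitized.map_inr]⟩

lemma ker_unitizedMap_resClosed_le (N : Type u) [AddCommGroup N] [Module (Unitized G.Alg) N] :
    RingHom.ker (Unitized.map (G.resClosed U hU hinv)) ≤
      RingHom.ker (Module.toAddMonoidEnd (Unitized G.Alg) (N ⧸ G.idealPart hU hinv N)) := by
  intro s hs
  obtain ⟨n, r, rfl⟩ := Unitized.exists_eq s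
  rw [RingHom.mem_ker, map_add, map_intCast, Unitized.map_inr] at hs
  obtain ⟨rfl, hr⟩ := Unitized.intCast_add_inr_inj (n' := 0) (r' := 0)
    (hs.trans (by rw [Int.cast_zero, map_zero, add_zero]))
  obtain ⟨h, rfl⟩ := (G.resClosed_eq_zero_iff hU hinv r).1 hr
  refine AddMonoidHom.ext fun x => ?_
  obtain ⟨x, rfl⟩ := Submodule.mkQ_surjective _ x
  change (((0 : ℤ) : Unitized G.Alg) + Unitized.inr _) • Submodule.mkQ (G.idealPart hU hinv N) x = 0
  rw [Int.cast_zero, zero_add, ← map_smul]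
  exact (Submodule.Quotient.mk_eq_zero _).2 (Submodule.subset_span ⟨h, x, rfl⟩)

/-- The left `ℤG_C^C`-module structure of `N / ℤG_U^U · N`: the action of the restriction to `C`
of an element `f` of `ℤG` is that of `f`. -/
noncomputable def closedAction (N : Type u) [AddCommGroup N] [Module (Unitized G.Alg) N] :
    Unitized (G.closedPart U hU hinv).Alg →+* AddMonoid.End (N ⧸ G.idealPart hU hinv N) :=
  (Unitized.map (G.resClosed U hU hinv)).liftOfSurjective
    (G.unitizedMap_resClosed_surjective hU hinv)
    ⟨Module.toAddMonoidEnd (Unitized G.Alg) (N ⧸ G.idealPart hU hinv N),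
      G.ker_unitizedMap_resClosed_le hU hinv N⟩

lemma closedAction_map (N : Type u) [AddCommGroup N] [Module (Unitized G.Alg) N]
    (s : Unitized G.Alg) (x : N ⧸ G.idealPart hU hinv N) :
    G.closedAction hU hinv N (Unitized.map (G.resClosed U hU hinv) s) x = s • x :=
  DFunLike.congr_fun (RingHom.liftOfRightInverse_comp_apply _ _ _ _ s) x

/-- `M / ℤG_U^U · M` as a left `ℤG_C^C`-module. -/
noncomputable def closedCoeffModule : ModuleCat.{u} (Unitized (G.closedPart U hU hinv).Alg) :=
  letI : Module (Unitized (G.closedPart U hU hinv).Alg) (M.obj ⧸ G.idealPart hU hinv M.obj) :=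
    Module.compHom _ (G.closedAction hU hinv M.obj)
  ModuleCat.of _ (M.obj ⧸ G.idealPart hU hinv M.obj)

/-- `M / ℤG_U^U · M` as a unitary left `ℤG_C^C`-module. -/
noncomputable def closedCoeff : UnitaryMod (G.closedPart U hU hinv).Alg :=
  ⟨G.closedCoeffModule hU hinv M, by
    rw [isUnitary_iff]
    intro x
    obtain ⟨e, he, h⟩ := (isUnitary_iff _).1 (G.quotMod hU hinv M).property x
    refine ⟨G.resClosed U hU hinv e, by rw [← map_mul, he], ?_⟩
    refine Eq.trans ?_ h
    rw [← Unitized.map_inr]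
    exact G.closedAction_map hU hinv M.obj (Unitized.inr e) x⟩

end Coefficients

end AmpleGroupoid

/-! Write `R = ℤG`, `I = ℤG_U^U`, so that `R / I = ℤG_C^C`, and let `A = ℤG⁰`. The sequence `0 → I M
→ M → M / I M → 0` is a short exact sequence of unitary `R`-modules and yields a long exact sequence
for `Tor^R(A, -)`. What remains is excision: the outer terms have to be identified with `Tor` over
`I` and over `R / I`.

Both identifications are instances of one comparison, `Functor.nonempty_leftDerived_iso`. Let `L` be
an exact functor, `F` and `F'` right exact functors with `F' ≅ L ⋙ F`, and suppose that `L` sends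
projectives to `F`-acyclic objects. Then `L_n F'` and `L_n F ∘ L` agree on objects, by dimension
shifting. Here `L` is the functor that extends the action of `I` on a unitary `I`-module to `R`
(`idealExtend`), or inflation along `R → R / I` (`inflation`). Neither changes the underlying
groups, so exactness is clear.

The agreement of the tensor functors comes down to functions on the unit space. For a unitary
`I`-module `N`, both `A ⊗_R N` and `ℤU ⊗_I N` are the same group, because `A I` lies in `ℤU` and `n
= e n` for some `e` in `I`. For a module `N` over `R / I`, the kernel of `A → ℤC` consists of
functions `a` with `a = a f` for some `f` in `I`, and these die in `A ⊗_R N` because `f` acts on `N`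
as zero.

Acyclicity is obtained from flatness over the unitization of `R`. A projective `I`-module `P`,
extended to `R`, is a retract of any projective `R`-module `Q` mapping onto it: the surjection `I Q
→ P` splits over `I`, and the splitting is automatically `R`-linear. A projective `R / I`-module is
a retract of `Q / I Q`, with `Q` projective over `R`. The latter quotient is flat because `I` is a
two-sided ideal with local units (`BalancedTensor.IsFlat.quotient`): when a tensor becomes trivial
modulo `I` after an injection of right modules, its coefficients are fixed by some `e` in `I`, and
this `e` can be moved across the tensor sign into `I Q`. -/

namespace CategoryTheory

open Limits

/-! ### The five lemma for short exact sequences of complexes -/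

section FiveLemma

open ComposableArrows Abelian

variable {C ι : Type*} [Category* C] [Abelian C] {c : ComplexShape ι}
  {S₁ S₂ : ShortComplex (HomologicalComplex C c)}

/-- The five lemma applied to the two long exact homology sequences. The condition `hc` supplies the
term to the left of the homology at a given index that injectivity needs; in a chain complex every
degree `j` is reached from `j + 1`. -/
lemma quasiIso_τ₂_of_shortExact (φ : S₁ ⟶ S₂) (hS₁ : S₁.ShortExact) (hS₂ : S₂.ShortExact)
    (hc : ∀ j, ∃ i, c.Rel i j) (h₁ : QuasiIso φ.τ₁) (h₃ : QuasiIso φ.τ₃) : QuasiIso φ.τ₂ := by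
  rw [quasiIso_iff]
  intro i
  rw [quasiIsoAt_iff_isIso_homologyMap]
  have hmono : Mono (HomologicalComplex.homologyMap φ.τ₂ i) := by
    obtain ⟨j, hij⟩ := hc i
    exact mono_of_epi_of_mono_of_mono'' (k := 2) (by lia)
      (HomologicalComplex.HomologySequence.composableArrows₅_exact hS₁ j i hij)
      (HomologicalComplex.HomologySequence.composableArrows₅_exact hS₂ j i hij)
      (HomologicalComplex.HomologySequence.mapComposableArrows₅ φ hS₁ hS₂ j i hij)
      2 3 4 5 rfl rfl rfl rfl
      (inferInstance : Epi (HomologicalComplex.homologyMap φ.τ₃ j))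
      (inferInstance : Mono (HomologicalComplex.homologyMap φ.τ₁ i))
      (inferInstance : Mono (HomologicalComplex.homologyMap φ.τ₃ i))
  have hepi : Epi (HomologicalComplex.homologyMap φ.τ₂ i) := by
    by_cases hi : ∃ j, c.Rel i j
    · obtain ⟨j, hij⟩ := hi
      exact epi_of_epi_of_epi_of_mono'' (k := 0) (by lia)
        (HomologicalComplex.HomologySequence.composableArrows₅_exact hS₁ i j hij)
        (HomologicalComplex.HomologySequence.composableArrows₅_exact hS₂ i j hij)
        (HomologicalComplex.HomologySequence.mapComposableArrows₅ φ hS₁ hS₂ i j hij)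
        0 1 2 3 rfl rfl rfl rfl
        (inferInstance : Epi (HomologicalComplex.homologyMap φ.τ₁ i))
        (inferInstance : Epi (HomologicalComplex.homologyMap φ.τ₃ i))
        (inferInstance : Mono (HomologicalComplex.homologyMap φ.τ₁ j))
    -- Nothing leaves the index `i`, as in degree `0` of a chain complex. The homology sequence then
    -- ends with an epimorphism, and the shorter four lemma suffices.
    · have := hS₁.epi_g
      have hg := HomologicalComplex.epi_homologyMap_of_epi_of_not_rel S₁.g i (by simpa using hi)
      exact Abelian.epi_of_epi_of_epi_of_epi
        (HomologicalComplex.HomologySequence.mapComposableArrows₂ φ i)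
        (HomologicalComplex.HomologySequence.composableArrows₂_exact hS₂ i) hg
        (inferInstance : Epi (HomologicalComplex.homologyMap φ.τ₁ i))
        (inferInstance : Epi (HomologicalComplex.homologyMap φ.τ₃ i))
  exact isIso_of_mono_of_epi _

end FiveLemma

/-! ### Twisted extensions of complexes and the horseshoe lemma -/

section Horseshoe

variable {C : Type*} [Category* C] [Abelian C]

/-- A twisting cochain: the off-diagonal part of the differential of an extension of `R` by `P`. -/
structure ChainComplex.Twist (P R : ChainComplex C ℕ) where
  /-- the off-diagonal part of the differential -/
  θ (n : ℕ) : R.X (n + 1) ⟶ P.X n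
  comm (n : ℕ) : θ (n + 1) ≫ P.d (n + 1) n + R.d (n + 2) (n + 1) ≫ θ n = 0

namespace ChainComplex.Twist

variable {P R : ChainComplex C ℕ} (t : ChainComplex.Twist P R)

/-- The off-diagonal part of the differential in arbitrary bidegree. -/
noncomputable def d (i j : ℕ) : R.X i ⟶ P.X j :=
  if h : j + 1 = i then (R.XIsoOfEq h).inv ≫ t.θ j else 0

lemma d_succ (j : ℕ) : t.d (j + 1) j = t.θ j := by
  simp [d]

lemma d_of_ne {i j : ℕ} (h : j + 1 ≠ i) : t.d i j = 0 := dif_neg h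

/-- The extension of `R` by `P` given by a twisting cochain. -/
noncomputable def total : ChainComplex C ℕ where
  X n := P.X n ⊞ R.X n
  d i j := biprod.desc (P.d i j ≫ biprod.inl) (R.d i j ≫ biprod.inr + t.d i j ≫ biprod.inl)
  shape i j h := by
    rw [P.shape i j h, R.shape i j h, t.d_of_ne h]
    ext <;> simp
  d_comp_d' i j k hij hjk := by
    obtain rfl : j + 1 = i := hij
    obtain rfl : k + 1 = j := hjk
    have := t.comm k
    ext
    · simp
    · simp
    · simp only [d_succ, biprod.inr_desc_assoc, Preadditive.add_comp, Category.assoc,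
        biprod.inr_desc, biprod.inl_desc, Preadditive.comp_add, BinaryBicone.inl_fst,
        BinaryBicone.inr_fst, comp_zero, zero_comp, Category.comp_id, zero_add]
      exact (add_comm _ _).trans this
    · simp

/-- The inclusion of the subcomplex of an extension given by a twisting cochain. -/
noncomputable def inl : P ⟶ t.total where
  f n := biprod.inl
  comm' i j _ := by simp [total]

/-- The projection to the quotient of an extension given by a twisting cochain. -/
noncomputable def snd : t.total ⟶ R where
  f n := biprod.snd
  comm' i j _ := by
    change biprod.snd ≫ _ = biprod.desc _ _ ≫ biprod.snd
    ext <;> simp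

/-- The short exact sequence of an extension given by a twisting cochain. -/
noncomputable abbrev shortComplex : ShortComplex (ChainComplex C ℕ) :=
  ShortComplex.mk t.inl t.snd (by
    ext n
    exact biprod.inl_snd)

/-- An extension given by a twisting cochain splits in each degree. -/
noncomputable def splitting (n : ℕ) :
    (t.shortComplex.map (HomologicalComplex.eval C _ n)).Splitting where
  r := biprod.fst
  s := biprod.inr
  f_r := biprod.inl_fst
  s_g := biprod.inr_snd
  id := biprod.total

/-- Additive functors preserve splittings, so the degreewise splitting keeps the sequence exact even
though `F` is not assumed exact. This is the reason for resolving the middle object by a twisted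
sum. -/
lemma shortExact_map {D : Type*} [Category* D] [Abelian D] (F : C ⥤ D) [F.Additive] :
    (t.shortComplex.map (F.mapHomologicalComplex (ComplexShape.down ℕ))).ShortExact :=
  HomologicalComplex.shortExact_of_degreewise_shortExact _ fun n =>
    ((t.splitting n).map F).shortExact

lemma shortExact : t.shortComplex.ShortExact :=
  HomologicalComplex.shortExact_of_degreewise_shortExact _ fun n => (t.splitting n).shortExact

end ChainComplex.Twist

/-- The horseshoe lemma. -/
lemma exists_horseshoe {S : ShortComplex C} (hS : S.ShortExact) (P : ProjectiveResolution S.X₁)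
    (R : ProjectiveResolution S.X₃) :
    ∃ (t : ChainComplex.Twist P.complex R.complex)
      (π : t.total ⟶ (ChainComplex.single₀ C).obj S.X₂), QuasiIso π ∧
      t.inl ≫ π = P.π ≫ (ChainComplex.single₀ C).map S.f ∧
      t.snd ≫ R.π = π ≫ (ChainComplex.single₀ C).map S.g := by
  have := hS.epi_g
  have := hS.mono_f
  let p : P.complex.X 0 ⟶ S.X₁ := P.π.f 0
  have hp : Epi p := inferInstanceAs (Epi (P.π.f 0))
  have hdp : P.complex.d 1 0 ≫ p = 0 := P.complex_d_comp_π_f_zero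
  let r : R.complex.X 0 ⟶ S.X₃ := R.π.f 0
  have hdr : R.complex.d 1 0 ≫ r = 0 := R.complex_d_comp_π_f_zero
  let l : R.complex.X 0 ⟶ S.X₂ := Projective.factorThru r S.g
  have hl : l ≫ S.g = r := Projective.factorThru_comp _ _
  -- The composite `d ≫ l` measures how far the lifted augmentation `l` is from vanishing on
  -- boundaries. It is killed by `S.g`, hence lands in `S.X₁`, and lifts to the first term of `P`.
  let z : R.complex.X 1 ⟶ P.complex.X 0 := Projective.factorThru
    (hS.exact.lift (R.complex.d 1 0 ≫ l) (by
      rw [Category.assoc, hl]; exact hdr)) p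
  have hz : z ≫ p ≫ S.f = R.complex.d 1 0 ≫ l := by
    have h : z ≫ p = _ := Projective.factorThru_comp _ _
    rw [← Category.assoc, h]
    exact hS.exact.lift_f _ _
  have hz' : R.complex.d 2 1 ≫ z ≫ p = 0 := by
    rw [← cancel_mono S.f]
    simp only [Category.assoc]
    erw [hz]
    simp
  -- The off-diagonal part of the differential lowers the degree by one, so up to sign it is a chain
  -- map to `P` from the shifted complex with terms `R_{n+1}`. It is built from `z` by lifting along
  -- the exact complex `P`.
  let T := ChainComplex.truncate.obj R.complex
  have hT (n : ℕ) : Projective (T.X n) := R.projective (n + 1)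
  let θ : T ⟶ P.complex := ChainComplex.mkHom _ _ z
    (P.exact₀.liftFromProjective (T.d 1 0 ≫ z) ((Category.assoc _ _ _).trans hz'))
    (P.exact₀.liftFromProjective_comp _ _)
    fun n ⟨g, g', w⟩ => ⟨(P.exact_succ n).liftFromProjective (T.d (n + 2) (n + 1) ≫ g')
      ((Category.assoc _ _ _).trans ((congrArg _ w).trans
        ((T.d_comp_d_assoc _ _ _ _).trans zero_comp))),
      (P.exact_succ n).liftFromProjective_comp _ _⟩
  have hθ0 : θ.f 0 = z := rfl
  let t : ChainComplex.Twist P.complex R.complex :=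
    -- The alternating sign turns the commuting squares of a chain map into the anticommuting ones
    -- required by `comm`. The exponent is chosen so that degree `0` carries `-z`, which cancels `d
    -- ≫ l` in the augmentation below.
    { θ := fun n => (-1 : ℤ) ^ (n + 1) • (show R.complex.X (n + 1) ⟶ P.complex.X n from θ.f n)
      comm := fun n => by
        have := θ.comm (n + 1) n
        change _ = R.complex.d (n + 2) (n + 1) ≫ _ at this
        rw [Linear.smul_comp, Linear.comp_smul]
        erw [this]
        rw [pow_succ _ (n + 1), mul_neg_one, neg_smul]
        exact neg_add_cancel _ }
  have ht0 : t.θ 0 = -z := by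
    change (-1 : ℤ) ^ (0 + 1) • z = -z
    simp
  let π : t.total ⟶ (ChainComplex.single₀ C).obj S.X₂ :=
    (ChainComplex.toSingle₀Equiv _ _).symm ⟨biprod.desc (p ≫ S.f) l, by
      change biprod.desc (P.complex.d 1 0 ≫ biprod.inl)
        (R.complex.d 1 0 ≫ biprod.inr + t.d 1 0 ≫ biprod.inl) ≫ _ = 0
      rw [ChainComplex.Twist.d_succ, ht0]
      ext
      · simp only [biprod.inl_desc_assoc, Category.assoc, biprod.inl_desc, comp_zero]
        erw [reassoc_of% hdp, zero_comp]
      · simp only [biprod.inr_desc_assoc, Preadditive.add_comp, Category.assoc, biprod.inr_desc,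
          Preadditive.neg_comp, biprod.inl_desc, comp_zero]
        erw [hz]
        exact add_neg_cancel _⟩
  have hπ : π.f 0 = biprod.desc (p ≫ S.f) l :=
    ChainComplex.toSingle₀Equiv_symm_apply_f_zero _ _
  have c1 : t.inl ≫ π = P.π ≫ (ChainComplex.single₀ C).map S.f := by
    ext
    rw [HomologicalComplex.comp_f, HomologicalComplex.comp_f, hπ,
      ChainComplex.single₀_map_f_zero]
    exact biprod.inl_desc _ _
  have c2 : t.snd ≫ R.π = π ≫ (ChainComplex.single₀ C).map S.g := by
    ext
    rw [HomologicalComplex.comp_f, HomologicalComplex.comp_f, hπ,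
      ChainComplex.single₀_map_f_zero]
    change biprod.snd ≫ r = biprod.desc (p ≫ S.f) l ≫ S.g
    ext
    · simp
    · simp [hl]
  -- The outer components of this morphism are the given resolutions, so the five lemma makes the
  -- middle one a quasi-isomorphism.
  let φ : t.shortComplex ⟶ S.map (ChainComplex.single₀ C) :=
    { τ₁ := P.π, τ₂ := π, τ₃ := R.π, comm₁₂ := c1.symm, comm₂₃ := c2.symm }
  exact ⟨t, π, quasiIso_τ₂_of_shortExact φ t.shortExact (hS.map_of_exact _)
    (fun j => ⟨j + 1, rfl⟩) P.quasiIso R.quasiIso, c1, c2⟩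

end Horseshoe

/-! ### Long exact sequence and comparison of left derived functors -/

section LongExactSequence

variable {C D : Type*} [Category* C] [Abelian C] [HasProjectiveResolutions C]
  [Category* D] [Abelian D]

/-- The long exact sequence of the left derived functors of an additive functor. -/
lemma Functor.exists_leftDerived_longExact (F : C ⥤ D) [F.Additive] {S : ShortComplex C}
    (hS : S.ShortExact) :
    ∃ δ : ∀ n, (F.leftDerived (n + 1)).obj S.X₃ ⟶ (F.leftDerived n).obj S.X₁,
      (∀ n, ∃ w, (ShortComplex.mk (δ n) ((F.leftDerived n).map S.f) w).Exact) ∧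
      (∀ n, ∃ w, (ShortComplex.mk ((F.leftDerived n).map S.f)
        ((F.leftDerived n).map S.g) w).Exact) ∧
      (∀ n, ∃ w, (ShortComplex.mk ((F.leftDerived (n + 1)).map S.g) (δ n) w).Exact) ∧
      Epi ((F.leftDerived 0).map S.g) := by
  obtain ⟨P⟩ := (HasProjectiveResolutions.out S.X₁).out
  obtain ⟨R⟩ := (HasProjectiveResolutions.out S.X₃).out
  obtain ⟨t, π, hπ, c1, c2⟩ := exists_horseshoe hS P R
  let Q : ProjectiveResolution S.X₂ :=
    { complex := t.total
      projective := fun n => inferInstanceAs (Projective (P.complex.X n ⊞ R.complex.X n))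
      π := π
      quasiIso := hπ }
  have hE := t.shortExact_map F
  have hrel (n : ℕ) : (ComplexShape.down ℕ).Rel (n + 1) n := rfl
  let a (n : ℕ) := P.isoLeftDerivedObj F n
  let b (n : ℕ) := Q.isoLeftDerivedObj F n
  let c (n : ℕ) := R.isoLeftDerivedObj F n
  have hf (n : ℕ) : (F.leftDerived n).map S.f = (a n).hom ≫ HomologicalComplex.homologyMap
      ((F.mapHomologicalComplex _).map t.inl) n ≫ (b n).inv :=
    F.leftDerived_map_eq n S.f (P := P) (Q := Q) t.inl c1
  have hg (n : ℕ) : (F.leftDerived n).map S.g = (b n).hom ≫ HomologicalComplex.homologyMap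
      ((F.mapHomologicalComplex _).map t.snd) n ≫ (c n).inv :=
    F.leftDerived_map_eq n S.g (P := Q) (Q := R) t.snd c2
  let δ (n : ℕ) : (F.leftDerived (n + 1)).obj S.X₃ ⟶ (F.leftDerived n).obj S.X₁ :=
    (c (n + 1)).hom ≫ hE.δ (n + 1) n (hrel n) ≫ (a n).inv
  -- Transport of exactness from the homology of the complexes `F P`, `F Q`, `F R` to the derived
  -- functors that they compute.
  have tr {X₁ X₂ X₃ Y₁ Y₂ Y₃ : D} {f : Y₁ ⟶ Y₂} {g : Y₂ ⟶ Y₃} {w : f ≫ g = 0}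
      (h : (ShortComplex.mk f g w).Exact) (e₁ : X₁ ≅ Y₁) (e₂ : X₂ ≅ Y₂) (e₃ : X₃ ≅ Y₃)
      (f' : X₁ ⟶ X₂) (g' : X₂ ⟶ X₃) (hf : f' = e₁.hom ≫ f ≫ e₂.inv)
      (hg : g' = e₂.hom ≫ g ≫ e₃.inv) : ∃ w, (ShortComplex.mk f' g' w).Exact := by
    subst hf hg
    have w' : (e₁.hom ≫ f ≫ e₂.inv) ≫ e₂.hom ≫ g ≫ e₃.inv = 0 := by
      simp [reassoc_of% w]
    exact ⟨w', ShortComplex.exact_of_iso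
      (ShortComplex.isoMk e₁.symm e₂.symm e₃.symm (by simp) (by simp)) h⟩
  refine ⟨δ, fun n => ?_, fun n => ?_, fun n => ?_, ?_⟩
  · exact tr (hE.homology_exact₁ (n + 1) n (hrel n)) (c (n + 1)) (a n) (b n) _ _ rfl (hf n)
  · exact tr (hE.homology_exact₂ n) (a n) (b n) (c n) _ _ (hf n) (hg n)
  · exact tr (hE.homology_exact₃ (n + 1) n (hrel n)) (b (n + 1)) (c (n + 1)) (a n) _ _
      (hg (n + 1)) rfl
  · rw [hg]
    have h1 : Epi (((F.mapHomologicalComplex (ComplexShape.down ℕ)).map t.snd).f 0) :=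
      ((t.splitting 0).map F).epi_g
    have := HomologicalComplex.epi_homologyMap_of_epi_of_not_rel
      ((F.mapHomologicalComplex (ComplexShape.down ℕ)).map t.snd) 0 (by simp)
    have hb : Epi (b 0).hom := inferInstance
    have hc : Epi (c 0).inv := inferInstance
    exact epi_comp' hb (epi_comp' this hc)

/-- Left derived functors and an exact functor that sends projective objects to acyclic ones. -/
lemma Functor.nonempty_leftDerived_iso {C' : Type*} [Category* C'] [Abelian C']
    [EnoughProjectives C'] (F : C ⥤ D) [F.Additive] [PreservesFiniteColimits F]
    (F' : C' ⥤ D) [F'.Additive] [PreservesFiniteColimits F'] (L : C' ⥤ C) [L.Additive]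
    (hL : ∀ S : ShortComplex C', S.ShortExact → (S.map L).ShortExact) (e : F' ≅ L ⋙ F)
    (hacyclic : ∀ (P : C') [Projective P] (n : ℕ), IsZero ((F.leftDerived (n + 1)).obj (L.obj P)))
    (n : ℕ) (X : C') : Nonempty ((F'.leftDerived n).obj X ≅ (F.leftDerived n).obj (L.obj X)) := by
  -- Right exactness of `F` and `F'` enters here: each agrees with its zeroth left derived functor.
  let e₀ : F'.leftDerived 0 ≅ L ⋙ F.leftDerived 0 :=
    F'.leftDerivedZeroIsoSelf ≪≫ e ≪≫ Functor.isoWhiskerLeft L F.leftDerivedZeroIsoSelf.symm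
  induction n generalizing X with
  | zero => exact ⟨e₀.app X⟩
  | succ n ih =>
    -- Dimension shifting along `0 → K → P → X → 0` with `P` projective. The term at `P` vanishes in
    -- positive degrees on one side by projectivity and on the other by `hacyclic`.
    let S : ShortComplex C' := ShortComplex.mk (kernel.ι (Projective.π X)) (Projective.π X)
      (kernel.condition _)
    have hS : S.ShortExact :=
      { exact := ShortComplex.exact_kernel _
        mono_f := inferInstanceAs (Mono (kernel.ι _))
        epi_g := inferInstanceAs (Epi (Projective.π X)) }
    obtain ⟨δ', h₁', -, h₃', -⟩ := F'.exists_leftDerived_longExact hS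
    obtain ⟨δ, h₁, -, h₃, -⟩ := F.exists_leftDerived_longExact (hL S hS)
    obtain ⟨w', hw'⟩ := h₁' n
    obtain ⟨w, hw⟩ := h₁ n
    have hP : Projective S.X₂ := inferInstanceAs (Projective (Projective.over X))
    have m' : Mono (δ' n) := (h₃' n).choose_spec.mono_g
      ((F'.isZero_leftDerived_obj_projective_succ n S.X₂).eq_of_src _ _)
    have m : Mono (δ n) := (h₃ n).choose_spec.mono_g ((hacyclic S.X₂ n).eq_of_src _ _)
    -- In degree one, both sides are the kernel of the map from the zeroth derived functor at `K` to
    -- that at `P`, so naturality of `e₀` is needed. In higher degrees the connecting maps are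
    -- isomorphisms, and an isomorphism at the single object `K` is enough.
    cases n with
    | zero =>
      let k' := hw'.fIsKernel
      let k := hw.fIsKernel
      exact ⟨KernelFork.mapIsoOfIsLimit k' k (Arrow.isoMk (e₀.app S.X₁) (e₀.app S.X₂)
        (e₀.hom.naturality S.f).symm)⟩
    | succ n =>
      have i' : Epi (δ' (n + 1)) :=
        hw'.epi_f ((F'.isZero_leftDerived_obj_projective_succ n S.X₂).eq_of_tgt _ _)
      have i : Epi (δ (n + 1)) := hw.epi_f ((hacyclic S.X₂ n).eq_of_tgt _ _)
      have := isIso_of_mono_of_epi (δ' (n + 1))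
      have := isIso_of_mono_of_epi (δ (n + 1))
      obtain ⟨j⟩ := ih S.X₁
      exact ⟨asIso (δ' (n + 1)) ≪≫ j ≪≫ (asIso (δ (n + 1))).symm⟩

end LongExactSequence

end CategoryTheory

/-! ### Tensor products over noncommutative rings and right exactness -/

namespace BalancedTensor

section Basic

variable {S : Type u} [Ring S] {A : Type u} [AddCommGroup A] [Module Sᵐᵒᵖ A]
  {M : Type u} [AddCommGroup M] [Module S M] {B : Type*} [AddCommGroup B]

variable (S) in
/-- The element `a ⊗ m` of `A ⊗_S M`. -/
def tmul (a : A) (m : M) : BalancedTensor S A M :=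
  QuotientAddGroup.mk' (balancedRelations S A M) (a ⊗ₜ[ℤ] m)

lemma tmul_add (a : A) (m n : M) : tmul S a (m + n) = tmul S a m + tmul S a n := by
  rw [tmul, TensorProduct.tmul_add, map_add]; rfl

lemma add_tmul (a b : A) (m : M) : tmul S (a + b) m = tmul S a m + tmul S b m := by
  rw [tmul, TensorProduct.add_tmul, map_add]; rfl

@[simp] lemma tmul_zero (a : A) : tmul S a (0 : M) = 0 := by
  rw [tmul, TensorProduct.tmul_zero, map_zero]

@[simp] lemma zero_tmul (m : M) : tmul S (0 : A) m = 0 := by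
  rw [tmul, TensorProduct.zero_tmul, map_zero]

lemma smul_tmul (s : S) (a : A) (m : M) :
    tmul S (MulOpposite.op s • a) m = tmul S a (s • m) := by
  refine sub_eq_zero.1 ((map_sub _ _ _).symm.trans ((QuotientAddGroup.eq_zero_iff _).2 ?_))
  exact AddSubgroup.subset_closure ⟨a, s, m, rfl⟩

@[elab_as_elim]
lemma induction {p : BalancedTensor S A M → Prop} (zero : p 0) (tmul : ∀ a m, p (tmul S a m))
    (add : ∀ x y, p x → p y → p (x + y)) (x : BalancedTensor S A M) : p x := by
  obtain ⟨x, rfl⟩ := QuotientAddGroup.mk'_surjective _ x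
  induction x with
  | zero => rw [map_zero]; exact zero
  | tmul a m => exact tmul a m
  | add x y hx hy => rw [map_add]; exact add _ _ hx hy

/-- The homomorphism from `A ⊗_S M` given by a balanced biadditive map. -/
def lift (f : A → M → B) (hl : ∀ a a' m, f (a + a') m = f a m + f a' m)
    (hr : ∀ a m m', f a (m + m') = f a m + f a m')
    (hb : ∀ a (s : S) m, f (MulOpposite.op s • a) m = f a (s • m)) : BalancedTensor S A M →+ B :=
  let φ : A →+ M →+ B := AddMonoidHom.mk' (fun a => AddMonoidHom.mk' (f a) (hr a))
    fun a a' => AddMonoidHom.ext fun m => hl a a' m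
  QuotientAddGroup.lift _ (TensorProduct.liftAddHom (R := ℤ) φ fun n a m => by
    rw [map_zsmul, map_zsmul]; rfl) <| by
    rw [balancedRelations, AddSubgroup.closure_le]
    rintro _ ⟨a, s, m, rfl⟩
    change _ = _
    rw [map_sub, sub_eq_zero]
    exact hb a s m

lemma hom_ext {f g : BalancedTensor S A M →+ B}
    (h : ∀ a m, f (tmul S a m) = g (tmul S a m)) : f = g := by
  refine AddMonoidHom.ext fun x => ?_
  induction x using induction with
  | zero => rw [map_zero, map_zero]
  | tmul a m => exact h a m
  | add x y hx hy => rw [map_add, map_add, hx, hy]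

end Basic

section Semilinear

variable {S : Type u} [Ring S] {A : Type u} [AddCommGroup A] [Module Sᵐᵒᵖ A]
  {M : Type u} [AddCommGroup M] [Module S M]
  {S' : Type u} [Ring S'] {A' : Type u} [AddCommGroup A'] [Module S'ᵐᵒᵖ A']
  {M' : Type u} [AddCommGroup M'] [Module S' M']

/-- The homomorphism `A ⊗_S M → A' ⊗_{S'} M'` induced by maps that are semilinear with respect
to a ring homomorphism `S → S'`. -/
def map₂ (σ : S →+* S') (p : A →+ A') (q : M →+ M')
    (hp : ∀ s a, p (MulOpposite.op s • a) = MulOpposite.op (σ s) • p a)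
    (hq : ∀ s m, q (s • m) = σ s • q m) : BalancedTensor S A M →+ BalancedTensor S' A' M' :=
  lift (fun a m => tmul S' (p a) (q m)) (fun a a' m => by rw [map_add, add_tmul])
    (fun a m m' => by rw [map_add, tmul_add]) (fun a s m => by rw [hp, hq, smul_tmul])

variable (σ : S →+* S') (p : A →+ A') (q : M →+ M')
    (hp : ∀ s a, p (MulOpposite.op s • a) = MulOpposite.op (σ s) • p a)
    (hq : ∀ s m, q (s • m) = σ s • q m)

@[simp] lemma map₂_tmul (a : A) (m : M) :
    map₂ σ p q hp hq (tmul S a m) = tmul S' (p a) (q m) := rfl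

include hp hq in
-- As all three maps are surjective, every balancing relation over `S'` lifts to one over `S`.
lemma balancedRelations_le_map (hσs : Function.Surjective σ) (hps : Function.Surjective p)
    (hqs : Function.Surjective q) :
    balancedRelations S' A' M' ≤ (balancedRelations S A M).map
      (TensorProduct.map p.toIntLinearMap q.toIntLinearMap).toAddMonoidHom := by
  rw [balancedRelations, AddSubgroup.closure_le]
  rintro _ ⟨a, s, m, rfl⟩
  obtain ⟨a, rfl⟩ := hps a
  obtain ⟨s, rfl⟩ := hσs s
  obtain ⟨m, rfl⟩ := hqs m
  refine ⟨_, AddSubgroup.subset_closure ⟨a, s, m, rfl⟩, ?_⟩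
  rw [map_sub]
  change p _ ⊗ₜ q m - p a ⊗ₜ q _ = _
  rw [hp, hq]

include hp hq in
lemma map₂_surjective (hps : Function.Surjective p) (hqs : Function.Surjective q) :
    Function.Surjective (map₂ σ p q hp hq) := by
  intro x
  induction x using induction with
  | zero => exact ⟨0, map_zero _⟩
  | tmul a m =>
    obtain ⟨a, rfl⟩ := hps a
    obtain ⟨m, rfl⟩ := hqs m
    exact ⟨tmul S a m, rfl⟩
  | add x y hx hy =>
    obtain ⟨x, rfl⟩ := hx
    obtain ⟨y, rfl⟩ := hy
    exact ⟨x + y, map_add _ _ _⟩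

/-- The kernel of the surjection `A ⊗_S M → A' ⊗_{S'} M'` is generated by the elements `a ⊗ m`
with `a` in the kernel of `A → A'` or `m` in the kernel of `M → M'`. -/
lemma map₂_induction (hσs : Function.Surjective σ) (hps : Function.Surjective p)
    (hqs : Function.Surjective q) (H : AddSubgroup (BalancedTensor S A M))
    (h₁ : ∀ a m, p a = 0 → tmul S a m ∈ H) (h₂ : ∀ a m, q m = 0 → tmul S a m ∈ H)
    {x : BalancedTensor S A M} (hx : map₂ σ p q hp hq x = 0) : x ∈ H := by
  obtain ⟨x, rfl⟩ := QuotientAddGroup.mk'_surjective _ x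
  have hcomp : ∀ y, map₂ σ p q hp hq (QuotientAddGroup.mk' _ y) = QuotientAddGroup.mk' _
      (TensorProduct.map p.toIntLinearMap q.toIntLinearMap y) := by
    intro y
    induction y with
    | zero => simp only [map_zero]
    | tmul a m => rfl
    | add x y hx hy => simp only [map_add, hx, hy]
  rw [hcomp] at hx
  -- Over `ℤ` the image of `x` is a combination of relations, which lifts to a combination `w` of
  -- relations upstairs. So `x - w` represents the same class and lies in the kernel of the tensor
  -- product over `ℤ`, where right exactness is known.
  obtain ⟨w, hw, hwx⟩ := balancedRelations_le_map σ p q hp hq hσs hps hqs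
    ((QuotientAddGroup.eq_zero_iff _).1 hx)
  have hker : x - w ∈ LinearMap.ker (TensorProduct.map p.toIntLinearMap q.toIntLinearMap) := by
    rw [LinearMap.mem_ker, map_sub, sub_eq_zero]
    exact hwx.symm
  rw [TensorProduct.map_ker (f := (LinearMap.ker p.toIntLinearMap).subtype)
    (LinearMap.exact_subtype_ker_map _) hps (f' := (LinearMap.ker q.toIntLinearMap).subtype)
    (LinearMap.exact_subtype_ker_map _) hqs] at hker
  have hx' : QuotientAddGroup.mk' (balancedRelations S A M) x =
      QuotientAddGroup.mk' (balancedRelations S A M) (x - w) := by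
    have hw0 : QuotientAddGroup.mk' (balancedRelations S A M) w = 0 :=
      (QuotientAddGroup.eq_zero_iff w).2 hw
    rw [map_sub, hw0, sub_zero]
  rw [hx']
  obtain ⟨y, ⟨y, rfl⟩, z, ⟨z, rfl⟩, hyz⟩ := Submodule.mem_sup.1 hker
  rw [← hyz, map_add]
  clear hyz
  refine add_mem ?_ ?_
  · induction y with
    | zero => rw [map_zero, map_zero]; exact zero_mem _
    | tmul a m => exact h₂ a m.1 m.2
    | add x y hx hy => rw [map_add, map_add]; exact add_mem hx hy
  · induction z with
    | zero => rw [map_zero, map_zero]; exact zero_mem _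
    | tmul a m => exact h₁ a.1 m a.2
    | add x y hx hy => rw [map_add, map_add]; exact add_mem hx hy

end Semilinear

section Linear

variable {S : Type u} [Ring S] {A A' A'' : Type u} [AddCommGroup A] [Module Sᵐᵒᵖ A]
  [AddCommGroup A'] [Module Sᵐᵒᵖ A'] [AddCommGroup A''] [Module Sᵐᵒᵖ A'']
  {M M' M'' : Type u} [AddCommGroup M] [Module S M] [AddCommGroup M'] [Module S M']
  [AddCommGroup M''] [Module S M'']

@[simp] lemma map_tmul (f : M →ₗ[S] M') (a : A) (m : M) :
    BalancedTensor.map S A f (tmul S a m) = tmul S a (f m) := rfl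

/-- The homomorphism `A ⊗_S M → A' ⊗_S M` induced by a linear map `A → A'`. -/
def mapLeft (M : Type u) [AddCommGroup M] [Module S M] (p : A →ₗ[Sᵐᵒᵖ] A') :
    BalancedTensor S A M →+ BalancedTensor S A' M :=
  map₂ (RingHom.id S) p.toAddMonoidHom (AddMonoidHom.id M) (fun _ a => p.map_smul _ a)
    (fun _ _ => rfl)

@[simp] lemma mapLeft_tmul (p : A →ₗ[Sᵐᵒᵖ] A') (a : A) (m : M) :
    mapLeft M p (tmul S a m) = tmul S (p a) m := rfl

lemma mapLeft_map (p : A →ₗ[Sᵐᵒᵖ] A') (f : M →ₗ[S] M') (x : BalancedTensor S A M) :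
    mapLeft M' p (BalancedTensor.map S A f x) = BalancedTensor.map S A' f (mapLeft M p x) := by
  have : (mapLeft M' p).comp (BalancedTensor.map S A f) =
      (BalancedTensor.map S A' f).comp (mapLeft M p) := hom_ext fun a m => rfl
  exact DFunLike.congr_fun this x

lemma map_map (f : M →ₗ[S] M') (g : M' →ₗ[S] M'') (x : BalancedTensor S A M) :
    BalancedTensor.map S A g (BalancedTensor.map S A f x) = BalancedTensor.map S A (g ∘ₗ f) x := by
  have : (BalancedTensor.map S A g).comp (BalancedTensor.map S A f) =
      BalancedTensor.map S A (g ∘ₗ f) := hom_ext fun a m => rfl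
  exact DFunLike.congr_fun this x

variable (S A) in
lemma map_surjective {g : M' →ₗ[S] M''} (hg : Function.Surjective g) :
    Function.Surjective (BalancedTensor.map S A g) := by
  have : BalancedTensor.map S A g = map₂ (RingHom.id S) (AddMonoidHom.id A) g.toAddMonoidHom
      (fun _ _ => rfl) (fun s m => g.map_smul s m) := hom_ext fun a m => rfl
  rw [this]
  exact map₂_surjective _ _ _ _ _ Function.surjective_id hg

variable (S A) in
-- Right exactness is the case of `map₂_induction` in which the ring and the right module do not
-- change, so that only `M' → M''` contributes to the kernel.
lemma map_exact {f : M →ₗ[S] M'} {g : M' →ₗ[S] M''} (h : Function.Exact f g)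
    (hg : Function.Surjective g) :
    Function.Exact (BalancedTensor.map S A f) (BalancedTensor.map S A g) := by
  intro x
  constructor
  · intro hx
    have : BalancedTensor.map S A g = map₂ (RingHom.id S) (AddMonoidHom.id A) g.toAddMonoidHom
        (fun _ _ => rfl) (fun s m => g.map_smul s m) := hom_ext fun a m => rfl
    rw [this] at hx
    refine map₂_induction _ _ _ _ _ Function.surjective_id Function.surjective_id hg
      (BalancedTensor.map S A f).range ?_ ?_ hx
    · rintro _ m rfl
      rw [zero_tmul]
      exact zero_mem _
    · intro a m hm
      obtain ⟨m, rfl⟩ := (h m).1 hm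
      exact ⟨tmul S a m, rfl⟩
  · rintro ⟨x, rfl⟩
    rw [map_map]
    have : g ∘ₗ f = 0 := LinearMap.ext fun m => h.apply_apply_eq_zero m
    rw [this]
    induction x using induction with
    | zero => exact map_zero _
    | tmul a m => exact tmul_zero a
    | add x y hx hy => rw [map_add, hx, hy, add_zero]

variable (M) in
lemma mapLeft_surjective {p : A' →ₗ[Sᵐᵒᵖ] A''} (hp : Function.Surjective p) :
    Function.Surjective (mapLeft M p) :=
  map₂_surjective _ _ _ _ _ hp Function.surjective_id

variable (M) in
lemma mapLeft_exact {i : A →ₗ[Sᵐᵒᵖ] A'} {p : A' →ₗ[Sᵐᵒᵖ] A''} (h : Function.Exact i p)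
    (hp : Function.Surjective p) : Function.Exact (mapLeft M i) (mapLeft M p) := by
  intro x
  constructor
  · intro hx
    refine map₂_induction _ _ _ _ _ Function.surjective_id hp Function.surjective_id
      (mapLeft M i).range ?_ ?_ hx
    · intro a m ha
      obtain ⟨a, rfl⟩ := (h a).1 ha
      exact ⟨tmul S a m, rfl⟩
    · rintro a _ rfl
      rw [tmul_zero]
      exact zero_mem _
  · rintro ⟨x, rfl⟩
    induction x using induction with
    | zero => rw [map_zero, map_zero]
    | tmul a m =>
      rw [mapLeft_tmul, mapLeft_tmul, h.apply_apply_eq_zero, zero_tmul]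
    | add x y hx hy => rw [map_add, map_add, hx, hy, add_zero]

end Linear

/-! ### Flat modules -/

section Flat

variable (S : Type u) [Ring S]

/-- Flatness of a left module over a ring that need not be commutative. -/
def IsFlat (Y : Type u) [AddCommGroup Y] [Module S Y] : Prop :=
  ∀ ⦃A A' : Type u⦄ [AddCommGroup A] [AddCommGroup A'] [Module Sᵐᵒᵖ A] [Module Sᵐᵒᵖ A']
    (p : A →ₗ[Sᵐᵒᵖ] A'), Function.Injective p → Function.Injective (mapLeft Y p)

variable {S}
variable {A A' : Type u} [AddCommGroup A] [Module Sᵐᵒᵖ A] [AddCommGroup A'] [Module Sᵐᵒᵖ A']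
  {Y Y' P X : Type u} [AddCommGroup Y] [Module S Y] [AddCommGroup P] [Module S P]
  [AddCommGroup Y'] [Module S Y']

/-- Retracts of flat modules are flat. -/
lemma IsFlat.of_retract (hY : IsFlat S Y) (i : Y' →ₗ[S] Y) (r : Y →ₗ[S] Y')
    (hri : r ∘ₗ i = LinearMap.id) : IsFlat S Y' := by
  intro A A' _ _ _ _ p hp
  rw [injective_iff_map_eq_zero]
  intro x hx
  have h := (injective_iff_map_eq_zero _).1 (hY p hp) (BalancedTensor.map S A i x) (by
    rw [mapLeft_map, hx, map_zero])
  have h' := congrArg (BalancedTensor.map S A r) h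
  rw [map_map, hri, map_zero] at h'
  have hid : BalancedTensor.map S A (LinearMap.id : Y' →ₗ[S] Y') = AddMonoidHom.id _ :=
    hom_ext fun _ _ => rfl
  rwa [hid] at h'

/-- The coefficients of an element of `A ⊗_S P` with respect to a map from `P` to a free module. -/
noncomputable def coeffs (A : Type u) [AddCommGroup A] [Module Sᵐᵒᵖ A] (s : P →ₗ[S] X →₀ S) :
    BalancedTensor S A P →+ (X →₀ A) :=
  lift (fun a y => (s y).mapRange (fun t => MulOpposite.op t • a) (by simp))
    (fun a a' m => by ext x; simp) (fun a m m' => by ext x; simp [add_smul])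
    (fun a t m => by ext x; simp [mul_smul])

@[simp] lemma coeffs_tmul (s : P →ₗ[S] X →₀ S) (a : A) (y : P) (x : X) :
    coeffs A s (tmul S a y) x = MulOpposite.op (s y x) • a := rfl

lemma coeffs_mapLeft (s : P →ₗ[S] X →₀ S) (p : A →ₗ[Sᵐᵒᵖ] A') (z : BalancedTensor S A P) (x : X) :
    coeffs A' s (mapLeft P p z) x = p (coeffs A s z x) := by
  induction z using induction with
  | zero => simp
  | tmul a m => simp
  | add y z hy hz => simp [hy, hz]

/-- An element of `A ⊗_S P` is determined by its coefficients with respect to a dual basis. -/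
lemma sum_coeffs (s : P →ₗ[S] P →₀ S) (hs : Finsupp.linearCombination S id ∘ₗ s = LinearMap.id)
    (z : BalancedTensor S A P) : (coeffs A s z).sum (fun x a => tmul S a x) = z := by
  classical
  let γ : (P →₀ A) →+ BalancedTensor S A P := Finsupp.liftAddHom fun x =>
    AddMonoidHom.mk' (fun a => tmul S a x) fun a b => add_tmul a b x
  change γ (coeffs A s z) = z
  induction z using induction with
  | zero => simp
  | tmul a m =>
    -- The dual basis identity `m = ∑ s(m)_x x`; the scalars `s(m)_x` are then moved across the
    -- tensor sign.
    have h : m = (s m).sum fun x t => t • x := (LinearMap.congr_fun hs m).symm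
    let ta : P →+ BalancedTensor S A P := AddMonoidHom.mk' (tmul S a) (tmul_add a)
    change ((s m).mapRange (fun t => MulOpposite.op t • a) (by simp)).sum (fun x a => tmul S a x) = ta m
    rw [Finsupp.sum_mapRange_index (by simp)]
    conv_rhs => rw [h]
    rw [map_finsuppSum]
    exact Finsupp.sum_congr fun x _ => smul_tmul _ _ _
  | add y z hy hz => rw [map_add, map_add, hy, hz]

/-- Coefficients with respect to a dual basis are natural in the right module and determine the
tensor, so an injection of right modules can be tested coefficient by coefficient. -/
lemma IsFlat.of_projective [Module.Projective S P] : IsFlat S P := by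
  obtain ⟨s, hs⟩ := (Module.projective_def' (R := S) (P := P)).1 inferInstance
  intro A A' _ _ _ _ p hp
  rw [injective_iff_map_eq_zero]
  intro z hz
  have : coeffs A s z = 0 := by
    ext x
    apply hp
    rw [← coeffs_mapLeft, hz]
    simp
  rw [← sum_coeffs s hs z, this, Finsupp.sum_zero_index]

/-- Tensor products with free right modules preserve injections. -/
lemma map_injective_of_free (X : Type u) {f : Y →ₗ[S] Y'} (hf : Function.Injective f) :
    Function.Injective (BalancedTensor.map S (X →₀ Sᵐᵒᵖ) f) := by
  classical
  -- `β` sends `c ⊗ y` to the family `x ↦ c_x y`, naturally in `Y`; the map `γ` below is a left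
  -- inverse of it, so an element is zero as soon as its image under `β` is.
  let β (Y : Type u) [AddCommGroup Y] [Module S Y] :
      BalancedTensor S (X →₀ Sᵐᵒᵖ) Y →+ (X →₀ Y) :=
    lift (fun c y => c.mapRange (fun t => t.unop • y) (by simp))
      (fun a a' m => by ext x; simp [add_smul]) (fun a m m' => by ext x; simp)
      (fun a t m => by ext x; simp [mul_smul])
  have hβ (z : BalancedTensor S (X →₀ Sᵐᵒᵖ) Y) (x : X) :
      β Y' (BalancedTensor.map S _ f z) x = f (β Y z x) := by
    induction z using induction with
    | zero => simp
    | tmul a m => exact (f.map_smul _ _).symm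
    | add y z hy hz => simp [hy, hz]
  let γ : (X →₀ Y) →+ BalancedTensor S (X →₀ Sᵐᵒᵖ) Y := Finsupp.liftAddHom fun x =>
    AddMonoidHom.mk' (fun y => tmul S (Finsupp.single x 1) y) fun a b => tmul_add _ a b
  have hγ (z : BalancedTensor S (X →₀ Sᵐᵒᵖ) Y) : γ (β Y z) = z := by
    induction z using induction with
    | zero => simp
    | tmul c y =>
      induction c using Finsupp.induction_linear with
      | zero => simp
      | add c d hc hd => rw [add_tmul, map_add, map_add, hc, hd]
      | single x t =>
        change γ ((Finsupp.single x t).mapRange (fun t => t.unop • y) (by simp)) = _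
        rw [Finsupp.mapRange_single]
        refine (Finsupp.liftAddHom_apply_single _ _ _).trans ?_
        change tmul S _ (t.unop • y) = _
        rw [← smul_tmul]
        simp
    | add y z hy hz => rw [map_add, map_add, hy, hz]
  rw [injective_iff_map_eq_zero]
  intro z hz
  have : β Y z = 0 := by
    ext x
    apply hf
    rw [← hβ, hz]
    simp
  rw [← hγ z, this, map_zero]

/-- A diagram chase that takes the place of the vanishing of `Tor_1(A'', Y')`. If `z` in `A' ⊗ Y`
dies in `A'' ⊗ P`, its image in `A' ⊗ P` comes from some `w` in `A ⊗ P`. Flatness of `Y'` makes `w`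
vanish in `A ⊗ Y'`, so `w` comes from `A ⊗ Y`; injectivity over `A'` then shows that `z` comes from
`A ⊗ Y` and dies in `A'' ⊗ Y`. -/
lemma map_injective_of_presentation {A'' : Type u} [AddCommGroup A''] [Module Sᵐᵒᵖ A'']
    {i : A →ₗ[Sᵐᵒᵖ] A'} {p : A' →ₗ[Sᵐᵒᵖ] A''} (hi : Function.Injective i)
    (hip : Function.Exact i p) (hp : Function.Surjective p) {f : Y →ₗ[S] P} {g : P →ₗ[S] Y'}
    (hf : Function.Injective (BalancedTensor.map S A' f)) (h : Function.Exact f g)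
    (hg : Function.Surjective g) (hY : IsFlat S Y') :
    Function.Injective (BalancedTensor.map S A'' f) := by
  rw [injective_iff_map_eq_zero]
  intro z hz
  obtain ⟨z, rfl⟩ := mapLeft_surjective Y hp z
  rw [← mapLeft_map] at hz
  obtain ⟨w, hw⟩ := (mapLeft_exact P hip hp _).1 hz
  have hw0 : BalancedTensor.map S _ g w = 0 := by
    apply hY i hi
    rw [mapLeft_map, hw, map_zero]
    exact (map_exact S _ h hg).apply_apply_eq_zero z
  obtain ⟨v, rfl⟩ := (map_exact S _ h hg w).1 hw0
  rw [mapLeft_map] at hw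
  rw [← hf hw]
  exact (mapLeft_exact Y hip hp).apply_apply_eq_zero v

/-- Tensoring preserves injections with flat cokernel. -/
lemma map_injective_of_isFlat {f : Y →ₗ[S] P} {g : P →ₗ[S] Y'} (hf : Function.Injective f)
    (h : Function.Exact f g) (hg : Function.Surjective g) (hY : IsFlat S Y') :
    Function.Injective (BalancedTensor.map S A f) := by
  -- A free presentation of the right module `A` reduces the claim to free modules, for which no
  -- flatness is needed.
  let p : (A →₀ Sᵐᵒᵖ) →ₗ[Sᵐᵒᵖ] A := Finsupp.linearCombination _ id
  let K : Submodule Sᵐᵒᵖ (A →₀ Sᵐᵒᵖ) := LinearMap.ker p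
  exact map_injective_of_presentation (A := K) (i := K.subtype) (p := p) Subtype.val_injective
    (LinearMap.exact_subtype_ker_map _) (Finsupp.linearCombination_id_surjective _ _)
    (map_injective_of_free A hf) h hg hY

/-- Kernels of surjections of flat modules are flat. -/
lemma IsFlat.of_exact {f : Y →ₗ[S] P} {g : P →ₗ[S] Y'} (hf : Function.Injective f)
    (h : Function.Exact f g) (hg : Function.Surjective g) (hP : IsFlat S P) (hY : IsFlat S Y') :
    IsFlat S Y := by
  intro A A' _ _ _ _ p hp
  have : BalancedTensor.map S A' f ∘ mapLeft Y p = mapLeft P p ∘ BalancedTensor.map S A f :=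
    funext fun x => (mapLeft_map p f x).symm
  refine Function.Injective.of_comp (f := BalancedTensor.map S A' f) ?_
  rw [this]
  exact (hP p hp).comp (map_injective_of_isFlat hf h hg hY)

end Flat

end BalancedTensor

/-! ### Exactness, projectivity and acyclicity for unitary modules -/

section UnitaryModules

open Limits

variable {R : Type u} [NonUnitalRing R] [HasLocalUnits R]

instance : (IsUnitary R).ι.PreservesHomology where
  preservesKernels := (IsUnitary R).preservesKernels_ι
  preservesCokernels := (IsUnitary R).preservesCokernels_ι

namespace UnitaryMod

lemma surjective_of_epi {X Y : UnitaryMod R} (f : X ⟶ Y) [Epi f] :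
    Function.Surjective f.hom := by
  have := (IsUnitary R).preservesEpimorphisms_ι_of_isNormalMonoCategory
  exact (ModuleCat.epi_iff_surjective _).1 (inferInstanceAs (Epi ((IsUnitary R).ι.map f)))

omit [HasLocalUnits R] in
lemma epi_of_surjective {X Y : UnitaryMod R} (f : X ⟶ Y) (hf : Function.Surjective f.hom) :
    Epi f := by
  have := (ModuleCat.epi_iff_surjective f.hom).2 hf
  exact (IsUnitary R).ι.epi_of_epi_map this

/-- The inclusion into all modules is faithful and preserves homology, so exactness is visible on
underlying groups. Functors that leave these groups unchanged are therefore exact. -/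
lemma shortExact_iff (S : ShortComplex (UnitaryMod R)) :
    S.ShortExact ↔ Function.Injective S.f.hom ∧ Function.Exact S.f.hom S.g.hom ∧
      Function.Surjective S.g.hom := by
  rw [← ModuleCat.mono_iff_injective, ← ModuleCat.epi_iff_surjective]
  have h : (S.map (IsUnitary R).ι).Exact ↔ Function.Exact S.f.hom S.g.hom :=
    ShortComplex.ShortExact.moduleCat_exact_iff_function_exact (S.map (IsUnitary R).ι)
  rw [← h, ShortComplex.exact_map_iff_of_faithful]
  have hm := (IsUnitary R).preservesMonomorphisms_ι_of_isNormalEpiCategory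
  constructor
  · intro hS
    have := hS.mono_f
    have := hS.epi_g
    exact ⟨inferInstanceAs (Mono ((IsUnitary R).ι.map S.f)), hS.exact,
      (ModuleCat.epi_iff_surjective _).2 (surjective_of_epi S.g)⟩
  · rintro ⟨h1, h2, h3⟩
    have h1' : Mono ((IsUnitary R).ι.map S.f) := h1
    exact { exact := h2, mono_f := (IsUnitary R).ι.mono_of_mono_map h1'
            epi_g := epi_of_surjective _ ((ModuleCat.epi_iff_surjective _).1 h3) }

/-- Projective unitary modules are projective over the unitization. -/
lemma module_projective (P : UnitaryMod R) [Projective P] :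
    Module.Projective (Unitized R) P.obj := by
  let F := P.obj →₀ Unitized R
  -- The free module `F` over the unitization is not unitary in general, so its unitary part is used
  -- to cover `P`. It still maps onto `P`, since `x = e x` is the image of `e` times the basis
  -- vector at `x`.
  let X : UnitaryMod R := ⟨ModuleCat.of _ (unitaryPart R F), isUnitary_unitaryPart F⟩
  let l : unitaryPart R F →ₗ[Unitized R] P.obj :=
    Finsupp.linearCombination _ id ∘ₗ (unitaryPart R F).subtype
  let p : X ⟶ P := (IsUnitary R).homMk (ModuleCat.ofHom l)
  have hp : Epi p := by
    refine epi_of_surjective _ fun x => ?_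
    obtain ⟨e, -, he⟩ := (isUnitary_iff P.obj).1 P.property x
    refine ⟨⟨Unitized.inr e • Finsupp.single x (1 : Unitized R), smul_mem_unitaryPart _ _⟩, ?_⟩
    change Finsupp.linearCombination (Unitized R) id
      (Unitized.inr e • Finsupp.single x (1 : Unitized R)) = x
    rw [map_smul, Finsupp.linearCombination_single, one_smul]
    exact he
  let s : P ⟶ X := Projective.factorThru (𝟙 P) p
  have hs : s ≫ p = 𝟙 P := Projective.factorThru_comp _ _
  refine Module.Projective.of_split ((unitaryPart R F).subtype ∘ₗ s.hom.hom)
    (Finsupp.linearCombination _ id) ?_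
  ext x
  exact congrArg (fun f : P ⟶ P => f.hom x) hs

variable (A : Type u) [AddCommGroup A] [Module (Unitized R)ᵐᵒᵖ A]

instance : PreservesFiniteColimits ((IsUnitary R).ι ⋙ tensorFunctor (Unitized R) A) := by
  refine ((Functor.preservesFiniteColimits_tfae _).out 0 3).1 fun S hS => ?_
  obtain ⟨-, h, hg⟩ := (shortExact_iff S).1 hS
  exact ⟨(ShortComplex.ab_exact_iff_function_exact _).2 (BalancedTensor.map_exact _ A h hg),
    (AddCommGrpCat.epi_iff_surjective _).2 (BalancedTensor.map_surjective _ A hg)⟩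

/-- Flat unitary modules have no higher `Tor`. -/
lemma isZero_torFunctor_of_isFlat (Y : UnitaryMod R)
    (hY : BalancedTensor.IsFlat (Unitized R) Y.obj) (n : ℕ) :
    IsZero ((torFunctor A (n + 1)).obj Y) := by
  let F := (IsUnitary R).ι ⋙ tensorFunctor (Unitized R) A
  change IsZero ((F.leftDerived (n + 1)).obj Y)
  induction n generalizing Y with
  | zero =>
    let S : ShortComplex (UnitaryMod R) := ShortComplex.mk (kernel.ι (Projective.π Y))
      (Projective.π Y) (kernel.condition _)
    have hS : S.ShortExact :=
      { exact := ShortComplex.exact_kernel _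
        mono_f := inferInstanceAs (Mono (kernel.ι _))
        epi_g := inferInstanceAs (Epi (Projective.π Y)) }
    have hP : Projective S.X₂ := inferInstanceAs (Projective (Projective.over Y))
    obtain ⟨δ, h₁, -, h₃, -⟩ := F.exists_leftDerived_longExact hS
    obtain ⟨hi, he, hs⟩ := (shortExact_iff S).1 hS
    obtain ⟨w, hw⟩ := h₁ 0
    have m : Mono (δ 0) := (h₃ 0).choose_spec.mono_g
      ((F.isZero_leftDerived_obj_projective_succ 0 S.X₂).eq_of_src _ _)
    -- The cokernel `Y` is flat, so tensoring keeps `K → P` injective. The connecting map composes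
    -- with this injection to zero, hence vanishes; being mono as well, it forces its source to
    -- vanish.
    have hF : Mono (F.map S.f) := (AddCommGrpCat.mono_iff_injective _).2
      (BalancedTensor.map_injective_of_isFlat (A := A) hi he hs hY)
    have hF' : Mono ((F.leftDerived 0).map S.f) := by
      have := F.leftDerivedZeroIsoSelf.hom.naturality S.f
      have h2 : Mono ((F.leftDerived 0).map S.f ≫ F.leftDerivedZeroIsoSelf.hom.app S.X₂) := by
        rw [this]; infer_instance
      exact mono_of_mono _ (F.leftDerivedZeroIsoSelf.hom.app S.X₂)
    have : δ 0 = 0 := by rw [← cancel_mono ((F.leftDerived 0).map S.f), w, zero_comp]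
    rw [this] at m
    exact IsZero.of_mono_zero _ ((F.leftDerived 0).obj S.X₁)
  | succ n ih =>
    let S : ShortComplex (UnitaryMod R) := ShortComplex.mk (kernel.ι (Projective.π Y))
      (Projective.π Y) (kernel.condition _)
    have hS : S.ShortExact :=
      { exact := ShortComplex.exact_kernel _
        mono_f := inferInstanceAs (Mono (kernel.ι _))
        epi_g := inferInstanceAs (Epi (Projective.π Y)) }
    have hP : Projective S.X₂ := inferInstanceAs (Projective (Projective.over Y))
    obtain ⟨δ, -, -, h₃, -⟩ := F.exists_leftDerived_longExact hS
    obtain ⟨hi, he, hs⟩ := (shortExact_iff S).1 hS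
    have m : Mono (δ (n + 1)) := (h₃ (n + 1)).choose_spec.mono_g
      ((F.isZero_leftDerived_obj_projective_succ (n + 1) S.X₂).eq_of_src _ _)
    -- The kernel of the projective cover is again flat, so the induction hypothesis applies to it,
    -- and the connecting map embeds the next `Tor` of `Y` into its `Tor`.
    have := module_projective S.X₂
    exact IsZero.of_mono (δ (n + 1)) (ih S.X₁ (.of_exact hi he hs .of_projective hY))

end UnitaryMod

end UnitaryModules

/-! ### Flatness of `P / J P` -/

section Quotients

open BalancedTensor

variable {S : Type u} [Ring S] {P : Type u} [AddCommGroup P] [Module S P]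

/-- If `J` is a two-sided ideal with local units on the right and `P` is projective, then `P / J P`
is flat. -/
lemma BalancedTensor.IsFlat.quotient [Module.Projective S P] (J : Submodule S S)
    (hJr : ∀ j ∈ J, ∀ s, j * s ∈ J)
    (hJ : ∀ F : Finset S, (∀ j ∈ F, j ∈ J) → ∃ e ∈ J, ∀ j ∈ F, j * e = j)
    (N : Submodule S P) (hN : N = Submodule.span S {x | ∃ j ∈ J, ∃ m, x = j • m}) :
    IsFlat S (P ⧸ N) := by
  classical
  obtain ⟨s, hs⟩ := (Module.projective_def' (R := S) (P := P)).1 inferInstance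
  -- The coordinates of `j m` are `j s(m)_x`; this is where `J` must be closed under multiplication
  -- from the right.
  have hsN (y : P) (hy : y ∈ N) (x : P) : s y x ∈ J := by
    rw [hN] at hy
    induction hy using Submodule.span_induction with
    | mem y hy =>
      obtain ⟨j, hj, m, rfl⟩ := hy
      rw [map_smul]
      exact hJr j hj _
    | zero => simp
    | add y z _ _ hy hz => rw [map_add]; exact add_mem hy hz
    | smul t y _ hy => rw [map_smul]; exact J.smul_mem t hy
  -- The coefficients of an element of `A ⊗ N` are sums of terms `a j` with `j` in `J`, so a right
  -- unit for the finitely many `j` involved fixes them.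
  have hcoeff {A : Type u} [AddCommGroup A] [Module Sᵐᵒᵖ A] (z : BalancedTensor S A N) (x : P) :
      ∃ F : Finset S, (∀ j ∈ F, j ∈ J) ∧ ∀ e, (∀ j ∈ F, j * e = j) → MulOpposite.op e •
        coeffs A s (BalancedTensor.map S A N.subtype z) x =
          coeffs A s (BalancedTensor.map S A N.subtype z) x := by
    induction z using induction with
    | zero => exact ⟨∅, by simp⟩
    | tmul a y =>
      refine ⟨{s y x}, by simpa using hsN y y.2 x, fun e he => ?_⟩
      rw [map_tmul, coeffs_tmul, smul_smul, ← MulOpposite.op_mul]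
      exact congrArg (fun t => MulOpposite.op t • a) (he _ (Finset.mem_singleton_self _))
    | add y z hy hz =>
      obtain ⟨F, hF, h⟩ := hy
      obtain ⟨F', hF', h'⟩ := hz
      refine ⟨F ∪ F', fun j hj => (Finset.mem_union.1 hj).elim (hF j) (hF' j), fun e he => ?_⟩
      rw [map_add, map_add, Finsupp.add_apply, smul_add, h e fun j hj => he j (by simp [hj]),
        h' e fun j hj => he j (by simp [hj])]
  intro A A' _ _ _ _ p hp
  rw [injective_iff_map_eq_zero]
  intro z hz
  obtain ⟨z, rfl⟩ := map_surjective S A N.mkQ_surjective z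
  rw [mapLeft_map] at hz
  have hex : Function.Exact N.subtype N.mkQ := by
    rw [LinearMap.exact_iff]; simp
  obtain ⟨w, hw⟩ := (map_exact S A' hex N.mkQ_surjective _).1 hz
  choose F hF h using hcoeff w
  obtain ⟨e, heJ, he⟩ := hJ ((coeffs A s z).support.biUnion F) (by
    intro j hj
    obtain ⟨x, -, hx⟩ := Finset.mem_biUnion.1 hj
    exact hF x j hx)
  -- The coefficients of `z` become fixed by `e` after applying `p`, because there they are
  -- coefficients of the image of `w`. Injectivity of `p` brings this back to `A`; afterwards `a ⊗ x
  -- = a e ⊗ x = a ⊗ e x`, and `e x` lies in `N`.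
  have hfix (x : P) (hx : x ∈ (coeffs A s z).support) :
      MulOpposite.op e • coeffs A s z x = coeffs A s z x := by
    apply hp
    rw [map_smul, ← coeffs_mapLeft, ← hw]
    exact h x e fun j hj => he j (Finset.mem_biUnion.2 ⟨x, hx, hj⟩)
  rw [← sum_coeffs s hs z, map_finsuppSum]
  refine Finset.sum_eq_zero fun x hx => ?_
  change BalancedTensor.map S A N.mkQ (tmul S (coeffs A s z x) x) = 0
  rw [← hfix x hx, smul_tmul, map_tmul, Submodule.mkQ_apply,
    (Submodule.Quotient.mk_eq_zero N).2, tmul_zero]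
  rw [hN]
  exact Submodule.subset_span ⟨e, heJ, x, rfl⟩

end Quotients

/-! ### Semilinear maps over unitizations -/

namespace Unitized

variable {R R' : Type u} [NonUnitalRing R] [NonUnitalRing R'] (φ : R →ₙ+* R')

/-- Semilinearity along a homomorphism of unitizations can be checked on the given rings. -/
lemma map_smul_of_inr {M M' : Type*} [AddCommGroup M] [Module (Unitized R) M] [AddCommGroup M']
    [Module (Unitized R') M'] (q : M →+ M') (h : ∀ r m, q (inr r • m) = inr (φ r) • q m)
    (s : Unitized R) (m : M) : q (s • m) = map φ s • q m := by
  obtain ⟨n, r, rfl⟩ := exists_eq s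
  rw [map_add, map_intCast, map_inr, add_smul, add_smul, map_add, h, Int.cast_smul_eq_zsmul,
    Int.cast_smul_eq_zsmul, map_zsmul]

/-- The analogue of `map_smul_of_inr` for right modules. -/
lemma map_op_smul_of_inr {A A' : Type*} [AddCommGroup A] [Module (Unitized R)ᵐᵒᵖ A]
    [AddCommGroup A'] [Module (Unitized R')ᵐᵒᵖ A'] (p : A →+ A')
    (h : ∀ r a, p (MulOpposite.op (inr r) • a) = MulOpposite.op (inr (φ r)) • p a)
    (s : Unitized R) (a : A) :
    p (MulOpposite.op s • a) = MulOpposite.op (map φ s) • p a := by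
  obtain ⟨n, r, rfl⟩ := exists_eq s
  rw [map_add, map_intCast, map_inr, MulOpposite.op_add, MulOpposite.op_add, add_smul, add_smul,
    map_add, h, MulOpposite.op_intCast, MulOpposite.op_intCast, Int.cast_smul_eq_zsmul,
    Int.cast_smul_eq_zsmul, map_zsmul]

end Unitized

/-! ### Unitary modules over an ideal with local units -/

section Ideal

open Unitized BalancedTensor

variable {I R : Type u} [NonUnitalRing I] [NonUnitalRing R] [HasLocalUnits I]
  (φ : I →ₙ+* R) (hφ : Function.Injective φ) (hl : ∀ r i, ∃ j, φ j = r * φ i)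

include hl in
omit [HasLocalUnits I] in
lemma exists_mul_inr (s : Unitized R) (i : I) : ∃ j, inr (φ j) = s * inr (φ i) := by
  obtain ⟨n, r, rfl⟩ := exists_eq s
  obtain ⟨j, hj⟩ := hl r i
  exact ⟨n • i + j, by simp [add_mul, hj]⟩

include hl in
/-- Tensor products over a ring and over a left ideal with local units agree. -/
lemma BalancedTensor.map₂_bijective_of_ideal {A B N : Type u} [AddCommGroup A]
    [Module (Unitized R)ᵐᵒᵖ A] [AddCommGroup B] [Module (Unitized I)ᵐᵒᵖ B] [AddCommGroup N]
    [Module (Unitized I) N] [Module (Unitized R) N]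
    (hN : ∀ (i : I) (n : N), (inr i : Unitized I) • n = (inr (φ i) : Unitized R) • n)
    (hu : ∀ n : N, ∃ e : I, (inr e : Unitized I) • n = n)
    (p : B →+ A) (hpi : Function.Injective p)
    (hp : ∀ s b, p (MulOpposite.op s • b) = MulOpposite.op (Unitized.map φ s) • p b)
    (hp' : ∀ (i : I) (a : A), ∃ b, p b = MulOpposite.op (inr (φ i) : Unitized R) • a)
    (hq : ∀ s n, AddMonoidHom.id N (s • n) = Unitized.map φ s • AddMonoidHom.id N n) :
    Function.Bijective (map₂ (Unitized.map φ) p (AddMonoidHom.id N) hp hq) := by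
  classical
  choose e he using hu
  choose b hb using hp'
  have hpr (i : I) (c : B) : p (MulOpposite.op (inr i) • c) =
      MulOpposite.op (inr (φ i) : Unitized R) • p c := by
    rw [hp, Unitized.map_inr]
  -- The inverse will send `a ⊗ n` to `(a d) ⊗ n` for any `d` in the ideal with `d n = n`, where `a
  -- d` is read in `B`. Two choices of `d` are compared through a common local unit `f`, by moving
  -- `d` across `(a f) ⊗ d n`.
  have key (n : N) (d d' k : I) (hd : (inr d : Unitized I) • n = n)
      (hd' : (inr d' : Unitized I) • n = n) (a : A) (c c' : B)
      (hc : p c = MulOpposite.op (inr (φ d) : Unitized R) • a)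
      (hc' : p c' = MulOpposite.op (inr (φ d') : Unitized R) • a) :
      tmul (Unitized I) c n = tmul (Unitized I) c' n := by
    obtain ⟨f, -, hf⟩ := HasLocalUnits.exists_unit {d, d'}
    have aux (d : I) (hd : (inr d : Unitized I) • n = n) (c : B)
        (hc : p c = MulOpposite.op (inr (φ d) : Unitized R) • a) (hfd : f * d = d) :
        tmul (Unitized I) c n = tmul (Unitized I) (b f a) n := by
      conv_rhs => rw [← hd, ← smul_tmul]
      congr 1
      apply hpi
      rw [hc, hpr, hb, smul_smul, ← MulOpposite.op_mul, ← map_mul, ← map_mul, hfd]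
    rw [aux d hd c hc (hf d (by simp)).1, aux d' hd' c' hc' (hf d' (by simp)).1]
  let ψ : BalancedTensor (Unitized R) A N →+ BalancedTensor (Unitized I) B N :=
    lift (fun a n => tmul (Unitized I) (b (e n) a) n)
      (fun a a' n => by
        rw [← add_tmul]
        congr 1
        apply hpi
        rw [hb, map_add, hb, hb, smul_add])
      (fun a n n' => by
        -- The chosen units of `n`, `n'` and `n + n'` are unrelated; all three are replaced by one
        -- `f`.
        obtain ⟨f, -, hf⟩ := HasLocalUnits.exists_unit {e n, e n'}
        have hfn (n : N) (h : f * e n = e n) : (inr f : Unitized I) • n = n := by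
          conv_lhs => rw [← he n]
          rw [smul_smul, ← map_mul, h, he]
        have h1 := hfn n (hf _ (by simp)).1
        have h2 := hfn n' (hf _ (by simp)).1
        rw [key (n + n') _ f 0 (he _) (by rw [smul_add, h1, h2]) a _ (b f a) (hb _ _) (hb _ _),
          key n _ f 0 (he _) h1 a _ (b f a) (hb _ _) (hb _ _),
          key n' _ f 0 (he _) h2 a _ (b f a) (hb _ _) (hb _ _), tmul_add])
      (fun a s n => by
        obtain ⟨i, hi⟩ := exists_mul_inr φ hl s (e n)
        have hs : s • n = (inr i : Unitized I) • n := by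
          conv_lhs => rw [← he n]
          rw [hN, smul_smul, ← hi, hN]
        obtain ⟨f, -, hf⟩ := HasLocalUnits.exists_unit {i}
        have hfi : f * i = i := (hf i (by simp)).1
        rw [key (s • n) _ f 0 (he _) (by rw [hs, smul_smul, ← map_mul, hfi]) a _ (b f a)
          (hb _ _) (hb _ _), hs, ← smul_tmul]
        congr 1
        apply hpi
        rw [hb, hpr, hb, smul_smul, smul_smul, ← MulOpposite.op_mul, ← MulOpposite.op_mul, ← hi,
          ← map_mul, ← map_mul, hfi])
  refine ⟨?_, ?_⟩
  · have h : ψ.comp (map₂ (Unitized.map φ) p (AddMonoidHom.id N) hp hq) = AddMonoidHom.id _ := by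
      refine hom_ext fun c n => ?_
      change tmul (Unitized I) (b (e n) (p c)) n = tmul (Unitized I) c n
      conv_rhs => rw [← he n, ← smul_tmul]
      congr 1
      apply hpi
      rw [hb, hpr]
    exact Function.LeftInverse.injective (g := ψ) (DFunLike.congr_fun h)
  · intro x
    induction x using induction with
    | zero => exact ⟨0, map_zero _⟩
    | tmul a n =>
      refine ⟨tmul (Unitized I) (b (e n) a) n, ?_⟩
      rw [map₂_tmul, hb, smul_tmul, AddMonoidHom.id_apply, ← hN, he]
    | add x y hx hy =>
      obtain ⟨x, rfl⟩ := hx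
      obtain ⟨y, rfl⟩ := hy
      exact ⟨x + y, map_add _ _ _⟩

/-- The action of `r` on an element `n` of a unitary module over a left ideal `I` of `R`:
it is the action of `r e` for any `e` in `I` with `e n = n`. -/
noncomputable def idealAct {N : Type u} [AddCommGroup N] [Module (Unitized I) N]
    (hu : ∀ n : N, ∃ e : I, (inr e : Unitized I) • n = n) (r : R) (n : N) : N :=
  (inr (hl r (hu n).choose).choose : Unitized I) • n

section

variable {N : Type u} [AddCommGroup N] [Module (Unitized I) N]
  (hu : ∀ n : N, ∃ e : I, (inr e : Unitized I) • n = n)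

include hφ in
-- Independence of the choice of `e`: with `f e = e` and `k = r f`, the identity `r e = (r f) e`
-- gives `j n = k e n = k n`, and `f` can serve two choices at once.
lemma idealAct_eq (r : R) (n : N) (e j : I) (he : (inr e : Unitized I) • n = n)
    (hj : φ j = r * φ e) : idealAct φ hl hu r n = (inr j : Unitized I) • n := by
  classical
  obtain ⟨f, -, hf⟩ := HasLocalUnits.exists_unit {(hu n).choose, e}
  obtain ⟨k, hk⟩ := hl r f
  have aux (e j : I) (he : (inr e : Unitized I) • n = n) (hj : φ j = r * φ e) (hfe : f * e = e) :
      (inr j : Unitized I) • n = (inr k : Unitized I) • n := by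
    conv_rhs => rw [← he]
    rw [smul_smul, ← map_mul]
    congr 2
    apply hφ
    rw [map_mul, hk, hj, mul_assoc, ← map_mul, hfe]
  rw [aux e j he hj (hf e (by simp)).1]
  exact aux _ _ (hu n).choose_spec (hl r _).choose_spec (hf _ (by simp)).1

/-- The action of a ring `R` on a unitary module over a left ideal of `R`. -/
noncomputable def idealActHom : R →ₙ+* AddMonoid.End N where
  toFun r := AddMonoidHom.mk' (idealAct φ hl hu r) fun n n' => by
    classical
    obtain ⟨e, he⟩ := hu n
    obtain ⟨e', he'⟩ := hu n'
    obtain ⟨f, -, hf⟩ := HasLocalUnits.exists_unit {e, e'}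
    have h1 : (inr f : Unitized I) • n = n := by
      conv_lhs => rw [← he]
      rw [smul_smul, ← map_mul, (hf e (by simp)).1, he]
    have h2 : (inr f : Unitized I) • n' = n' := by
      conv_lhs => rw [← he']
      rw [smul_smul, ← map_mul, (hf e' (by simp)).1, he']
    obtain ⟨j, hj⟩ := hl r f
    rw [idealAct_eq φ hφ hl hu r n f j h1 hj, idealAct_eq φ hφ hl hu r n' f j h2 hj,
      idealAct_eq φ hφ hl hu r (n + n') f j (by rw [smul_add, h1, h2]) hj, smul_add]
  map_zero' := AddMonoidHom.ext fun n => by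
    obtain ⟨e, he⟩ := hu n
    change idealAct φ hl hu 0 n = 0
    rw [idealAct_eq φ hφ hl hu 0 n e 0 he (by simp), map_zero, zero_smul]
  map_add' r r' := AddMonoidHom.ext fun n => by
    obtain ⟨e, he⟩ := hu n
    obtain ⟨j, hj⟩ := hl r e
    obtain ⟨j', hj'⟩ := hl r' e
    change idealAct φ hl hu (r + r') n = idealAct φ hl hu r n + idealAct φ hl hu r' n
    rw [idealAct_eq φ hφ hl hu (r + r') n e (j + j') he (by rw [map_add, hj, hj', add_mul]),
      idealAct_eq φ hφ hl hu r n e j he hj, idealAct_eq φ hφ hl hu r' n e j' he hj', map_add,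
      add_smul]
  map_mul' r r' := AddMonoidHom.ext fun n => by
    obtain ⟨e, he⟩ := hu n
    obtain ⟨j', hj'⟩ := hl r' e
    -- A left unit `f` of `j' = r' e` fixes `r' n = j' n`, so it may be used to compute the outer
    -- action; then `r r' e = (r f)(r' e)`.
    obtain ⟨f, -, hf⟩ := HasLocalUnits.exists_unit {j'}
    have hfj := (hf j' (by simp)).1
    obtain ⟨j, hj⟩ := hl r f
    change idealAct φ hl hu (r * r') n = idealAct φ hl hu r (idealAct φ hl hu r' n)
    rw [idealAct_eq φ hφ hl hu r' n e j' he hj',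
      idealAct_eq φ hφ hl hu r _ f j (by rw [smul_smul, ← map_mul, hfj]) hj,
      idealAct_eq φ hφ hl hu (r * r') n e (j * j') he
        (by rw [map_mul, hj, mul_assoc, ← map_mul, hfj, hj', mul_assoc]), map_mul, mul_smul]

end

variable [HasLocalUnits R]

lemma IsUnitary.exists_smul_eq {M : ModuleCat.{u} (Unitized R)} (h : IsUnitary R M) (m : M) :
    ∃ e : R, (inr e : Unitized R) • m = m :=
  ((isUnitary_iff M).1 h m).imp fun _ h => h.2

/-- A unitary module over a left ideal of `R`, as a module over `R`. -/
noncomputable abbrev idealExtendModule (N : UnitaryMod I) : Module (Unitized R) N.obj :=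
  Module.compHom _ (lift (idealActHom φ hφ hl N.property.exists_smul_eq))

omit [HasLocalUnits R] in
lemma idealExtendModule_inr_smul (N : UnitaryMod I) (i : I) (n : N.obj) :
    let _ := idealExtendModule φ hφ hl N
    (inr i : Unitized I) • n = (inr (φ i) : Unitized R) • n := by
  intro _
  change _ = lift (idealActHom φ hφ hl N.property.exists_smul_eq) (inr (φ i)) n
  rw [lift_inr]
  obtain ⟨e, he⟩ := N.property.exists_smul_eq n
  refine Eq.trans ?_
    (idealAct_eq φ hφ hl N.property.exists_smul_eq (φ i) n e (i * e) he (map_mul φ i e)).symm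
  rw [map_mul, mul_smul, he]

omit [HasLocalUnits R] in
/-- Additive maps from a unitary module over a left ideal that commute with the action of the
ideal commute with the action of the ring. -/
lemma idealExtendModule_map_smul (N : UnitaryMod I) {M : Type*} [AddCommGroup M]
    [Module (Unitized R) M] (g : N.obj →+ M)
    (hg : ∀ (i : I) (n : N.obj), g ((inr i : Unitized I) • n) = (inr (φ i) : Unitized R) • g n)
    (s : Unitized R) (n : N.obj) :
    let _ := idealExtendModule φ hφ hl N
    g (s • n) = s • g n := by
  intro _
  obtain ⟨e, he⟩ := N.property.exists_smul_eq n
  obtain ⟨j, hj⟩ := exists_mul_inr φ hl s e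
  have h : s • n = (inr j : Unitized I) • n := by
    conv_lhs => rw [← he]
    rw [idealExtendModule_inr_smul φ hφ hl, smul_smul, ← hj, idealExtendModule_inr_smul φ hφ hl]
  rw [h, hg, hj, mul_smul, ← hg, he]

omit [HasLocalUnits R] in
lemma idealExtendModule_smul (N : UnitaryMod I) (s : Unitized I) (n : N.obj) :
    let _ := idealExtendModule φ hφ hl N
    s • n = Unitized.map φ s • n :=
  let _ := idealExtendModule φ hφ hl N
  map_smul_of_inr φ (AddMonoidHom.id N.obj) (idealExtendModule_inr_smul φ hφ hl N) s n

/-- The functor from unitary modules over a left ideal of `R` to unitary modules over `R`. -/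
noncomputable def idealExtend : UnitaryMod I ⥤ UnitaryMod R where
  obj N := ⟨letI := idealExtendModule φ hφ hl N; ModuleCat.of (Unitized R) N.obj, by
    let _ := idealExtendModule φ hφ hl N
    rw [isUnitary_iff]
    intro n
    obtain ⟨e, he, hn⟩ := (isUnitary_iff N.obj).1 N.property n
    refine ⟨φ e, by rw [← map_mul, he], ?_⟩
    exact (idealExtendModule_inr_smul φ hφ hl N e n).symm.trans hn⟩
  map {N N'} f := (IsUnitary R).homMk <|
    letI := idealExtendModule φ hφ hl N
    letI := idealExtendModule φ hφ hl N'
    ModuleCat.ofHom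
      { f.hom.hom.toAddMonoidHom with
        map_smul' := idealExtendModule_map_smul φ hφ hl N f.hom.hom.toAddMonoidHom fun i n =>
          (f.hom.hom.map_smul _ _).trans (idealExtendModule_inr_smul φ hφ hl N' i _) }

instance : (idealExtend φ hφ hl).Additive where
  map_add := rfl

/-- Underlying groups and maps are unchanged, and exactness is tested on them. -/
lemma idealExtend_shortExact (S : ShortComplex (UnitaryMod I)) (hS : S.ShortExact) :
    (S.map (idealExtend φ hφ hl)).ShortExact :=
  (UnitaryMod.shortExact_iff _).2 ((UnitaryMod.shortExact_iff S).1 hS)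

end Ideal

/-! ### Functions on the unit space of a reduction -/

namespace AmpleGroupoid

variable {G : AmpleGroupoid.{u}}
variable {X : Set G.Obj} {hX : IsLocallyClosed X} {hinv : G.IsInvariant X}

/-- The inclusion of the unit space of a reduction. -/
def inclObj (x : (G.reduction X hX hinv).Obj) : G.Obj := Subtype.val (p := (· ∈ X)) x

lemma inclObj_injective : Function.Injective (inclObj (hX := hX) (hinv := hinv)) :=
  Subtype.val_injective

lemma range_inclObj : Set.range (inclObj (hX := hX) (hinv := hinv)) = X :=
  Subtype.range_coe

lemma isEmbedding_inclObj : Topology.IsEmbedding (inclObj (hX := hX) (hinv := hinv)) :=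
  .subtypeVal

/-- The action of `G` at a unit of a reduction is the action of the reduction. -/
lemma act_inclObj (h : G.Obj → ℤ) (f : G.Arr → ℤ) (x : (G.reduction X hX hinv).Obj) :
    G.act h f (inclObj x) = (G.reduction X hX hinv).act (h ∘ inclObj) (f ∘ incl) x := by
  symm
  refine finsum_eq_of_bijective (fun a => ⟨incl a.1, congrArg Subtype.val a.2⟩) ⟨?_, ?_⟩ ?_
  · intro a b hab
    have h1 : incl a.1 = incl b.1 := Subtype.mk.inj hab
    exact Subtype.ext (incl_injective h1)
  · rintro ⟨a, ha⟩
    have haX : G.src a ∈ X := by rw [ha]; exact x.2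
    exact ⟨⟨⟨a, (hinv.mem_iff a).2 haX, haX⟩, Subtype.ext ha⟩, rfl⟩
  · intro a
    rfl

lemma Alg.ext0_injective (ho : IsOpen X) :
    Function.Injective (ext0 (hX := hX) (hinv := hinv) ho) := by
  intro f h hfh
  refine Alg.ext ?_
  rw [← extend_incl (val f), ← extend_incl (val h)]
  exact congrArg (fun k => val k ∘ incl) hfh

/-- No arrow with source outside `X` lies in the reduction. Hence multiplication by an element of
its algebra moves all of `ℤG⁰` into the functions vanishing off `X`. -/
lemma act_extend_of_notMem (h : G.Obj → ℤ) (f : (G.reduction X hX hinv).Arr → ℤ) {x : G.Obj}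
    (hx : x ∉ X) : G.act h (extend f) x = 0 := by
  refine finsum_eq_zero_of_forall_eq_zero fun g => ?_
  rw [extend_apply_of_notMem _ (by rwa [g.2]), mul_zero]

namespace ObjAlg

/-- Restriction of functions on the unit space to a closed invariant subset. -/
noncomputable def res (hc : IsClosed X) : G.ObjAlg →+ (G.reduction X hX hinv).ObjAlg where
  toFun a := ⟨val a ∘ inclObj, by
    induction a using ObjAlg.induction with
    | ind W hWo hWc =>
      have hcl : Topology.IsClosedEmbedding (inclObj (hX := hX) (hinv := hinv)) :=
        ⟨isEmbedding_inclObj, by rw [range_inclObj]; exact hc⟩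
      exact (ind (G := G.reduction X hX hinv) (inclObj ⁻¹' W) (hWo.preimage hcl.continuous)
        (hcl.isCompact_preimage hWc)).2
    | zero => rw [map_zero]; exact zero_mem _
    | add f h hf hh => rw [map_add]; exact add_mem hf hh
    | neg f hf => rw [map_neg]; exact neg_mem hf⟩
  map_zero' := rfl
  map_add' _ _ := rfl

lemma val_res (hc : IsClosed X) (a : G.ObjAlg) :
    val (res (hX := hX) (hinv := hinv) hc a) = val a ∘ inclObj := rfl

lemma res_actHom (hc : IsClosed X) (f : G.Alg) (a : G.ObjAlg) :
    res (hX := hX) (hinv := hinv) hc (actHom f a) = actHom (Alg.res hc f) (res hc a) :=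
  ObjAlg.ext (funext fun x => act_inclObj _ _ x)

lemma res_surjective (hc : IsClosed X) :
    Function.Surjective (res (hX := hX) (hinv := hinv) hc) := by
  intro a
  induction a using ObjAlg.induction with
  | ind W hWo hWc =>
    obtain ⟨O, hO, hOW⟩ := isEmbedding_inclObj.isInducing.isOpen_iff.1 hWo
    -- `W` is the trace on `X` of an open set `O`, which need not be compact. A compact open set
    -- between the image of `W` and `O` has the same trace.
    obtain ⟨V, hVo, hVc, hWV, hVO⟩ := exists_compactOpen_of_isCompact
      (hWc.image isEmbedding_inclObj.continuous) hO (by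
        rw [← hOW]; exact Set.image_preimage_subset _ _)
    refine ⟨ind V hVo hVc, ObjAlg.ext ?_⟩
    have : inclObj ⁻¹' V = W :=
      (hOW ▸ Set.preimage_mono hVO).antisymm (Set.image_subset_iff.1 hWV)
    rw [val_res, val_ind, val_ind, ← this]
    rfl
  | zero => exact ⟨0, map_zero _⟩
  | add f h hf hh =>
    obtain ⟨f, rfl⟩ := hf
    obtain ⟨h, rfl⟩ := hh
    exact ⟨f + h, map_add _ _ _⟩
  | neg f hf =>
    obtain ⟨f, rfl⟩ := hf
    exact ⟨-f, map_neg _ _⟩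

/-- Extension by zero of functions on the unit space from an open invariant subset. -/
noncomputable def ext0 (ho : IsOpen X) : (G.reduction X hX hinv).ObjAlg →+ G.ObjAlg where
  toFun a := ⟨Function.extend inclObj (val a) 0, by
    have hadd (f h : (G.reduction X hX hinv).Obj → ℤ) :
        Function.extend inclObj (f + h) 0 = Function.extend inclObj f 0 +
          Function.extend inclObj h 0 := by
      rw [← Function.extend_add, add_zero]
    have hneg (f : (G.reduction X hX hinv).Obj → ℤ) :
        Function.extend inclObj (-f) 0 = -Function.extend inclObj f 0 := by
      rw [← Function.extend_neg, neg_zero]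
    induction a using ObjAlg.induction with
    | ind W hWo hWc =>
      have hop : Topology.IsOpenEmbedding (inclObj (hX := hX) (hinv := hinv)) :=
        ⟨isEmbedding_inclObj, by rw [range_inclObj]; exact ho⟩
      have h : Function.extend inclObj (W.indicator (1 : (G.reduction X hX hinv).Obj → ℤ)) 0 =
          (inclObj '' W).indicator 1 := by
        classical
        ext x
        by_cases hx : x ∈ X
        · obtain ⟨x, rfl⟩ : x ∈ Set.range (inclObj (hX := hX) (hinv := hinv)) := by
            rwa [range_inclObj]
          rw [inclObj_injective.extend_apply]
          simp [Set.indicator_apply, inclObj_injective.mem_set_image]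
        · rw [Function.extend_apply' _ _ _ fun ⟨y, hy⟩ => hx (hy ▸ y.2),
            Set.indicator_of_notMem (s := inclObj '' W) fun ⟨y, _, hy⟩ => hx (hy ▸ y.2)]
          rfl
      rw [val_ind, h]
      exact (ind _ (hop.isOpenMap W hWo) (hWc.image hop.continuous)).2
    | zero => rw [map_zero, Function.extend_zero]; exact zero_mem _
    | add f h hf hh => rw [map_add, hadd]; exact add_mem hf hh
    | neg f hf => rw [map_neg, hneg]; exact neg_mem hf⟩
  map_zero' := ObjAlg.ext (by
    change Function.extend inclObj (val 0) 0 = 0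
    rw [map_zero, Function.extend_zero])
  map_add' a b := ObjAlg.ext (by
    change Function.extend inclObj (val (a + b)) 0 = Function.extend inclObj (val a) 0 +
      Function.extend inclObj (val b) 0
    rw [map_add, ← Function.extend_add, add_zero])

lemma val_ext0_inclObj (ho : IsOpen X) (a : (G.reduction X hX hinv).ObjAlg) (x) :
    val (ext0 ho a) (inclObj x) = val a x :=
  inclObj_injective.extend_apply _ _ x

lemma val_ext0_of_notMem (ho : IsOpen X) (a : (G.reduction X hX hinv).ObjAlg) {x : G.Obj}
    (hx : x ∉ X) : val (ext0 ho a) x = 0 :=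
  Function.extend_apply' _ _ _ fun ⟨y, hy⟩ => hx (hy ▸ y.2)

lemma ext0_injective (ho : IsOpen X) :
    Function.Injective (ext0 (hX := hX) (hinv := hinv) ho) := by
  intro a b hab
  refine ObjAlg.ext (funext fun x => ?_)
  rw [← val_ext0_inclObj ho, hab, val_ext0_inclObj ho]

lemma eq_ext0 (ho : IsOpen X) {a : (G.reduction X hX hinv).ObjAlg} {b : G.ObjAlg}
    (h1 : val b ∘ inclObj = val a) (h2 : ∀ x ∉ X, val b x = 0) : b = ext0 ho a := by
  refine ObjAlg.ext (funext fun x => ?_)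
  by_cases hx : x ∈ X
  · obtain ⟨x, rfl⟩ : x ∈ Set.range (inclObj (hX := hX) (hinv := hinv)) := by
      rwa [range_inclObj]
    rw [val_ext0_inclObj, ← h1, Function.comp_apply]
  · rw [h2 x hx, val_ext0_of_notMem ho a hx]

lemma ext0_actHom (ho : IsOpen X) (f : (G.reduction X hX hinv).Alg)
    (a : (G.reduction X hX hinv).ObjAlg) :
    ext0 ho (actHom f a) = actHom (Alg.ext0 ho f) (ext0 ho a) := by
  refine (eq_ext0 ho (funext fun x => ?_) fun x hx => ?_).symm
  · have h : val (ext0 ho a) ∘ inclObj = val a := funext (val_ext0_inclObj ho a)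
    rw [Function.comp_apply, val_actHom, act_inclObj, Alg.val_ext0, extend_incl, h]
    rfl
  · rw [val_actHom, Alg.val_ext0, act_extend_of_notMem _ _ hx]

/-- The characteristic function of a set of units is supported on identity arrows, so it acts by
pointwise multiplication. -/
lemma val_actHom_idem (W : Set G.Obj) (hWo : IsOpen W) (hWc : IsCompact W) (a : G.ObjAlg) :
    val (actHom (Alg.idem W hWo hWc) a) = W.indicator (val a) := by
  classical
  induction a using ObjAlg.induction with
  | ind V hVo hVc =>
    have : G.src '' (G.unit '' W ∩ G.rng ⁻¹' V) = W ∩ V := by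
      ext x
      constructor
      · rintro ⟨_, ⟨⟨x, hx, rfl⟩, hxV⟩, rfl⟩
        rw [Set.mem_preimage, G.rng_unit] at hxV
        rw [G.src_unit]
        exact ⟨hx, hxV⟩
      · rintro ⟨hx, hxV⟩
        exact ⟨_, ⟨⟨x, hx, rfl⟩, by rwa [Set.mem_preimage, G.rng_unit]⟩, G.src_unit x⟩
    simp only [Alg.idem, actHom_ind, val_ind, this, ← Set.indicator_indicator]
  | zero => rw [map_zero, map_zero, Set.indicator_zero']
  | add f h hf hh => rw [map_add, map_add, hf, hh, map_add, ← Set.indicator_add']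
  | neg f hf => rw [map_neg, map_neg, hf, map_neg, Set.indicator_neg']

/-- The support of an element of `ℤG⁰` is compact and open. -/
lemma isOpen_isCompact_support (a : G.ObjAlg) :
    IsOpen (Function.support (val a)) ∧ IsCompact (Function.support (val a)) := by
  have h : Continuous (val a) ∧ ∃ K : Set G.Obj, IsCompact K ∧ ∀ x ∉ K, val a x = 0 := by
    classical
    induction a using ObjAlg.induction with
    | ind W hWo hWc =>
      refine ⟨?_, W, hWc, fun x hx => Set.indicator_of_notMem hx _⟩
      exact continuous_const.indicator fun x hx => by
        rw [IsClopen.frontier_eq ⟨hWc.isClosed, hWo⟩] at hx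
        exact hx.elim
    | zero => exact ⟨continuous_const, ∅, isCompact_empty, fun _ _ => rfl⟩
    | add f h hf hh =>
      obtain ⟨hf, K, hK, hfK⟩ := hf
      obtain ⟨hh, L, hL, hhL⟩ := hh
      refine ⟨by rw [map_add]; exact hf.add hh, K ∪ L, hK.union hL, fun x hx => ?_⟩
      rw [map_add, Pi.add_apply, hfK x fun h => hx (.inl h), hhL x fun h => hx (.inr h), add_zero]
    | neg f hf =>
      obtain ⟨hf, K, hK, hfK⟩ := hf
      refine ⟨by rw [map_neg]; exact hf.neg, K, hK, fun x hx => ?_⟩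
      rw [map_neg, Pi.neg_apply, hfK x hx, neg_zero]
  obtain ⟨hc, K, hK, hKa⟩ := h
  have hcl : IsClopen (Function.support (val a)) :=
    (isClopen_discrete ({0}ᶜ : Set ℤ)).preimage hc
  exact ⟨hcl.isOpen, hK.of_isClosed_subset hcl.isClosed fun x hx => by
    by_contra h
    exact hx (hKa x h)⟩

/-- An element of `ℤG⁰` that vanishes off an open invariant set comes from this set. -/
lemma exists_ext0 (ho : IsOpen X) (a : G.ObjAlg) (ha : ∀ x ∉ X, val a x = 0) :
    ∃ b : (G.reduction X hX hinv).ObjAlg, ext0 ho b = a := by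
  have step (W : Set G.Obj) (hWo : IsOpen W) (hWc : IsCompact W) (hW : W ⊆ X) (a : G.ObjAlg) :
      ∃ b : (G.reduction X hX hinv).ObjAlg, ext0 ho b = actHom (Alg.idem W hWo hWc) a := by
    induction a using ObjAlg.induction with
    | ind V hVo hVc =>
      have hop : Topology.IsOpenEmbedding (inclObj (hX := hX) (hinv := hinv)) :=
        ⟨isEmbedding_inclObj, by rw [range_inclObj]; exact ho⟩
      refine ⟨ind (inclObj ⁻¹' (W ∩ V)) ((hWo.inter hVo).preimage hop.continuous)
        (hop.isInducing.isCompact_preimage' (hWc.inter hVc) (by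
          rw [range_inclObj]; exact fun x hx => hW hx.1)), (eq_ext0 ho ?_ ?_).symm⟩
      · rw [val_actHom_idem, val_ind, val_ind, Set.indicator_indicator]
        rfl
      · intro x hx
        rw [val_actHom_idem, Set.indicator_of_notMem fun h => hx (hW h)]
    | zero => exact ⟨0, by rw [map_zero, map_zero]⟩
    | add f h hf hh =>
      obtain ⟨f', hf⟩ := hf
      obtain ⟨h', hh⟩ := hh
      exact ⟨f' + h', by rw [map_add, hf, hh, map_add]⟩
    | neg f hf =>
      obtain ⟨f', hf⟩ := hf
      exact ⟨-f', by rw [map_neg, hf, map_neg]⟩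
  -- The support of `a` is compact open and contained in `X`, and `a` is fixed by the corresponding
  -- idempotent; so `step` with this set reaches `a` itself.
  obtain ⟨hWo, hWc⟩ := isOpen_isCompact_support a
  obtain ⟨b, hb⟩ := step _ hWo hWc (fun x hx => by_contra fun h => hx (ha x h)) a
  refine ⟨b, hb.trans (ObjAlg.ext ?_)⟩
  rw [val_actHom_idem, Set.indicator_support]

/-- An element of `ℤG⁰` that vanishes off an open invariant set is fixed by an element of the
algebra of the reduction to this set. -/
lemma exists_actHom_ext0_eq (ho : IsOpen X) (a : G.ObjAlg) (ha : ∀ x ∉ X, val a x = 0) :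
    ∃ f : (G.reduction X hX hinv).Alg, actHom (Alg.ext0 ho f) a = a := by
  obtain ⟨hWo, hWc⟩ := isOpen_isCompact_support a
  obtain ⟨f, hf⟩ := Alg.exists_ext0 (hX := hX) (hinv := hinv) ho (Alg.idem _ hWo hWc) (by
    intro g hg
    rw [Alg.idem, Alg.val_bis, Set.indicator_of_notMem]
    rintro ⟨x, hx, rfl⟩
    rw [G.src_unit] at hg
    exact hx (ha x hg))
  refine ⟨f, ObjAlg.ext ?_⟩
  rw [hf, val_actHom_idem, Set.indicator_support]

end ObjAlg

end AmpleGroupoid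

section

open Unitized

variable {I R : Type u} [NonUnitalRing I] [NonUnitalRing R] [HasLocalUnits I] [HasLocalUnits R]
  (φ : I →ₙ+* R) (hφ : Function.Injective φ) (hl : ∀ r i, ∃ j, φ j = r * φ i)

/-- The functor `A ⊗ -` on unitary modules over an ideal of `R`, for a right `R`-module `A`. -/
noncomputable def tensorIdealExtendIso {A B : Type u} [AddCommGroup A] [Module (Unitized R)ᵐᵒᵖ A]
    [AddCommGroup B] [Module (Unitized I)ᵐᵒᵖ B] (p : B →+ A) (hpi : Function.Injective p)
    (hp : ∀ s b, p (MulOpposite.op s • b) = MulOpposite.op (Unitized.map φ s) • p b)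
    (hp' : ∀ (i : I) (a : A), ∃ b, p b = MulOpposite.op (inr (φ i) : Unitized R) • a) :
    (IsUnitary I).ι ⋙ tensorFunctor (Unitized I) B ≅
      idealExtend φ hφ hl ⋙ (IsUnitary R).ι ⋙ tensorFunctor (Unitized R) A :=
  NatIso.ofComponents
    (fun N =>
      letI := idealExtendModule φ hφ hl N
      (AddEquiv.ofBijective (BalancedTensor.map₂ (Unitized.map φ) p (AddMonoidHom.id N.obj) hp
        (idealExtendModule_smul φ hφ hl N)) (BalancedTensor.map₂_bijective_of_ideal φ hl
          (idealExtendModule_inr_smul φ hφ hl N) N.property.exists_smul_eq p hpi hp hp'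
          _)).toAddCommGrpIso)
    (fun {N N'} f => by
      let _ := idealExtendModule φ hφ hl N
      let _ := idealExtendModule φ hφ hl N'
      refine AddCommGrpCat.hom_ext ?_
      exact BalancedTensor.hom_ext fun a n => rfl)

end

/-! ### Excision for the open reduction -/

namespace AmpleGroupoid

variable (G : AmpleGroupoid.{u}) {U : Set G.Obj} (hU : IsOpen U) (hinv : G.IsInvariant U)

/-- The image of `ℤG_U^U` is the kernel of restriction to `C`, hence an ideal. -/
lemma exists_extOpen_eq_mul (r : G.Alg) (i : (G.openPart U hU hinv).Alg) :
    ∃ j, G.extOpen U hU hinv j = r * G.extOpen U hU hinv i := by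
  rw [← resClosed_eq_zero_iff, map_mul, (G.resClosed_eq_zero_iff hU hinv _).2 ⟨i, rfl⟩, mul_zero]

lemma exists_extOpen_eq_mul' (i : (G.openPart U hU hinv).Alg) (r : G.Alg) :
    ∃ j, G.extOpen U hU hinv j = G.extOpen U hU hinv i * r := by
  rw [← resClosed_eq_zero_iff, map_mul, (G.resClosed_eq_zero_iff hU hinv _).2 ⟨i, rfl⟩, zero_mul]

/-- The functor from unitary `ℤG_U^U`-modules to unitary `ℤG`-modules. -/
noncomputable abbrev openExtend : UnitaryMod (G.openPart U hU hinv).Alg ⥤ UnitaryMod G.Alg :=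
  idealExtend (G.extOpen U hU hinv) (Alg.ext0_injective hU) (G.exists_extOpen_eq_mul hU hinv)

/-- With `I = ℤG_U^U`, take a projective unitary `ℤG`-module `Q` mapping onto `P`. Since `I P = P`,
already `I Q` maps onto `P`, and this surjection splits over `I` because `P` is projective there.
The section is `ℤG`-linear by `idealExtendModule_map_smul`, so `P` is a retract of `Q`. -/
lemma isFlat_openExtend (P : UnitaryMod (G.openPart U hU hinv).Alg) [Projective P] :
    BalancedTensor.IsFlat (Unitized G.Alg) ((G.openExtend hU hinv).obj P).obj := by
  let φ := G.extOpen U hU hinv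
  have hφ : Function.Injective φ := Alg.ext0_injective hU
  have hl := G.exists_extOpen_eq_mul hU hinv
  let _ := idealExtendModule φ hφ hl P
  let X : UnitaryMod G.Alg := (G.openExtend hU hinv).obj P
  let Q := Projective.over X
  let π : Q.obj →ₗ[Unitized G.Alg] P.obj := (Projective.π X).hom.hom
  have hπ : Function.Surjective π := UnitaryMod.surjective_of_epi (Projective.π X)
  let f : (G.openCoeff hU hinv Q).obj →ₗ[Unitized (G.openPart U hU hinv).Alg] P.obj :=
    { toFun := fun y : G.idealPart hU hinv Q.obj => π y.1
      map_add' := fun y z => map_add π y.1 z.1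
      map_smul' := fun s y => (π.map_smul (Unitized.map φ s) y.1).trans
        (idealExtendModule_smul φ hφ hl P s _).symm }
  let f₀ : ModuleCat.of _ (G.openCoeff hU hinv Q).obj ⟶ ModuleCat.of _ P.obj := ModuleCat.ofHom f
  let f' : G.openCoeff hU hinv Q ⟶ P := (IsUnitary _).homMk f₀
  have hf : Epi f' := by
    refine UnitaryMod.epi_of_surjective _ fun n => ?_
    obtain ⟨e, he⟩ := P.property.exists_smul_eq n
    obtain ⟨y, hy⟩ := hπ n
    -- If `e n = n` and `y` lifts `n`, then `e y` is a lift of `n` inside `I Q`.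
    refine ⟨⟨Unitized.inr (φ e) • y, Submodule.subset_span ⟨e, y, rfl⟩⟩, ?_⟩
    refine (π.map_smul _ _).trans ?_
    rw [hy, ← idealExtendModule_inr_smul φ hφ hl P, he]
  let s : P ⟶ G.openCoeff hU hinv Q := Projective.factorThru (𝟙 P) f'
  have hs : s ≫ f' = 𝟙 P := Projective.factorThru_comp _ _
  let i : P.obj →+ Q.obj :=
    (G.idealPart hU hinv Q.obj).subtype.toAddMonoidHom.comp s.hom.hom.toAddMonoidHom
  let i' : P.obj →ₗ[Unitized G.Alg] Q.obj :=
    { i with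
      map_smul' := idealExtendModule_map_smul φ hφ hl P i fun j n => by
        refine (congrArg (G.idealPart hU hinv Q.obj).subtype
          (s.hom.hom.map_smul (Unitized.inr j) n)).trans ?_
        rw [← Unitized.map_inr]
        rfl }
  have := UnitaryMod.module_projective Q
  exact BalancedTensor.IsFlat.of_projective.of_retract i' π
    (LinearMap.ext fun n => congrArg (fun f : P ⟶ P => f.hom n) hs)

/-- Extending the module `ℤG_U^U · M` over `ℤG_U^U` to a module over `ℤG` gives back the
submodule `ℤG_U^U · M` of `M`. -/
noncomputable def openExtendCoeffIso (M : UnitaryMod G.Alg) :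
    (G.openExtend hU hinv).obj (G.openCoeff hU hinv M) ≅ G.idealMod hU hinv M :=
  letI := idealExtendModule (G.extOpen U hU hinv) (Alg.ext0_injective hU)
    (G.exists_extOpen_eq_mul hU hinv) (G.openCoeff hU hinv M)
  let q : (G.openCoeff hU hinv M).obj →+ G.idealPart hU hinv M.obj :=
    AddMonoidHom.id (G.idealPart hU hinv M.obj)
  have hq (j : (G.openPart U hU hinv).Alg) (n : (G.openCoeff hU hinv M).obj) :
      q (Unitized.inr j • n) = Unitized.inr (G.extOpen U hU hinv j) • q n := by
    rw [← Unitized.map_inr]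
    rfl
  let e : (G.openCoeff hU hinv M).obj ≃ₗ[Unitized G.Alg] G.idealPart hU hinv M.obj :=
    { AddEquiv.refl (G.idealPart hU hinv M.obj) with
      map_smul' := idealExtendModule_map_smul (G.extOpen U hU hinv) _ _ _ q hq }
  (IsUnitary _).isoMk e.toModuleIso

/-- The homology of an open invariant reduction of `G` is homology of `G`. -/
lemma nonempty_homology_openPart_iso (M : UnitaryMod G.Alg) (n : ℕ) :
    Nonempty (((G.openPart U hU hinv).homology n).obj (G.openCoeff hU hinv M) ≅
      (G.homology n).obj (G.idealMod hU hinv M)) := by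
  have hp (s : Unitized (G.openPart U hU hinv).Alg) (b : (G.openPart U hU hinv).ObjAlg) :
      ObjAlg.ext0 hU (MulOpposite.op s • b) =
        MulOpposite.op (Unitized.map (G.extOpen U hU hinv) s) • ObjAlg.ext0 hU b := by
    refine Unitized.map_op_smul_of_inr _ _ (fun r a => ?_) s b
    rw [ObjAlg.op_inr_smul, ObjAlg.op_inr_smul, ObjAlg.ext0_actHom]
  -- Multiplying by the ideal sends `ℤG⁰` into `ℤU`, which is what identifies `ℤG⁰ ⊗_{ℤG} N` with
  -- the tensor product of `ℤU` and `N` over `ℤG_U^U`.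
  have hp' (i : (G.openPart U hU hinv).Alg) (a : G.ObjAlg) :
      ∃ b : (G.openPart U hU hinv).ObjAlg, ObjAlg.ext0 hU b =
        MulOpposite.op (Unitized.inr (G.extOpen U hU hinv i)) • a := by
    refine ObjAlg.exists_ext0 hU _ fun x hx => ?_
    rw [ObjAlg.op_inr_smul, ObjAlg.val_actHom, Alg.val_ext0, act_extend_of_notMem _ _ hx]
  obtain ⟨e⟩ := Functor.nonempty_leftDerived_iso
    ((IsUnitary G.Alg).ι ⋙ tensorFunctor (Unitized G.Alg) G.ObjAlg)
    ((IsUnitary _).ι ⋙ tensorFunctor (Unitized (G.openPart U hU hinv).Alg)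
      (G.openPart U hU hinv).ObjAlg)
    (G.openExtend hU hinv) (idealExtend_shortExact _ _ _)
    (tensorIdealExtendIso _ _ _ (ObjAlg.ext0 hU) (ObjAlg.ext0_injective hU) hp hp')
    (fun P _ n => UnitaryMod.isZero_torFunctor_of_isFlat G.ObjAlg _
      (G.isFlat_openExtend hU hinv P) n) n (G.openCoeff hU hinv M)
  exact ⟨e ≪≫ (G.homology n).mapIso (G.openExtendCoeffIso hU hinv M)⟩

end AmpleGroupoid

/-! ### Unitary modules over a quotient ring -/

section

open Unitized

variable {R R' : Type u} [NonUnitalRing R] [NonUnitalRing R'] [HasLocalUnits R] [HasLocalUnits R']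
  (ρ : R →ₙ+* R') (hρ : Function.Surjective ρ)

include hρ in
omit [HasLocalUnits R] [HasLocalUnits R'] in
lemma Unitized.map_surjective : Function.Surjective (Unitized.map ρ) := by
  intro s
  obtain ⟨n, r, rfl⟩ := exists_eq s
  obtain ⟨r, rfl⟩ := hρ r
  exact ⟨n + inr r, by rw [map_add, map_intCast, Unitized.map_inr]⟩

/-- Unitary modules over a quotient of `R`, regarded as unitary modules over `R`. -/
noncomputable def inflation : UnitaryMod R' ⥤ UnitaryMod R :=
  (IsUnitary R).lift ((IsUnitary R').ι ⋙ ModuleCat.restrictScalars (Unitized.map ρ)) fun N => by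
    rw [IsUnitary, Submodule.eq_top_iff']
    intro n
    obtain ⟨e, he⟩ := N.property.exists_smul_eq n
    obtain ⟨r, rfl⟩ := hρ e
    rw [← Unitized.map_inr] at he
    have := smul_mem_unitaryPart (R := R)
      (M := (ModuleCat.restrictScalars (Unitized.map ρ)).obj N.obj) r n
    exact he ▸ this

instance : (inflation ρ hρ).Additive where
  map_add := rfl

lemma inflation_shortExact (S : ShortComplex (UnitaryMod R')) (hS : S.ShortExact) :
    (S.map (inflation ρ hρ)).ShortExact :=
  (UnitaryMod.shortExact_iff _).2 ((UnitaryMod.shortExact_iff S).1 hS)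

/-- The functor `A ⊗ -` on unitary modules over a quotient of `R`, for a right `R`-module `A`. -/
noncomputable def tensorInflationIso {A B : Type u} [AddCommGroup A] [Module (Unitized R)ᵐᵒᵖ A]
    [AddCommGroup B] [Module (Unitized R')ᵐᵒᵖ B] (p : A →+ B) (hps : Function.Surjective p)
    (hp : ∀ s a, p (MulOpposite.op s • a) = MulOpposite.op (Unitized.map ρ s) • p a)
    (hp' : ∀ a, p a = 0 → ∃ r, ρ r = 0 ∧ MulOpposite.op (inr r : Unitized R) • a = a) :
    inflation ρ hρ ⋙ (IsUnitary R).ι ⋙ tensorFunctor (Unitized R) A ≅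
      (IsUnitary R').ι ⋙ tensorFunctor (Unitized R') B :=
  NatIso.ofComponents
    (fun N =>
      letI : Module (Unitized R) N.obj := Module.compHom _ (Unitized.map ρ)
      (AddEquiv.ofBijective (BalancedTensor.map₂ (M := N.obj) (Unitized.map ρ) p
        (AddMonoidHom.id N.obj) hp (fun _ _ => rfl)) ⟨by
          rw [injective_iff_map_eq_zero]
          intro x hx
          refine (AddSubgroup.mem_bot (G := BalancedTensor (Unitized R) A N.obj)).1 <|
            BalancedTensor.map₂_induction _ _ _ _ _ (Unitized.map_surjective ρ hρ) hps
              Function.surjective_id ⊥ (fun a n ha => ?_) (fun a n hn => ?_) hx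
          -- If `p a = 0`, then `a ⊗ n = a r ⊗ n = a ⊗ r n`, and `r n = 0` because `r` vanishes in
          -- the quotient ring.
          · obtain ⟨r, hr, hra⟩ := hp' a ha
            have : (inr r : Unitized R) • n = 0 := by
              change Unitized.map ρ (inr r) • n = 0
              rw [Unitized.map_inr, hr, map_zero, zero_smul]
            rw [AddSubgroup.mem_bot, ← hra, BalancedTensor.smul_tmul, this,
              BalancedTensor.tmul_zero]
          · rw [AddSubgroup.mem_bot, show n = 0 from hn, BalancedTensor.tmul_zero],
        BalancedTensor.map₂_surjective _ _ _ _ _ hps Function.surjective_id⟩).toAddCommGrpIso)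
    (fun {N N'} f => by
      let _ : Module (Unitized R) N.obj := Module.compHom _ (Unitized.map ρ)
      let _ : Module (Unitized R) N'.obj := Module.compHom _ (Unitized.map ρ)
      refine AddCommGrpCat.hom_ext ?_
      exact BalancedTensor.hom_ext fun a n => rfl)

end

lemma AddCommGrpCat.exact_conj {A B C A' B' C' : AddCommGrpCat.{u}} {f : A ⟶ B} {g : B ⟶ C}
    (h : Function.Exact f g) (a : A ≅ A') (b : B ≅ B') (c : C ≅ C') :
    Function.Exact (a.inv ≫ f ≫ b.hom) (b.inv ≫ g ≫ c.hom) := by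
  have w : f ≫ g = 0 := AddCommGrpCat.hom_ext (AddMonoidHom.ext h.apply_apply_eq_zero)
  have h' : (ShortComplex.mk f g w).Exact := (ShortComplex.ab_exact_iff_function_exact _).2 h
  exact (ShortComplex.ab_exact_iff_function_exact (ShortComplex.mk (a.inv ≫ f ≫ b.hom)
    (b.inv ≫ g ≫ c.hom) (by simp [reassoc_of% w]))).1
    (ShortComplex.exact_of_iso (ShortComplex.isoMk a b c (by simp) (by simp)) h')

/-! ### Excision for the closed reduction and the long exact sequence -/

namespace AmpleGroupoid

variable (G : AmpleGroupoid.{u}) {U : Set G.Obj} (hU : IsOpen U) (hinv : G.IsInvariant U)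

/-- The functor from unitary `ℤG_C^C`-modules to unitary `ℤG`-modules. -/
noncomputable abbrev closedInflation :
    UnitaryMod (G.closedPart U hU hinv).Alg ⥤ UnitaryMod G.Alg :=
  inflation (G.resClosed U hU hinv) (Alg.res_surjective hU.isClosed_compl)

/-- If `P` is projective, then `P / ℤG_U^U · P` is flat. -/
lemma isFlat_quotient_idealPart (P : Type u) [AddCommGroup P] [Module (Unitized G.Alg) P]
    [Module.Projective (Unitized G.Alg) P] :
    BalancedTensor.IsFlat (Unitized G.Alg) (P ⧸ G.idealPart hU hinv P) := by
  classical
  let φ := G.extOpen U hU hinv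
  -- The image of `ℤG_U^U` in the unitization of `ℤG` is again a two-sided ideal, since the adjoined
  -- integers act by multiples; local units of `ℤG_U^U` serve as its right units.
  let J : Submodule (Unitized G.Alg) (Unitized G.Alg) :=
    { carrier := Set.range fun i => Unitized.inr (φ i)
      add_mem' := by
        rintro _ _ ⟨i, rfl⟩ ⟨j, rfl⟩
        exact ⟨i + j, by simp only [map_add]⟩
      zero_mem' := ⟨0, by simp only [map_zero]⟩
      smul_mem' := by
        rintro s _ ⟨i, rfl⟩
        exact exists_mul_inr φ (G.exists_extOpen_eq_mul hU hinv) s i }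
  refine .quotient J ?_ ?_ _ ?_
  · rintro _ ⟨i, rfl⟩ s
    obtain ⟨n, r, rfl⟩ := Unitized.exists_eq s
    obtain ⟨j, hj⟩ := G.exists_extOpen_eq_mul' hU hinv i r
    exact ⟨n • i + j, by simp [φ, mul_add, hj, (Int.cast_commute n _).eq]⟩
  · intro F hF
    choose! i hi using hF
    obtain ⟨e, -, he⟩ := HasLocalUnits.exists_unit (F.image i)
    refine ⟨_, ⟨e, rfl⟩, fun j hj => ?_⟩
    rw [← hi j hj]
    simp only [← map_mul]
    rw [(he _ (Finset.mem_image_of_mem i hj)).2]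
  · rw [idealPart]
    congr 1
    ext x
    constructor
    · rintro ⟨f, m, rfl⟩
      exact ⟨_, ⟨f, rfl⟩, m, rfl⟩
    · rintro ⟨_, ⟨f, rfl⟩, m, rfl⟩
      exact ⟨f, m, rfl⟩

/-- Let `Q` be a projective unitary `ℤG`-module mapping onto `P`. The ideal `I = ℤG_U^U` acts on `P`
as zero, so the map factors through `Q / I Q`, and the induced surjection splits over `ℤG_C^C`. Thus
`P` is a retract of the flat module `Q / I Q`, which in general is not projective over `ℤG`. -/
lemma isFlat_closedInflation (P : UnitaryMod (G.closedPart U hU hinv).Alg) [Projective P] :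
    BalancedTensor.IsFlat (Unitized G.Alg) ((G.closedInflation hU hinv).obj P).obj := by
  let ρ := G.resClosed U hU hinv
  let X : UnitaryMod G.Alg := (G.closedInflation hU hinv).obj P
  let Q := Projective.over X
  let π : Q.obj →ₗ[Unitized G.Alg] X.obj := (Projective.π X).hom.hom
  have hπ : Function.Surjective π := UnitaryMod.surjective_of_epi (Projective.π X)
  have hker : G.idealPart hU hinv Q.obj ≤ LinearMap.ker π := by
    refine Submodule.span_le.2 ?_
    rintro _ ⟨f, y, rfl⟩
    rw [SetLike.mem_coe, LinearMap.mem_ker, map_smul]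
    let z : P.obj := π y
    change Unitized.map ρ (Unitized.inr _) • z = 0
    rw [Unitized.map_inr, (G.resClosed_eq_zero_iff hU hinv _).2 ⟨f, rfl⟩, map_zero, zero_smul]
  let π' : (Q.obj ⧸ G.idealPart hU hinv Q.obj) →ₗ[Unitized G.Alg] X.obj :=
    (G.idealPart hU hinv Q.obj).liftQ π hker
  -- The two actions on `Q / I Q` agree along restriction, so linearity over `ℤG_C^C` and over `ℤG`
  -- can be exchanged.
  have hact (s : Unitized G.Alg) (y : (G.closedCoeff hU hinv Q).obj) :
      Unitized.map ρ s • y = s • show Q.obj ⧸ G.idealPart hU hinv Q.obj from y :=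
    G.closedAction_map hU hinv Q.obj s y
  let f : (G.closedCoeff hU hinv Q).obj →ₗ[Unitized (G.closedPart U hU hinv).Alg] P.obj :=
    { π'.toAddMonoidHom with
      map_smul' := fun s y => by
        obtain ⟨s, rfl⟩ := G.unitizedMap_resClosed_surjective hU hinv s
        exact (congrArg π' (hact s y)).trans (π'.map_smul s y) }
  let f₀ : ModuleCat.of _ (G.closedCoeff hU hinv Q).obj ⟶ ModuleCat.of _ P.obj := ModuleCat.ofHom f
  let f' : G.closedCoeff hU hinv Q ⟶ P := (IsUnitary _).homMk f₀
  have hf : Epi f' := by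
    refine UnitaryMod.epi_of_surjective _ fun n => ?_
    obtain ⟨y, hy⟩ := hπ n
    exact ⟨(G.idealPart hU hinv Q.obj).mkQ y, hy⟩
  let s : P ⟶ G.closedCoeff hU hinv Q := Projective.factorThru (𝟙 P) f'
  have hs : s ≫ f' = 𝟙 P := Projective.factorThru_comp _ _
  let i : X.obj →ₗ[Unitized G.Alg] Q.obj ⧸ G.idealPart hU hinv Q.obj :=
    { s.hom.hom.toAddMonoidHom with
      map_smul' := fun t n => (s.hom.hom.map_smul (Unitized.map ρ t) n).trans (hact t _) }
  have := UnitaryMod.module_projective Q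
  exact (G.isFlat_quotient_idealPart hU hinv Q.obj).of_retract i π'
    (LinearMap.ext fun n => congrArg (fun f : P ⟶ P => f.hom n) hs)

/-- The module `M / ℤG_U^U · M` over `ℤG` is the inflation of the corresponding module over
`ℤG_C^C`. -/
noncomputable def closedInflationCoeffIso (M : UnitaryMod G.Alg) :
    (G.closedInflation hU hinv).obj (G.closedCoeff hU hinv M) ≅ G.quotMod hU hinv M :=
  let e : ((G.closedInflation hU hinv).obj (G.closedCoeff hU hinv M)).obj ≃ₗ[Unitized G.Alg]
      M.obj ⧸ G.idealPart hU hinv M.obj :=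
    { AddEquiv.refl (M.obj ⧸ G.idealPart hU hinv M.obj) with
      map_smul' := G.closedAction_map hU hinv M.obj }
  (IsUnitary _).isoMk e.toModuleIso

/-- The homology of a closed invariant reduction of `G` is homology of `G`. -/
lemma nonempty_homology_closedPart_iso (M : UnitaryMod G.Alg) (n : ℕ) :
    Nonempty ((G.homology n).obj (G.quotMod hU hinv M) ≅
      ((G.closedPart U hU hinv).homology n).obj (G.closedCoeff hU hinv M)) := by
  let p : G.ObjAlg →+ (G.closedPart U hU hinv).ObjAlg := ObjAlg.res hU.isClosed_compl
  have hp (s : Unitized G.Alg) (a : G.ObjAlg) : p (MulOpposite.op s • a) =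
      MulOpposite.op (Unitized.map (G.resClosed U hU hinv) s) • p a := by
    refine Unitized.map_op_smul_of_inr _ _ (fun r a => ?_) s a
    rw [ObjAlg.op_inr_smul, ObjAlg.op_inr_smul, ObjAlg.res_actHom]
  -- A function that vanishes on `C` has compact open support inside `U`; the characteristic
  -- function of this support lies in `ℤG_U^U` and fixes it.
  have hp' (a : G.ObjAlg) (ha : p a = 0) : ∃ r, G.resClosed U hU hinv r = 0 ∧
      MulOpposite.op (Unitized.inr r) • a = a := by
    obtain ⟨f, hf⟩ := ObjAlg.exists_actHom_ext0_eq (hX := hU.isLocallyClosed) (hinv := hinv) hU a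
      fun x hx => congrFun (congrArg ObjAlg.val ha) ⟨x, hx⟩
    exact ⟨G.extOpen U hU hinv f, (G.resClosed_eq_zero_iff hU hinv _).2 ⟨f, rfl⟩, by
      rw [ObjAlg.op_inr_smul, hf]⟩
  obtain ⟨e⟩ := Functor.nonempty_leftDerived_iso
    ((IsUnitary G.Alg).ι ⋙ tensorFunctor (Unitized G.Alg) G.ObjAlg)
    ((IsUnitary _).ι ⋙ tensorFunctor (Unitized (G.closedPart U hU hinv).Alg)
      (G.closedPart U hU hinv).ObjAlg)
    (G.closedInflation hU hinv) (inflation_shortExact _ _)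
    (tensorInflationIso _ _ p (ObjAlg.res_surjective _) hp hp').symm
    (fun P _ n => UnitaryMod.isZero_torFunctor_of_isFlat G.ObjAlg _
      (G.isFlat_closedInflation hU hinv P) n) n (G.closedCoeff hU hinv M)
  exact ⟨(e ≪≫ (G.homology n).mapIso (G.closedInflationCoeffIso hU hinv M)).symm⟩

lemma shortExact_idealIncl_quotProj (M : UnitaryMod G.Alg) :
    ∃ w, (ShortComplex.mk (G.idealIncl hU hinv M) (G.quotProj hU hinv M) w).ShortExact := by
  have h : Function.Exact (G.idealPart hU hinv M.obj).subtype (G.idealPart hU hinv M.obj).mkQ := by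
    rw [LinearMap.exact_iff]; simp
  refine ⟨?_, (UnitaryMod.shortExact_iff _).2
    ⟨Subtype.val_injective, h, Submodule.mkQ_surjective _⟩⟩
  apply (IsUnitary G.Alg).ι.map_injective
  refine ModuleCat.hom_ext (LinearMap.ext fun x => ?_)
  exact h.apply_apply_eq_zero x

/-- The long exact `Tor` sequence of `0 → ℤG_U^U · M → M → M / ℤG_U^U · M → 0` over `ℤG` alone; the
reductions enter only through the excision isomorphisms. -/
lemma exists_homology_longExact (M : UnitaryMod G.Alg) :
    ∃ δ : ∀ n : ℕ, (G.homology (n + 1)).obj (G.quotMod hU hinv M) ⟶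
        (G.homology n).obj (G.idealMod hU hinv M),
      (∀ n, Function.Exact (δ n) ((G.homology n).map (G.idealIncl hU hinv M))) ∧
      (∀ n, Function.Exact ((G.homology n).map (G.idealIncl hU hinv M))
        ((G.homology n).map (G.quotProj hU hinv M))) ∧
      (∀ n, Function.Exact ((G.homology (n + 1)).map (G.quotProj hU hinv M)) (δ n)) ∧
      Function.Surjective ((G.homology 0).map (G.quotProj hU hinv M)) := by
  obtain ⟨w, hS⟩ := G.shortExact_idealIncl_quotProj hU hinv M
  obtain ⟨δ, h₁, h₂, h₃, h₄⟩ := Functor.exists_leftDerived_longExact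
    ((IsUnitary G.Alg).ι ⋙ tensorFunctor (Unitized G.Alg) G.ObjAlg) hS
  exact ⟨δ, fun n => (ShortComplex.ab_exact_iff_function_exact _).1 (h₁ n).choose_spec,
    fun n => (ShortComplex.ab_exact_iff_function_exact _).1 (h₂ n).choose_spec,
    fun n => (ShortComplex.ab_exact_iff_function_exact _).1 (h₃ n).choose_spec,
    (AddCommGrpCat.epi_iff_surjective _).1 h₄⟩

end AmpleGroupoid

theorem theoremt (G : AmpleGroupoid.{u}) (M : UnitaryMod G.Alg)
    (U : Set G.Obj) (hU : IsOpen U) (hinv : G.IsInvariant U) :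
    ∃ (φ : ∀ n : ℕ, ((G.openPart U hU hinv).homology n).obj (G.openCoeff hU hinv M) ≅
          (G.homology n).obj (G.idealMod hU hinv M))
      (ψ : ∀ n : ℕ, (G.homology n).obj (G.quotMod hU hinv M) ≅
          ((G.closedPart U hU hinv).homology n).obj (G.closedCoeff hU hinv M))
      (f : ∀ n : ℕ, ((G.openPart U hU hinv).homology n).obj (G.openCoeff hU hinv M) ⟶
          (G.homology n).obj M)
      (g : ∀ n : ℕ, (G.homology n).obj M ⟶
          ((G.closedPart U hU hinv).homology n).obj (G.closedCoeff hU hinv M))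
      (δ : ∀ n : ℕ, ((G.closedPart U hU hinv).homology (n + 1)).obj (G.closedCoeff hU hinv M) ⟶
          ((G.openPart U hU hinv).homology n).obj (G.openCoeff hU hinv M)),
      (∀ n, f n = (φ n).hom ≫ (G.homology n).map (G.idealIncl hU hinv M)) ∧
      (∀ n, g n = (G.homology n).map (G.quotProj hU hinv M) ≫ (ψ n).hom) ∧
      (∀ n, Function.Exact (δ n) (f n)) ∧
      (∀ n, Function.Exact (f n) (g n)) ∧
      (∀ n, Function.Exact (g (n + 1)) (δ n)) ∧
      Function.Surjective (g 0) := by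
  -- The isomorphisms are chosen separately in each degree, without naturality. This is harmless,
  -- because all maps of the final sequence, including the connecting ones, are defined by transport
  -- along them, and exactness is invariant under such transport.
  let φ n := (G.nonempty_homology_openPart_iso hU hinv M n).some
  let ψ n := (G.nonempty_homology_closedPart_iso hU hinv M n).some
  obtain ⟨δ, h₁, h₂, h₃, h₄⟩ := G.exists_homology_longExact hU hinv M
  refine ⟨φ, ψ, fun n => (φ n).hom ≫ (G.homology n).map (G.idealIncl hU hinv M),
    fun n => (G.homology n).map (G.quotProj hU hinv M) ≫ (ψ n).hom,
    fun n => (ψ (n + 1)).inv ≫ δ n ≫ (φ n).inv, fun _ => rfl, fun _ => rfl,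
    fun n => ?_, fun n => ?_, fun n => ?_, ?_⟩
  · simpa using AddCommGrpCat.exact_conj (h₁ n) (ψ (n + 1)) (φ n).symm (Iso.refl _)
  · simpa using AddCommGrpCat.exact_conj (h₂ n) (φ n).symm (Iso.refl _) (ψ n)
  · simpa using AddCommGrpCat.exact_conj (h₃ n) (Iso.refl _) (ψ (n + 1)) (φ n).symm
  · have h := (AddCommGrpCat.epi_iff_surjective _).2 h₄
    exact (AddCommGrpCat.epi_iff_surjective _).1 inferInstance
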